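/- **Notation.** For $n\ge 0$ and a partition $\alpha\vdash n$ let $\ell(\alpha)$ be its number of parts, and let $C_\alpha\in\mathbb{Q}(\mathfrak{S}_n)$ be the sum of all permutations of cycle type $\alpha$. Let $\mathcal{J}_k=\sum_{i<k}(i\;k)$, $2\le k\le n$, be the Jucys–Murphy elements. For $b\ge 0$ put $$B^{<}_b=\sum_{2\le k_1<\dots<k_b\le n}\mathcal{J}_{k_1}\cdots\mathcal{J}_{k_b},\qquad B^{\le}_b=\sum_{2\le k_1\le\dots\le k_b\le n}\mathcal{J}_{k_1}\cdots\mathcal{J}_{k_b},\qquad B^{|}_b=\sum_{\alpha\vdash n,\ \ell(\alpha)=n-b}C_\alpha,$$ $$B^{||}_b=\sum_{k=0}^{b}(-1)^{k+b}\sum_{\substack{\alpha_1,\dots,\alpha_k\vdash n,\ \alpha_i\ne(1^n)\\ \sum_i\ell(\alpha_i)=kn-b}}C_{\alpha_1}\cdots C_{\alpha_k}$$ (the term $k=0$ is the empty product $1$ and contributes only for $b=0$). For $\mu,\nu\vdash n$ and $B\in\mathbb{Q}(\mathfrak{S}_n)$ the disconnected double Hurwitz number is $h^\bullet_{\mu,\nu,B}=\frac1{n!}\,[C_{(1^n)}]\,C_\mu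 C_\nu B$, i.e. $\frac1{n!}$ times the coefficient of the identity permutation in $C_\mu C_\nu B$. Let $w=(w_a)$ and $z=(z_b)$ be two families of variables, finite or infinite. With $s_\lambda(\mathbf t)=\det(h_{\lambda_i-i+j}(\mathbf t))$, where $\sum_k h_k(\mathbf t)x^k=\exp(\sum_{i\ge1}t_ix^i)$, the hypergeometric tau-function is the formal power series $$\tau_{(q,w,z)}(\mathbf t,\tilde{\mathbf t})=\sum_{n\ge0}q^n\sum_{\lambda\vdash n}\ \prod_{x\in\lambda}\frac{\prod_a(1+c(x)w_a)}{\prod_b(1-c(x)z_b)}\ s_\lambda(\mathbf t)\,s_\lambda(\tilde{\mathbf t}),$$ where $x$ runs over the boxes of $\lambda$ and $c(x)$ is its content (column index minus row index). Write $p_k(\mathbf t)=kt_k$ and $p_\mu=p_{\mu_1}p_{\mu_2}\cdots$. **Theorem (Harnad–Orlov correspondence).** 1. For all $n,b\ge0$ the elements $B^{<}_b$ and $B^{\le}_b$ are central in $\mathbb{Q}(\mathfrak{S}_n)$, and $B^{<}_b=B^{|}_b$, $B^{\le}_b=B^{||}_b$. 2. Let $n\ge0$, $\mu,\nu\vdash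 n$, and let $c=(c_a)$, $d=(d_b)$ be finitely supported families of non-negative integers. Then the coefficient of $q^n\prod_a w_a^{c_a}\prod_b z_b^{d_b}\,p_\mu(\mathbf t)\,p_\nu(\tilde{\mathbf t})$ in $\tau_{(q,w,z)}(\mathbf t,\tilde{\mathbf t})$ equals $h^\bullet_{\mu,\nu,B}$ with $$B=\prod_aB^{<}_{c_a}\prod_bB^{\le}_{d_b},$$ and also equals $h^\bullet_{\mu,\nu,B}$ with $$B=\prod_aB^{|}_{c_a}\prod_bB^{||}_{d_b}.$$ Here each product runs, in any order, over a finite set of indices containing the support of $c$, respectively of $d$. If this coefficient is non-zero, then the Riemann–Hurwitz equation $\sum_ac_a+\sum_bd_b=2g-2+\ell(\mu)+\ell(\nu)$ holds for an integer $g$. 3. The coefficient of $q^n\prod_a w_a^{c_a}\prod_b z_b^{d_b}\,p_\mu(\mathbf t)\,p_\nu(\tilde{\mathbf t})$ vanishes unless $|\mu|=|\nu|=n$. -/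

import Mathlib

open scoped MvPowerSeries.WithPiTopology

noncomputable section

namespace HarnadOrlov

/-! ### Partitions, Young diagrams, Schur functions -/

/-- The number of parts `ℓ(α)` of a partition. -/
def len {n : ℕ} (α : n.Partition) : ℕ := Multiset.card α.parts

/-- The Young diagram (English convention: cells `(row, column)`, row lengths weakly decreasing)
of a partition. -/
def diagram {n : ℕ} (lam : n.Partition) : YoungDiagram :=
  YoungDiagram.ofRowLens (lam.parts.sort (· ≥ ·)) (Multiset.pairwise_sort _ _).sortedGE

/-- The content (column index minus row index) of a cell `(row, column)`. -/
def content (x : ℕ × ℕ) : ℤ := (x.2 : ℤ) - (x.1 : ℤ)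

/-- The elementary Schur polynomial `h_k` in the times `t₁, t₂, …`, defined by
`∑ₖ h_k xᵏ = exp (∑_{i ≥ 1} tᵢ xⁱ)`, with `h_k = 0` for `k < 0`. -/
def elemSchur {A : Type*} [CommRing A] [Algebra ℚ A] (t : ℕ+ → A) (k : ℤ) : A :=
  if k < 0 then 0
  else PowerSeries.coeff k.toNat
    ((PowerSeries.exp A).subst
      (PowerSeries.mk fun i : ℕ => if h : 0 < i then t ⟨i, h⟩ else 0))

/-- The Schur function `s_λ(t) = det (h_{λᵢ - i + j}(t))_{1 ≤ i, j ≤ ℓ(λ)}` in the times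
`t₁, t₂, …`. -/
def schur {A : Type*} [CommRing A] [Algebra ℚ A] (t : ℕ+ → A) (Y : YoungDiagram) : A :=
  Matrix.det (Matrix.of fun i j : Fin (Y.colLen 0) =>
    elemSchur t ((Y.rowLen i : ℤ) - ((i : ℕ) : ℤ) + ((j : ℕ) : ℤ)))

/-! ### The hypergeometric tau-function -/

/-- The variables of the hypergeometric tau-function: `q`, the parameters `w_a`, `z_b`, and the two
sets of rescaled times `p_k = k t_k`, `p̃_k = k t̃_k`, `k ≥ 1`. -/
inductive Var (L M : Type*) where
  | q : Var L M
  | w (a : L) : Var L M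
  | z (b : M) : Var L M
  | p (k : ℕ+) : Var L M
  | pt (k : ℕ+) : Var L M

/-- Formal power series in all the variables. Infinite sums and products are taken in the topology
of coefficientwise convergence. -/
abbrev Series (L M : Type*) := MvPowerSeries (Var L M) ℚ

/-- The times `t_k = p_k / k`. -/
def timeT (L M : Type*) (k : ℕ+) : Series L M := ((k : ℕ) : ℚ)⁻¹ • MvPowerSeries.X (Var.p k)

/-- The times `t̃_k = p̃_k / k`. -/
def timeTt (L M : Type*) (k : ℕ+) : Series L M := ((k : ℕ) : ℚ)⁻¹ • MvPowerSeries.X (Var.pt k)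

/-- `∏_a (1 + x w_a)`. -/
def wProd (L M : Type*) (x : ℤ) : Series L M :=
  ∏' a : L, (1 + MvPowerSeries.C (x : ℚ) * MvPowerSeries.X (Var.w a))

/-- `∏_b (1 - x z_b)`. -/
def zProd (L M : Type*) (x : ℤ) : Series L M :=
  ∏' b : M, (1 - MvPowerSeries.C (x : ℚ) * MvPowerSeries.X (Var.z b))

/-- The term of degree `n` in `q` of the hypergeometric tau-function. -/
def tauTerm (L M : Type*) (n : ℕ) : Series L M :=
  MvPowerSeries.X Var.q ^ n *
    ∑ lam : n.Partition,
      (∏ x ∈ (diagram lam).cells, wProd L M (content x) * (zProd L M (content x))⁻¹) *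
        schur (timeT L M) (diagram lam) * schur (timeTt L M) (diagram lam)

/-- The hypergeometric tau-function
`∑ₙ qⁿ ∑_{λ ⊢ n} ∏_{x ∈ λ} (∏_a (1 + c(x) w_a) / ∏_b (1 - c(x) z_b)) s_λ(t) s_λ(t̃)`. -/
def tau (L M : Type*) : Series L M := ∑' n : ℕ, tauTerm L M n

/-- Convergence of `∏_a (1 + x u_a)` for distinct variables `u_a`. -/
theorem multipliable_linear {σ ι : Type*} (u : ι → σ) (hu : Function.Injective u) (x : ℚ) :
    Multipliable fun a : ι =>
      (1 + MvPowerSeries.C x * MvPowerSeries.X (u a) : MvPowerSeries σ ℚ) := by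
  classical
  apply multipliable_one_add_of_summable_prod
  have key : ∀ s : Finset ι,
      (∏ a ∈ s, (MvPowerSeries.C x * MvPowerSeries.X (u a) : MvPowerSeries σ ℚ)) =
        MvPowerSeries.monomial (∑ a ∈ s, Finsupp.single (u a) 1) (x ^ s.card) := by
    intro s
    induction s using Finset.induction_on with
    | empty => simp
    | insert a s ha ih =>
      rw [Finset.prod_insert ha, ih, Finset.sum_insert ha, Finset.card_insert_of_notMem ha,
        ← MvPowerSeries.monomial_zero_eq_C_apply, MvPowerSeries.X,
        MvPowerSeries.monomial_mul_monomial, MvPowerSeries.monomial_mul_monomial]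
      congr 1
      · simp
      · ring
  rw [MvPowerSeries.WithPiTopology.summable_iff_summable_coeff]
  intro e
  have hinj : Function.Injective fun s : Finset ι => ∑ a ∈ s, Finsupp.single (u a) 1 := by
    intro s t h
    ext a
    have h1 : ∀ r : Finset ι,
        (∑ b ∈ r, Finsupp.single (u b) 1 : σ →₀ ℕ) (u a) = if a ∈ r then 1 else 0 := by
      intro r
      rw [Finsupp.finsetSum_apply]
      simp [Finsupp.single_apply, hu.eq_iff]
    have h2 := DFunLike.congr_fun h (u a)
    simp only [h1] at h2
    by_cases hs : a ∈ s <;> by_cases ht : a ∈ t <;> simp_all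
  apply summable_of_hasFiniteSupport
  refine Set.Subsingleton.finite ?_
  intro s hs t ht
  apply hinj
  simp only [Function.mem_support, key, MvPowerSeries.coeff_monomial] at hs ht
  have hs' := (ite_ne_right_iff.mp hs).1
  have ht' := (ite_ne_right_iff.mp ht).1
  exact hs'.symm.trans ht'

theorem multipliable_wProd (L M : Type*) (x : ℤ) :
    Multipliable fun a : L =>
      (1 + MvPowerSeries.C (x : ℚ) * MvPowerSeries.X (Var.w a) : Series L M) :=
  multipliable_linear _ (fun a b h => by cases h; rfl) _

theorem multipliable_zProd (L M : Type*) (x : ℤ) :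
    Multipliable fun b : M =>
      (1 - MvPowerSeries.C (x : ℚ) * MvPowerSeries.X (Var.z b) : Series L M) := by
  have h := multipliable_linear (Var.z : M → Var L M) (fun a b h => by cases h; rfl) (-(x : ℚ))
  refine h.congr fun b => ?_
  rw [map_neg, neg_mul, ← sub_eq_add_neg]

theorem summable_tauTerm (L M : Type*) : Summable (tauTerm L M) := by
  rw [MvPowerSeries.WithPiTopology.summable_iff_summable_coeff]
  intro e
  apply summable_of_hasFiniteSupport
  refine (Set.finite_Iic (e Var.q)).subset ?_
  intro n hn
  by_contra hlt
  exact hn (MvPowerSeries.X_pow_dvd_iff.mp (Dvd.intro _ rfl) e (not_le.mp hlt))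

/-- The exponent of the monomial `p_μ = p_{μ₁} p_{μ₂} ⋯`. -/
def partExp {n : ℕ} (μ : n.Partition) : ℕ+ →₀ ℕ :=
  Finsupp.comapDomain PNat.val (Multiset.toFinsupp μ.parts) PNat.coe_injective.injOn

/-- The exponent of the monomial `qⁿ ∏_a w_a^{c_a} ∏_b z_b^{d_b} p_μ(t) p_ν(t̃)`. -/
def tauExp {L M : Type*} (n : ℕ) (c : L →₀ ℕ) (d : M →₀ ℕ)
    {k k' : ℕ} (μ : k.Partition) (ν : k'.Partition) : Var L M →₀ ℕ :=
  Finsupp.single Var.q n + c.mapDomain Var.w + d.mapDomain Var.z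
    + (partExp μ).mapDomain Var.p + (partExp ν).mapDomain Var.pt

/-! ### Blocks and Hurwitz numbers -/

/-- The group algebra of the symmetric group on `n` points. -/
abbrev GA (n : ℕ) := MonoidAlgebra ℚ (Equiv.Perm (Fin n))

/-- The formal sum `C_α` of all permutations of cycle type `α` (fixed points are counted as
parts equal to `1`). -/
def classSum {n : ℕ} (α : n.Partition) : GA n :=
  ∑ g : Equiv.Perm (Fin n) with g.partition.parts = α.parts, MonoidAlgebra.single g 1

/-- The Jucys-Murphy elements `J_{k+2} = ∑_{i < k+2} (i  k+2)`, for `k + 2 = 2, …, n`; the points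
`1, …, n` are written as `0, …, n - 1`. -/
def jucysMurphy (n : ℕ) (k : Fin (n - 1)) : GA n :=
  ∑ i ∈ Finset.univ.filter (fun i : Fin n => (i : ℕ) < (k : ℕ) + 1),
    MonoidAlgebra.single (Equiv.swap i ⟨(k : ℕ) + 1, by omega⟩) 1

/-- The value `∑_{i₁ < ⋯ < i_b} x_{i₁} ⋯ x_{i_b}` of the elementary symmetric polynomial. -/
def elemSym {A : Type*} [Semiring A] {m : ℕ} (x : Fin m → A) (b : ℕ) : A :=
  ∑ f : Fin b → Fin m with StrictMono f, (List.ofFn fun i => x (f i)).prod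

/-- The value `∑_{i₁ ≤ ⋯ ≤ i_b} x_{i₁} ⋯ x_{i_b}` of the complete homogeneous polynomial. -/
def complSym {A : Type*} [Semiring A] {m : ℕ} (x : Fin m → A) (b : ℕ) : A :=
  ∑ f : Fin b → Fin m with Monotone f, (List.ofFn fun i => x (f i)).prod

/-- The strictly monotone block `B^<_b`. -/
def strictMonoBlock (n b : ℕ) : GA n := elemSym (jucysMurphy n) b

/-- The monotone block `B^≤_b`. -/
def monoBlock (n b : ℕ) : GA n := complSym (jucysMurphy n) b

/-- The free single block `B^|_b`: the sum of `C_α` over the partitions with `n - b` parts. -/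
def freeSingleBlock (n b : ℕ) : GA n :=
  ∑ α : n.Partition with len α + b = n, classSum α

/-- The free group block `B^||_b`: the signed sum of the products `C_{α₁} ⋯ C_{α_k}` over the
`k`-tuples of classes different from the class of the identity and with
`∑ᵢ (n - ℓ(αᵢ)) = b`. The value `k = 0` contributes (the empty product `1`) only for `b = 0`. -/
def freeGroupBlock (n b : ℕ) : GA n :=
  ∑ k ∈ Finset.range (b + 1), (-1 : GA n) ^ (k + b) *
    ∑ α : Fin k → n.Partition with
        (∀ i, len (α i) ≠ n) ∧ (∑ i, len (α i)) + b = k * n,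
      (List.ofFn fun i => classSum (α i)).prod

/-- The disconnected double Hurwitz number
`h^•_{μ,ν,B} = (1 / n!) [C_{(1ⁿ)}] C_μ C_ν B`. -/
def hurwitz {n : ℕ} (μ ν : n.Partition) (B : GA n) : ℚ :=
  (n.factorial : ℚ)⁻¹ * (classSum μ * classSum ν * B).coeff 1

end HarnadOrlov

end

/-! The Schur function of λ is the Frobenius characteristic of an explicit class function `jtChar`:
in the Jacobi–Trudi determinant each product of h's is replaced by the permutation character of the
symmetric group on words of the corresponding content. Expanding Schur functions in power sums makes
the tau-function a sum over λ of two values of this class function times a content product. The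
Frobenius formula `hurwitz_eq_sum` expands a Hurwitz number in the same way, with the central
character of B in place of the content product. It remains to show that B^<_b and B^≤_b act on λ by
e_b and h_b of the contents of λ.

No irreducible modules are constructed. Orthonormality of the `jtChar` (`sum_jtChar_mul_jtChar`) is
read off a coefficient of the bialternant identity. A trace function of norm one that is integral on
idempotents is, by Wedderburn, an irreducible character up to sign
(`trace_function_mul_of_norm_one`), so the center acts through a multiplicative scalar
`centralChar`. The table of values is square, hence column orthogonality follows from row
orthogonality.

Contents come from branching. Restricted to one point less, `jtChar` is a sum over the boxes that
can be removed, and multiplying by the last Jucys–Murphy element weights each summand by the content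
of its box (`sum_jtChar_mul_swap`). The recursion of B^< in n then yields e_b of the contents
(`jtFun_strictMonoBlock`), and the identity (∑ (-1)^b B^<_b x^b)(∑ B^≤_b x^b) = 1 yields h_b.

Every permutation of n + 1 points is g or g · (i, n+1), with g fixing the last point, so B^|
satisfies the recursion of B^<; this is Jucys' theorem. B^|| is the geometric expansion of the
inverse of ∑ (-1)^b B^|_b x^b, hence equals B^≤. Centrality is visible on the class side. The
Riemann–Hurwitz equation is a parity statement, obtained by twisting the group algebra with the
sign. -/

namespace HarnadOrlov

/-! ### Exponentials of power series -/

section Exponential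

variable {A : Type*} [CommRing A] [Algebra ℚ A]

open PowerSeries in
-- The equation F' = F f' determines the coefficients of F recursively from its constant term,
-- because i + 1 is invertible in a ℚ-algebra, and the coefficient of degree i only sees f up to
-- degree i. The functional equation of `expSeries` and its behaviour under truncation both follow.
theorem coeff_eq_of_derivative_eq {F G f g : PowerSeries A} (m : ℕ)
    (hF : derivative A F = F * derivative A f) (hG : derivative A G = G * derivative A g)
    (h0 : constantCoeff F = constantCoeff G) (hfg : ∀ i ≤ m, coeff i f = coeff i g) :
    ∀ i ≤ m, coeff i F = coeff i G := by
  intro i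
  induction i using Nat.strong_induction_on with
  | _ i ih =>
    intro hi
    rcases i with _ | i
    · simpa using h0
    have h1 : coeff i (derivative A F) = coeff i (derivative A G) := by
      rw [hF, hG, coeff_mul, coeff_mul]
      refine Finset.sum_congr rfl fun p hp => ?_
      have hp' := Finset.HasAntidiagonal.mem_antidiagonal.mp hp
      rw [ih p.1 (by omega) (by omega), coeff_derivative, coeff_derivative,
        hfg (p.2 + 1) (by omega)]
    rw [coeff_derivative, coeff_derivative] at h1
    have hu : IsUnit ((i : A) + 1) := by
      have : ((i : A) + 1) = algebraMap ℚ A (i + 1) := by simp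
      rw [this]
      exact (IsUnit.mk0 _ (by positivity)).map _
    exact hu.mul_right_cancel h1

/-- The exponential of a power series without constant term. -/
noncomputable def expSeries (f : PowerSeries A) : PowerSeries A := (PowerSeries.exp A).subst f

open PowerSeries in
theorem derivative_expSeries {f : PowerSeries A} (hf : constantCoeff f = 0) :
    derivative A (expSeries f) = expSeries f * derivative A f := by
  have h := derivative_subst (f := PowerSeries.exp A) (HasSubst.of_constantCoeff_zero' hf)
  rwa [derivative_exp] at h

open PowerSeries in
theorem coeff_expSeries {f : PowerSeries A} (hf : constantCoeff f = 0) (n : ℕ) :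
    coeff n (expSeries f) =
      ∑ᶠ d : ℕ, coeff d (PowerSeries.exp A) • coeff n (f ^ d) :=
  coeff_subst' (HasSubst.of_constantCoeff_zero' hf) _ _

open PowerSeries in
theorem constantCoeff_expSeries {f : PowerSeries A} (hf : constantCoeff f = 0) :
    constantCoeff (expSeries f) = 1 := by
  rw [← coeff_zero_eq_constantCoeff_apply, coeff_expSeries hf, finsum_eq_single _ 0]
  · simp
  · intro d hd
    simp [hf, hd]

open PowerSeries in
-- Both sides solve y' = y (f + g)' with constant term 1.
theorem expSeries_add {f g : PowerSeries A} (hf : constantCoeff f = 0)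
    (hg : constantCoeff g = 0) : expSeries (f + g) = expSeries f * expSeries g := by
  have hfg : constantCoeff (f + g) = 0 := by simp [hf, hg]
  ext n
  refine coeff_eq_of_derivative_eq (f := f + g) (g := f + g) n (derivative_expSeries hfg) ?_ ?_
    (fun _ _ => rfl) n le_rfl
  · rw [Derivation.leibniz, derivative_expSeries hf, derivative_expSeries hg, map_add,
      smul_eq_mul, smul_eq_mul]
    ring
  · rw [map_mul, constantCoeff_expSeries hf, constantCoeff_expSeries hg,
      constantCoeff_expSeries hfg, one_mul]

theorem expSeries_zero : expSeries (0 : PowerSeries A) = 1 := by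
  have h0 : PowerSeries.constantCoeff (0 : PowerSeries A) = 0 := map_zero _
  ext n
  refine coeff_eq_of_derivative_eq (f := 0) (g := 0) n (derivative_expSeries h0) ?_ ?_
    (fun _ _ => rfl) n le_rfl
  · simp
  · rw [constantCoeff_expSeries h0, map_one]

open PowerSeries in
theorem expSeries_sum {ι : Type*} (s : Finset ι) (f : ι → PowerSeries A)
    (hf : ∀ i ∈ s, constantCoeff (f i) = 0) :
    expSeries (∑ i ∈ s, f i) = ∏ i ∈ s, expSeries (f i) := by
  classical
  induction s using Finset.induction_on with
  | empty => simp [expSeries_zero]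
  | insert a s ha ih =>
    rw [Finset.sum_insert ha, Finset.prod_insert ha, expSeries_add, ih]
    · exact fun i hi => hf i (Finset.mem_insert_of_mem hi)
    · exact hf a (Finset.mem_insert_self _ _)
    · rw [map_sum]
      exact Finset.sum_eq_zero fun i hi => hf i (Finset.mem_insert_of_mem hi)

open PowerSeries in
theorem coeff_expSeries_congr {f g : PowerSeries A} (hf : constantCoeff f = 0)
    (hg : constantCoeff g = 0) (m : ℕ) (hfg : ∀ i ≤ m, coeff i f = coeff i g) :
    coeff m (expSeries f) = coeff m (expSeries g) :=
  coeff_eq_of_derivative_eq m (derivative_expSeries hf) (derivative_expSeries hg)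
    (by rw [constantCoeff_expSeries hf, constantCoeff_expSeries hg]) hfg m le_rfl

open PowerSeries in
-- This expansion has the shape of a factor in `Nat.Partition.hasProd_genFun`. It is coefficientwise
-- finite because the exponent i + 1 is positive.
theorem hasSum_expSeries_monomial [TopologicalSpace A] (i : ℕ) (c : A) :
    HasSum (fun j : ℕ => (algebraMap ℚ A (1 / (j.factorial : ℚ)) * c ^ j) •
      (X : PowerSeries A) ^ ((i + 1) * j)) (expSeries (monomial (i + 1) c)) := by
  rw [PowerSeries.WithPiTopology.hasSum_iff_hasSum_coeff]
  intro n
  have h0 : constantCoeff (monomial (i + 1) c) = 0 := by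
    rw [← coeff_zero_eq_constantCoeff_apply, coeff_monomial, if_neg (by omega)]
  have hterm : ∀ d : ℕ, coeff d (PowerSeries.exp A) • coeff n (monomial (i + 1) c ^ d) =
      coeff n ((algebraMap ℚ A (1 / (d.factorial : ℚ)) * c ^ d) •
        (X : PowerSeries A) ^ ((i + 1) * d)) := by
    intro d
    rw [monomial_eq_C_mul_X_pow, mul_pow, ← map_pow, coeff_C_mul, ← pow_mul, coeff_exp]
    simp
  rw [coeff_expSeries h0]
  simp_rw [hterm]
  have hfin : Function.HasFiniteSupport fun d : ℕ =>
      coeff n ((algebraMap ℚ A (1 / (d.factorial : ℚ)) * c ^ d) •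
        (X : PowerSeries A) ^ ((i + 1) * d)) := by
    refine (Set.finite_Iic n).subset fun d hd => ?_
    by_contra hlt
    apply hd
    rw [Set.mem_Iic, not_le] at hlt
    dsimp only
    rw [map_smul, coeff_X_pow, if_neg, smul_zero]
    nlinarith
  rw [← tsum_eq_finsum (L := SummationFilter.unconditional ℕ) hfin]
  exact (summable_of_hasFiniteSupport hfin).hasSum

end Exponential

/-! ### Expansion of the elementary Schur polynomials over partitions. -/

section TimeSeries

variable {A : Type*} [CommRing A]

/-- The power series `∑_{i ≥ 1} tᵢ xⁱ`. -/
noncomputable def timeSeries (t : ℕ+ → A) : PowerSeries A :=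
  PowerSeries.mk fun i : ℕ => if h : 0 < i then t ⟨i, h⟩ else 0

theorem elemSchur_natCast [Algebra ℚ A] (t : ℕ+ → A) (k : ℕ) :
    elemSchur t k = PowerSeries.coeff k (expSeries (timeSeries t)) := by
  rw [elemSchur, if_neg (by omega), Int.toNat_natCast]
  rfl

theorem elemSchur_of_neg [Algebra ℚ A] (t : ℕ+ → A) {k : ℤ} (hk : k < 0) : elemSchur t k = 0 := if_pos hk

theorem constantCoeff_timeSeries (t : ℕ+ → A) :
    PowerSeries.constantCoeff (timeSeries t) = 0 := by
  rw [← PowerSeries.coeff_zero_eq_constantCoeff_apply]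
  simp [timeSeries]

theorem coeff_timeSeries_succ (t : ℕ+ → A) (i : ℕ) :
    PowerSeries.coeff (i + 1) (timeSeries t) = t i.succPNat := by
  simp [timeSeries, Nat.succPNat]

open PowerSeries in
-- The exponential is the product over i of exp(tᵢ xⁱ); picking the m-th term of the i-th factor
-- means using the part i exactly m times.
theorem coeff_expSeries_timeSeries [Algebra ℚ A] (t : ℕ+ → A) (n : ℕ) :
    coeff n (expSeries (timeSeries t)) = ∑ μ : n.Partition, μ.parts.toFinsupp.prod fun i m =>
      algebraMap ℚ A (1 / (m.factorial : ℚ)) * coeff i (timeSeries t) ^ m := by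
  let _ : TopologicalSpace A := ⊥
  have _ : DiscreteTopology A := ⟨rfl⟩
  -- Times beyond n do not affect degree n; cutting them off makes the infinite product finite.
  let c : ℕ → A := fun i => if i ≤ n then coeff i (timeSeries t) else 0
  let f : ℕ → ℕ → A := fun i m => algebraMap ℚ A (1 / (m.factorial : ℚ)) * c i ^ m
  have hmon : ∀ i : ℕ, constantCoeff (monomial (i + 1) (c (i + 1))) = 0 := by
    intro i
    rw [← coeff_zero_eq_constantCoeff_apply, coeff_monomial, if_neg (by omega)]
  have hfac : ∀ i : ℕ, (1 + ∑' j, f (i + 1) (j + 1) • (X : PowerSeries A) ^ ((i + 1) * (j + 1)))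
      = expSeries (monomial (i + 1) (c (i + 1))) := by
    intro i
    have h := hasSum_expSeries_monomial i (c (i + 1))
    rw [← h.tsum_eq, h.summable.tsum_eq_zero_add]
    simp [f]
  have hprod := Nat.Partition.hasProd_genFun f
  simp_rw [hfac] at hprod
  have hfin : Nat.Partition.genFun f =
      ∏ i ∈ Finset.range n, expSeries (monomial (i + 1) (c (i + 1))) := by
    refine hprod.unique (hasProd_prod_of_ne_finset_one fun i hi => ?_)
    have : c (i + 1) = 0 := if_neg (by simpa using hi)
    rw [this, map_zero, expSeries_zero]
  rw [← expSeries_sum _ _ fun i _ => hmon i] at hfin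
  have h1 : coeff n (expSeries (timeSeries t)) = coeff n (Nat.Partition.genFun f) := by
    rw [hfin]
    refine coeff_expSeries_congr (constantCoeff_timeSeries t) ?_ n ?_
    · rw [map_sum]
      exact Finset.sum_eq_zero fun i _ => hmon i
    · intro i hi
      rw [map_sum]
      rcases i with _ | i
      · rw [coeff_zero_eq_constantCoeff_apply, constantCoeff_timeSeries]
        exact (Finset.sum_eq_zero fun i _ => by
          rw [coeff_zero_eq_constantCoeff_apply, hmon]).symm
      · rw [Finset.sum_eq_single i]
        · rw [coeff_monomial_same]
          exact (if_pos hi).symm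
        · intro j _ hj
          rw [coeff_monomial, if_neg (by omega)]
        · intro h
          simp at h
          omega
  rw [h1, Nat.Partition.coeff_genFun]
  refine Finset.sum_congr rfl fun μ _ => Finset.prod_congr rfl fun i hi => ?_
  have hi' : i ∈ μ.parts := by simpa using hi
  simp [f, c, Nat.Partition.le_of_mem_parts hi']

end TimeSeries

/-! ### Class sizes and the cycle index -/

theorem partition_parts_sum {n : ℕ} (g : Equiv.Perm (Fin n)) : g.partition.parts.sum = n := by
  rw [g.partition.parts_sum, Fintype.card_fin]

/-- The partition of a permutation records fixed points as parts 1, whereas `cycleType` omits them.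
So the parts are split into those at least 2 and r ones, and the r! in the class size formula
becomes the multiplicity factor of the part 1. -/
theorem card_class_mul {n : ℕ} (μ : n.Partition) :
    (Finset.univ.filter fun g : Equiv.Perm (Fin n) => g.partition.parts = μ.parts).card *
      (μ.parts.prod * ∏ i ∈ μ.parts.toFinset, (μ.parts.count i).factorial) = n.factorial := by
  classical
  set m := μ.parts.filter (2 ≤ ·) with hm
  set r := μ.parts.count 1 with hr
  have hsplit : μ.parts = m + Multiset.replicate r 1 := by
    have h := Multiset.filter_add_not (2 ≤ ·) μ.parts
    rw [← h, ← hm]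
    congr 1
    rw [Multiset.eq_replicate]
    refine ⟨?_, fun b hb => ?_⟩
    · rw [hr, Multiset.count, Multiset.countP_eq_card_filter]
      congr 1
      refine Multiset.filter_congr fun x hx => ?_
      have := μ.parts_pos hx
      omega
    · have h1 := (Multiset.mem_filter.mp hb).2
      have := μ.parts_pos (Multiset.mem_filter.mp hb).1
      omega
  have hsum : m.sum + r = n := by
    have := μ.parts_sum
    rw [hsplit] at this
    simpa using this
  have hset : (Finset.univ.filter fun g : Equiv.Perm (Fin n) => g.partition.parts = μ.parts) =
      Finset.univ.filter fun g : Equiv.Perm (Fin n) => g.cycleType = m := by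
    ext g
    simp only [Finset.mem_filter, Finset.mem_univ, true_and]
    constructor
    · intro h
      rw [← Equiv.Perm.filter_parts_partition_eq_cycleType, h]
    · intro h
      rw [Equiv.Perm.parts_partition, h, hsplit, ← Equiv.Perm.sum_cycleType, h, Fintype.card_fin]
      congr 2
      omega
  have h := Equiv.Perm.card_of_cycleType_mul_eq (Fin n) m
  rw [if_pos ⟨by rw [Fintype.card_fin]; omega, fun a ha => (Multiset.mem_filter.mp ha).2⟩,
    Fintype.card_fin] at h
  rw [hset, ← h]
  congr 1
  have h1 : n - m.sum = r := by omega
  have hprod : μ.parts.prod = m.prod := by rw [hsplit]; simp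
  have hm1 : 1 ∉ m := fun h => by
    have := (Multiset.mem_filter.mp h).2
    omega
  have hcount : ∀ i ∈ m.toFinset, μ.parts.count i = m.count i := by
    intro i hi
    have h2 := (Multiset.mem_filter.mp (Multiset.mem_toFinset.mp hi)).2
    rw [hm, Multiset.count_filter_of_pos h2]
  -- The part 1 is inserted even when it does not occur; it then contributes 0! = 1.
  have hfac : ∏ i ∈ μ.parts.toFinset, (μ.parts.count i).factorial =
      ∏ i ∈ insert 1 m.toFinset, (μ.parts.count i).factorial := by
    refine Finset.prod_subset (fun i hi => ?_) fun i _ hi => ?_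
    · rw [Multiset.mem_toFinset, hsplit, Multiset.mem_add] at hi
      rcases hi with hi | hi
      · exact Finset.mem_insert_of_mem (Multiset.mem_toFinset.mpr hi)
      · rw [Multiset.eq_of_mem_replicate hi]
        exact Finset.mem_insert_self _ _
    · rw [Multiset.mem_toFinset, ← Multiset.count_eq_zero] at hi
      rw [hi, Nat.factorial_zero]
  rw [h1, hprod, hfac, Finset.prod_insert (by simpa using hm1), Finset.prod_congr rfl
    fun i hi => by rw [hcount i hi]]
  ring

/-- The product `∏ y_{|c|}` over the cycles `c` of a permutation, including the fixed points. -/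
def cycleProd {A : Type*} [CommMonoid A] {n : ℕ} (y : ℕ → A) (g : Equiv.Perm (Fin n)) : A :=
  (g.partition.parts.map y).prod

theorem exists_partition_parts_eq {n : ℕ} (g : Equiv.Perm (Fin n)) :
    ∃ μ : n.Partition, g.partition.parts = μ.parts :=
  ⟨⟨g.partition.parts, g.partition.parts_pos, partition_parts_sum g⟩, rfl⟩

theorem sum_perm_eq_sum_partition {M : Type*} [AddCommMonoid M] {n : ℕ}
    (F : Equiv.Perm (Fin n) → M) :
    ∑ g, F g = ∑ μ : n.Partition,
      ∑ g : Equiv.Perm (Fin n) with g.partition.parts = μ.parts, F g := by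
  classical
  choose f hf using fun g : Equiv.Perm (Fin n) => exists_partition_parts_eq g
  rw [← Finset.sum_fiberwise (s := Finset.univ) (g := f)]
  refine Finset.sum_congr rfl fun μ _ => Finset.sum_congr ?_ fun _ _ => rfl
  ext g
  simp only [Finset.mem_filter, Finset.mem_univ, true_and]
  rw [hf g, Nat.Partition.ext_iff]

/-- The elementary Schur polynomial is the cycle index of the symmetric group. -/
theorem elemSchur_eq_sum_cycleProd {A : Type*} [CommRing A] [Algebra ℚ A] (t : ℕ+ → A) (n : ℕ) :
    elemSchur t n = ((n.factorial : ℚ)⁻¹) • ∑ g : Equiv.Perm (Fin n),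
      cycleProd (fun k => (k : A) * PowerSeries.coeff k (timeSeries t)) g := by
  rw [elemSchur_natCast, coeff_expSeries_timeSeries, sum_perm_eq_sum_partition, Finset.smul_sum]
  refine Finset.sum_congr rfl fun μ _ => ?_
  have h1 : ∀ g ∈ Finset.univ.filter fun g : Equiv.Perm (Fin n) => g.partition.parts = μ.parts,
      cycleProd (fun k => (k : A) * PowerSeries.coeff k (timeSeries t)) g =
        (μ.parts.map (fun k : ℕ => (k : A) * PowerSeries.coeff k (timeSeries t))).prod := by
    intro g hg
    rw [cycleProd, (Finset.mem_filter.mp hg).2]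
  rw [Finset.sum_congr rfl h1, Finset.sum_const, Multiset.prod_map_mul, Finsupp.prod,
    Finset.prod_mul_distrib]
  have hcard := card_class_mul μ
  set K := (Finset.univ.filter fun g : Equiv.Perm (Fin n) => g.partition.parts = μ.parts).card
  have h2 : (μ.parts.map (fun k => PowerSeries.coeff k (timeSeries t))).prod =
      ∏ i ∈ μ.parts.toFinsupp.support,
        PowerSeries.coeff i (timeSeries t) ^ μ.parts.toFinsupp i := by
    rw [Finset.prod_multiset_map_count]
    simp
  have h3 : (μ.parts.map (fun k : ℕ => (k : A))).prod = algebraMap ℚ A (μ.parts.prod : ℕ) := by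
    rw [map_natCast, Nat.cast_multiset_prod]
  rw [h2, h3, ← map_prod, ← Algebra.smul_def, ← Algebra.smul_def, ← Nat.cast_smul_eq_nsmul ℚ,
    smul_smul, smul_smul]
  congr 1
  simp only [Multiset.toFinsupp_support, Multiset.toFinsupp_apply, one_div, Finset.prod_inv_distrib]
  have hpos : (n.factorial : ℚ) ≠ 0 := by positivity
  rw [← hcard] at hpos ⊢
  push_cast at hpos ⊢
  have h4 := right_ne_zero_of_mul (right_ne_zero_of_mul hpos)
  have h5 := left_ne_zero_of_mul (right_ne_zero_of_mul hpos)
  have h6 := left_ne_zero_of_mul hpos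
  field_simp

/-! ### Words fixed by a permutation of their letters -/

/-- The cycle of a point, where fixed points are kept apart from the nontrivial cycles. -/
noncomputable def cycleLabel {n : ℕ} (g : Equiv.Perm (Fin n)) (x : Fin n) :
    g.cycleFactorsFinset ⊕ {x : Fin n // x ∉ g.support} :=
  if h : x ∈ g.support then
    Sum.inl ⟨g.cycleOf x, Equiv.Perm.cycleOf_mem_cycleFactorsFinset_iff.mpr h⟩
  else Sum.inr ⟨x, h⟩

theorem cycleLabel_of_mem {n : ℕ} {g : Equiv.Perm (Fin n)} {x : Fin n} (h : x ∈ g.support) :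
    cycleLabel g x =
      Sum.inl ⟨g.cycleOf x, Equiv.Perm.cycleOf_mem_cycleFactorsFinset_iff.mpr h⟩ :=
  dif_pos h

theorem cycleLabel_of_notMem {n : ℕ} {g : Equiv.Perm (Fin n)} {x : Fin n} (h : x ∉ g.support) :
    cycleLabel g x = Sum.inr ⟨x, h⟩ :=
  dif_neg h

theorem cycleLabel_apply {n : ℕ} (g : Equiv.Perm (Fin n)) (x : Fin n) :
    cycleLabel g (g x) = cycleLabel g x := by
  by_cases h : x ∈ g.support
  · have h' : g x ∈ g.support := Equiv.Perm.apply_mem_support.mpr h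
    rw [cycleLabel_of_mem h, cycleLabel_of_mem h']
    congr 2
    exact (Equiv.Perm.SameCycle.refl g x).apply_left.cycleOf_eq
  · have h' : g x = x := Equiv.Perm.notMem_support.mp h
    rw [h']

theorem sameCycle_of_cycleLabel_eq {n : ℕ} {g : Equiv.Perm (Fin n)} {x y : Fin n}
    (h : cycleLabel g x = cycleLabel g y) : g.SameCycle x y := by
  by_cases hx : x ∈ g.support <;> by_cases hy : y ∈ g.support
  · rw [cycleLabel_of_mem hx, cycleLabel_of_mem hy] at h
    have h1 : g.cycleOf x = g.cycleOf y := by simpa using h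
    have h2 : y ∈ (g.cycleOf x).support := by
      rw [h1, Equiv.Perm.mem_support_cycleOf_iff]
      exact ⟨Equiv.Perm.SameCycle.refl _ _, hy⟩
    exact (Equiv.Perm.mem_support_cycleOf_iff.mp h2).1
  · rw [cycleLabel_of_mem hx, cycleLabel_of_notMem hy] at h
    simp at h
  · rw [cycleLabel_of_notMem hx, cycleLabel_of_mem hy] at h
    simp at h
  · rw [cycleLabel_of_notMem hx, cycleLabel_of_notMem hy] at h
    have h1 : x = y := by simpa using h
    rw [h1]

theorem cycleLabel_surjective {n : ℕ} (g : Equiv.Perm (Fin n)) :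
    Function.Surjective (cycleLabel g) := by
  rintro (⟨c, hc⟩ | ⟨x, hx⟩)
  · obtain ⟨x, hx⟩ := (Equiv.Perm.mem_cycleFactorsFinset_iff.mp hc).1.nonempty_support
    refine ⟨x, ?_⟩
    have hx' := Equiv.Perm.mem_cycleFactorsFinset_support_le hc hx
    rw [cycleLabel_of_mem hx']
    congr 2
    exact (Equiv.Perm.cycle_is_cycleOf hx hc).symm
  · exact ⟨x, cycleLabel_of_notMem hx⟩

theorem card_cycleLabel_inl {n : ℕ} (g : Equiv.Perm (Fin n)) (c : g.cycleFactorsFinset) :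
    (Finset.univ.filter fun x => cycleLabel g x = Sum.inl c).card = c.1.support.card := by
  congr 1
  ext x
  simp only [Finset.mem_filter, Finset.mem_univ, true_and]
  constructor
  · intro h
    by_cases hx : x ∈ g.support
    · rw [cycleLabel_of_mem hx] at h
      have h1 : g.cycleOf x = c.1 := congrArg Subtype.val (Sum.inl_injective h)
      rw [← h1, Equiv.Perm.mem_support_cycleOf_iff]
      exact ⟨Equiv.Perm.SameCycle.refl _ _, hx⟩
    · rw [cycleLabel_of_notMem hx] at h
      simp at h
  · intro hx
    rw [cycleLabel_of_mem (Equiv.Perm.mem_cycleFactorsFinset_support_le c.2 hx)]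
    congr 1
    exact Subtype.ext (Equiv.Perm.cycle_is_cycleOf hx c.2).symm

theorem card_cycleLabel_inr {n : ℕ} (g : Equiv.Perm (Fin n))
    (z : {x : Fin n // x ∉ g.support}) :
    (Finset.univ.filter fun x => cycleLabel g x = Sum.inr z).card = 1 := by
  rw [Finset.card_eq_one]
  refine ⟨z.1, ?_⟩
  ext x
  simp only [Finset.mem_filter, Finset.mem_univ, true_and, Finset.mem_singleton]
  constructor
  · intro h
    by_cases hx : x ∈ g.support
    · rw [cycleLabel_of_mem hx] at h
      simp at h
    · rw [cycleLabel_of_notMem hx] at h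
      rw [← Sum.inr_injective h]
  · rintro rfl
    exact cycleLabel_of_notMem z.2

/-- The fibres of `cycleLabel` are the cycles, fixed points included, so their sizes are the parts
of `g.partition`. -/
theorem prod_cycleLabel {A : Type*} [CommMonoid A] {n : ℕ} (g : Equiv.Perm (Fin n))
    (F : ℕ → A) :
    ∏ q, F (Finset.univ.filter fun x => cycleLabel g x = q).card = cycleProd F g := by
  rw [Fintype.prod_sum_type]
  simp_rw [card_cycleLabel_inl, card_cycleLabel_inr]
  rw [cycleProd, Equiv.Perm.parts_partition, Multiset.map_add, Multiset.prod_add,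
    Equiv.Perm.cycleType_def, Multiset.map_map, Multiset.map_replicate, Multiset.prod_replicate]
  congr 1
  · rw [Finset.prod_coe_sort g.cycleFactorsFinset fun c => F c.support.card]
    rfl
  · have h : Fintype.card {x : Fin n // x ∉ g.support} = (g.supportᶜ).card :=
      Fintype.card_of_subtype _ fun x => Finset.mem_compl
    rw [Finset.prod_const, Finset.card_univ, h, Finset.card_compl]

theorem apply_eq_of_comp_eq {ι : Type*} {n : ℕ} {g : Equiv.Perm (Fin n)} {w : Fin n → ι}
    (hw : w ∘ g = w) {x y : Fin n} (h : g.SameCycle x y) : w x = w y := by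
  have h1 : ∀ x, w (g x) = w x := fun x => congrFun hw x
  obtain ⟨m, hm, rfl⟩ := h.exists_pow_eq'
  clear hm h
  induction m with
  | zero => rfl
  | succ m ih => rw [pow_succ', Equiv.Perm.mul_apply, h1, ih]

/-- The generating function of the words fixed by a permutation. -/
theorem sum_fixed_words {ι A : Type*} [Fintype ι] [DecidableEq ι] [CommSemiring A] {n : ℕ}
    (g : Equiv.Perm (Fin n)) (y : ι → A) :
    ∑ w : Fin n → ι with w ∘ g = w, ∏ i, y (w i) = cycleProd (fun k => ∑ a, y a ^ k) g := by
  classical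
  rw [← prod_cycleLabel, Finset.prod_univ_sum, Fintype.piFinset_univ]
  symm
  -- A fixed word is constant on cycles, so it factors uniquely through `cycleLabel`. Expanding the
  -- product over cycles chooses one letter per cycle.
  refine Finset.sum_bij (fun v _ => v ∘ cycleLabel g) ?_ ?_ ?_ ?_
  · intro v _
    rw [Finset.mem_filter]
    refine ⟨Finset.mem_univ _, ?_⟩
    ext x
    simp [cycleLabel_apply]
  · intro v _ v' _ h
    exact (cycleLabel_surjective g).injective_comp_right h
  · intro w hw
    have hw' := (Finset.mem_filter.mp hw).2
    refine ⟨fun q => w (Function.surjInv (cycleLabel_surjective g) q), Finset.mem_univ _, ?_⟩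
    ext x
    exact apply_eq_of_comp_eq hw'
      (sameCycle_of_cycleLabel_eq (Function.surjInv_eq (cycleLabel_surjective g) _))
  · intro v _
    rw [← Finset.prod_fiberwise (s := Finset.univ) (g := cycleLabel g)]
    refine Finset.prod_congr rfl fun q _ => ?_
    rw [← Finset.prod_const]
    refine Finset.prod_congr rfl fun x hx => ?_
    rw [Function.comp_apply, (Finset.mem_filter.mp hx).2]

/-! ### Jacobi-Trudi determinants and their class functions -/

/-- The power sum `p_k = k t_k`. -/
noncomputable def powerSum {A : Type*} [CommRing A] (t : ℕ+ → A) (k : ℕ) : A :=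
  (k : A) * PowerSeries.coeff k (timeSeries t)

theorem powerSum_of_pos {A : Type*} [CommRing A] (t : ℕ+ → A) {k : ℕ} (hk : 0 < k) :
    powerSum t k = (k : A) * t ⟨k, hk⟩ := by
  rw [powerSum, timeSeries, PowerSeries.coeff_mk, dif_pos hk]

theorem cycleProd_congr {A : Type*} [CommMonoid A] {n : ℕ} {y y' : ℕ → A}
    (h : ∀ k, 0 < k → y k = y' k) (g : Equiv.Perm (Fin n)) : cycleProd y g = cycleProd y' g := by
  rw [cycleProd, cycleProd]
  congr 1
  exact Multiset.map_congr rfl fun k hk => h k (g.partition.parts_pos hk)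

theorem cycleProd_mul {A : Type*} [CommMonoid A] {n : ℕ} (y y' : ℕ → A)
    (g : Equiv.Perm (Fin n)) :
    cycleProd (fun k => y k * y' k) g = cycleProd y g * cycleProd y' g :=
  Multiset.prod_map_mul

theorem cycleProd_pow {A : Type*} [CommMonoid A] {n : ℕ} (x : A) (g : Equiv.Perm (Fin n)) :
    cycleProd (fun k => x ^ k) g = x ^ n := by
  have h : ∀ m : Multiset ℕ, (m.map fun k => x ^ k).prod = x ^ m.sum := by
    intro m
    induction m using Multiset.induction_on with
    | empty => simp
    | cons a m ih => rw [Multiset.map_cons, Multiset.prod_cons, ih, Multiset.sum_cons, pow_add]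
  rw [cycleProd, h, partition_parts_sum]

theorem map_cycleProd {A B F : Type*} [CommMonoid A] [CommMonoid B] [FunLike F A B]
    [MonoidHomClass F A B] (f : F) {n : ℕ}
    (y : ℕ → A) (g : Equiv.Perm (Fin n)) :
    f (cycleProd y g) = cycleProd (fun k => f (y k)) g := by
  rw [cycleProd, cycleProd, map_multiset_prod, Multiset.map_map]
  rfl

theorem elemSchur_eq_cycleIndex {A : Type*} [CommRing A] [Algebra ℚ A] (t : ℕ+ → A) (n : ℕ) :
    elemSchur t n = ((n.factorial : ℚ)⁻¹) • ∑ g : Equiv.Perm (Fin n), cycleProd (powerSum t) g :=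
  elemSchur_eq_sum_cycleProd t n

section Scaling

variable {A B : Type*} [CommRing A] [Algebra ℚ A] [CommRing B] [Algebra ℚ B]

/-- Weighted homogeneity: the cycle lengths of a permutation of n points add up to n. -/
theorem elemSchur_scale (f : A →ₐ[ℚ] B) (t : ℕ+ → A) (x : B) (n : ℕ) :
    elemSchur (fun k => f (t k) * x ^ (k : ℕ)) n = f (elemSchur t n) * x ^ n := by
  rw [elemSchur_eq_cycleIndex, elemSchur_eq_cycleIndex, map_smul, map_sum, smul_mul_assoc,
    Finset.sum_mul]
  congr 1
  refine Finset.sum_congr rfl fun g _ => ?_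
  rw [← cycleProd_pow x g, map_cycleProd, ← cycleProd_mul]
  refine cycleProd_congr (fun k hk => ?_) g
  rw [powerSum_of_pos _ hk, powerSum_of_pos _ hk]
  simp [mul_assoc]

/-- The exponent is a sum over i, so the exponential factors. The coefficient of ∏ xᵢ^αᵢ then
isolates the product of the h_{αᵢ}, as needed in `prod_elemSchur`. -/
theorem coeff_expSeries_sum_scale {ι : Type*} [Fintype ι] [DecidableEq ι] (f : A →ₐ[ℚ] B)
    (t : ℕ+ → A) (x : ι → B) :
    expSeries (timeSeries fun k => ∑ i, f (t k) * x i ^ (k : ℕ)) =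
      ∏ i, PowerSeries.mk fun m => f (elemSchur t m) * x i ^ m := by
  have h1 : timeSeries (fun k : ℕ+ => ∑ i, f (t k) * x i ^ (k : ℕ)) =
      ∑ i, timeSeries fun k : ℕ+ => f (t k) * x i ^ (k : ℕ) := by
    ext m
    rw [map_sum]
    rcases m with _ | m
    · simp [constantCoeff_timeSeries]
    · simp only [coeff_timeSeries_succ]
  rw [h1, expSeries_sum _ _ fun i _ => constantCoeff_timeSeries _]
  refine Finset.prod_congr rfl fun i _ => ?_
  ext m
  rw [← elemSchur_natCast, elemSchur_scale, PowerSeries.coeff_mk]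

end Scaling

/-- The number of words of content `α` which are fixed by a permutation of their letters. -/
def wordCount {N n : ℕ} (α : Fin N → ℤ) (g : Equiv.Perm (Fin n)) : ℕ :=
  (Finset.univ.filter fun w : Fin n → Fin N => w ∘ g = w ∧
    ∀ a, ((Finset.univ.filter fun i => w i = a).card : ℤ) = α a).card

theorem wordCount_of_neg {N n : ℕ} {α : Fin N → ℤ} {a : Fin N} (ha : α a < 0)
    (g : Equiv.Perm (Fin n)) : wordCount α g = 0 := by
  rw [wordCount, Finset.card_eq_zero, Finset.filter_eq_empty_iff]
  rintro w - ⟨-, h⟩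
  have := h a
  omega

theorem prod_X_word {N n : ℕ} {A : Type*} [CommSemiring A] (w : Fin n → Fin N) :
    ∏ i, (MvPolynomial.X (w i) : MvPolynomial (Fin N) A) =
      MvPolynomial.monomial
        (Finsupp.equivFunOnFinite.symm fun a => (Finset.univ.filter fun i => w i = a).card) 1 := by
  rw [MvPolynomial.monomial_eq, Finsupp.prod_fintype _ _ fun _ => pow_zero _, map_one, one_mul,
    ← Finset.prod_fiberwise (s := Finset.univ) (g := w)]
  refine Finset.prod_congr rfl fun a _ => ?_
  rw [Finsupp.equivFunOnFinite_symm_apply_apply, ← Finset.prod_const]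
  exact Finset.prod_congr rfl fun i hi => by rw [(Finset.mem_filter.mp hi).2]

theorem coeff_cycleProd_X {N n : ℕ} {A : Type*} [CommSemiring A] (g : Equiv.Perm (Fin n))
    (e : Fin N →₀ ℕ) :
    MvPolynomial.coeff e (cycleProd (fun k => ∑ a, (MvPolynomial.X a : MvPolynomial (Fin N) A) ^ k)
      g) = (wordCount (fun a => (e a : ℤ)) g : A) := by
  rw [← sum_fixed_words, MvPolynomial.coeff_sum]
  simp_rw [prod_X_word, MvPolynomial.coeff_monomial]
  rw [Finset.sum_boole, Finset.filter_filter, wordCount]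
  congr 2
  ext w
  simp only [Finset.mem_filter, Finset.mem_univ, true_and, Finsupp.ext_iff,
    Finsupp.equivFunOnFinite_symm_apply_apply, Nat.cast_inj]

/-- Both sides are the coefficient of x^α in h_n at the times t_k ∑ xᵢ^k: once by factoring the
exponential, once by the cycle index. If α has a negative entry, both sides vanish, which is the
convention the determinants require. -/
theorem prod_elemSchur {A : Type*} [CommRing A] [Algebra ℚ A] {N n : ℕ} (t : ℕ+ → A)
    (α : Fin N → ℤ) (hα : ∑ i, α i = n) :
    ∏ i, elemSchur t (α i) = ((n.factorial : ℚ)⁻¹) • ∑ g : Equiv.Perm (Fin n),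
      (wordCount α g : A) * cycleProd (powerSum t) g := by
  by_cases hneg : ∃ a, α a < 0
  · obtain ⟨a, ha⟩ := hneg
    rw [Finset.prod_eq_zero (Finset.mem_univ a) (elemSchur_of_neg t ha)]
    simp [wordCount_of_neg ha]
  push Not at hneg
  obtain ⟨e, rfl⟩ : ∃ e : Fin N →₀ ℕ, α = fun a => (e a : ℤ) :=
    ⟨Finsupp.equivFunOnFinite.symm fun a => (α a).toNat, by ext a; simp [hneg a]⟩
  let f : A →ₐ[ℚ] MvPolynomial (Fin N) A := IsScalarTower.toAlgHom ℚ A _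
  have hf : ∀ a, f a = MvPolynomial.C a := fun a => rfl
  let T : ℕ+ → MvPolynomial (Fin N) A := fun k => ∑ i, f (t k) * MvPolynomial.X i ^ (k : ℕ)
  have h1 : MvPolynomial.coeff e (elemSchur T n) = ∏ i, elemSchur t (e i) := by
    have hmon : ∀ l : Fin N →₀ ℕ, ∏ i, PowerSeries.coeff (l i) (PowerSeries.mk fun m =>
        f (elemSchur t m) * MvPolynomial.X i ^ m) =
          MvPolynomial.monomial l (∏ i, elemSchur t (l i)) := by
      intro l
      rw [MvPolynomial.monomial_eq, Finsupp.prod_fintype _ _ fun _ => pow_zero _, map_prod,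
        ← Finset.prod_mul_distrib]
      exact Finset.prod_congr rfl fun i _ => by rw [PowerSeries.coeff_mk, hf]
    rw [elemSchur_natCast, coeff_expSeries_sum_scale, PowerSeries.coeff_prod,
      MvPolynomial.coeff_sum]
    simp_rw [hmon, MvPolynomial.coeff_monomial]
    rw [Finset.sum_ite_eq', if_pos]
    rw [Finset.mem_finsuppAntidiag]
    beta_reduce at hα
    exact ⟨by exact_mod_cast hα, Finset.subset_univ _⟩
  rw [← h1, elemSchur_eq_cycleIndex, MvPolynomial.coeff_smul, MvPolynomial.coeff_sum]
  congr 1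
  refine Finset.sum_congr rfl fun g _ => ?_
  -- The power sums at `T` are p_k(t) ∑ x_a^k, so the t-part splits off and the coefficient of x^e
  -- in the rest counts fixed words of content e.
  have h2 : cycleProd (powerSum T) g = MvPolynomial.C (cycleProd (powerSum t) g) *
      cycleProd (fun k => ∑ a, MvPolynomial.X a ^ k) g := by
    rw [map_cycleProd, ← cycleProd_mul]
    refine cycleProd_congr (fun k hk => ?_) g
    rw [powerSum_of_pos _ hk, powerSum_of_pos _ hk, Finset.mul_sum, Finset.mul_sum]
    refine Finset.sum_congr rfl fun i _ => ?_
    simp [hf, mul_assoc]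
  rw [h2, MvPolynomial.coeff_C_mul, coeff_cycleProd_X, mul_comm]

/-- The Jacobi-Trudi determinant `det (h_{aᵢ + j})`, where `aᵢ = λᵢ - i`. -/
noncomputable def jacobiTrudi {A : Type*} [CommRing A] [Algebra ℚ A] {N : ℕ} (t : ℕ+ → A)
    (a : Fin N → ℤ) : A :=
  Matrix.det (Matrix.of fun i j : Fin N => elemSchur t (a i + ((j : ℕ) : ℤ)))

/-- The class function whose characteristic is the Jacobi-Trudi determinant. -/
noncomputable def jtChar {N n : ℕ} (a : Fin N → ℤ) (g : Equiv.Perm (Fin n)) : ℤ :=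
  ∑ σ : Equiv.Perm (Fin N), (Equiv.Perm.sign σ : ℤ) *
    wordCount (fun i => a i + (((σ i : Fin N) : ℕ) : ℤ)) g

theorem sum_add_perm {N : ℕ} (a : Fin N → ℤ) (σ : Equiv.Perm (Fin N)) :
    ∑ i, (a i + (((σ i : Fin N) : ℕ) : ℤ)) = ∑ i, (a i + ((i : ℕ) : ℤ)) := by
  rw [Finset.sum_add_distrib, Finset.sum_add_distrib,
    Equiv.sum_comp σ fun i : Fin N => ((i : ℕ) : ℤ)]

theorem jacobiTrudi_eq_sum {A : Type*} [CommRing A] [Algebra ℚ A] {N n : ℕ} (t : ℕ+ → A)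
    (a : Fin N → ℤ) (ha : ∑ i, (a i + ((i : ℕ) : ℤ)) = n) :
    jacobiTrudi t a = ((n.factorial : ℚ)⁻¹) • ∑ g : Equiv.Perm (Fin n),
      (jtChar a g : A) * cycleProd (powerSum t) g := by
  -- After transposing, σ acts on the column index as in `jtChar`. All index vectors in the Leibniz
  -- expansion have the same sum n, so `prod_elemSchur` applies to each term.
  rw [jacobiTrudi, ← Matrix.det_transpose, Matrix.det_apply']
  simp_rw [Matrix.transpose_apply, Matrix.of_apply]
  have h1 : ∀ σ : Equiv.Perm (Fin N), ∏ i, elemSchur t (a i + (((σ i : Fin N) : ℕ) : ℤ)) =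
      ((n.factorial : ℚ)⁻¹) • ∑ g : Equiv.Perm (Fin n),
      (wordCount (fun i => a i + (((σ i : Fin N) : ℕ) : ℤ)) g : A) * cycleProd (powerSum t) g :=
    fun σ => prod_elemSchur t _ (by rw [sum_add_perm, ha])
  simp_rw [h1, mul_smul_comm]
  rw [← Finset.smul_sum]
  congr 1
  simp_rw [Finset.mul_sum]
  rw [Finset.sum_comm]
  refine Finset.sum_congr rfl fun g _ => ?_
  rw [jtChar, Int.cast_sum, Finset.sum_mul]
  refine Finset.sum_congr rfl fun σ _ => ?_
  push_cast
  ring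

/-! ### The bialternant formula and orthogonality -/

/-- The sequence `aᵢ = λᵢ - i` comes from a partition `λ` with at most `N` parts. -/
structure IsShifted {N : ℕ} (a : Fin N → ℤ) : Prop where
  strictAnti : StrictAnti a
  nonneg : ∀ i, 0 ≤ a i + ((i : ℕ) : ℤ)

section Bialternant

variable (N : ℕ)

/-- The times at which the Jacobi-Trudi determinants are the Schur polynomials in `N` variables. -/
noncomputable def varTimes (k : ℕ+) : MvPolynomial (Fin N) ℚ :=
  ∑ i, algebraMap ℚ (MvPolynomial (Fin N) ℚ) (((k : ℕ) : ℚ)⁻¹) * MvPolynomial.X i ^ (k : ℕ)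

/-- At t_k = 1/k all power sums are 1, so the cycle index averages the constant 1. -/
theorem elemSchur_inv (m : ℕ) : elemSchur (fun k : ℕ+ => (((k : ℕ) : ℚ)⁻¹)) m = 1 := by
  rw [elemSchur_eq_cycleIndex]
  have h : ∀ g : Equiv.Perm (Fin m), cycleProd (powerSum fun k : ℕ+ => (((k : ℕ) : ℚ)⁻¹)) g = 1 := by
    intro g
    rw [cycleProd_congr (y' := fun k => (1 : ℚ) ^ k), cycleProd_pow, one_pow]
    intro k hk
    rw [powerSum_of_pos _ hk, one_pow]
    exact mul_inv_cancel₀ (by exact_mod_cast hk.ne')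
  simp_rw [h]
  rw [Finset.sum_const, Finset.card_univ, Fintype.card_perm, Fintype.card_fin, nsmul_one,
    smul_eq_mul]
  exact inv_mul_cancel₀ (by positivity)

theorem expSeries_varTimes : expSeries (timeSeries (varTimes N)) =
    ∏ i, PowerSeries.mk fun m => (MvPolynomial.X i : MvPolynomial (Fin N) ℚ) ^ m := by
  have h := coeff_expSeries_sum_scale (Algebra.ofId ℚ (MvPolynomial (Fin N) ℚ))
    (fun k : ℕ+ => (((k : ℕ) : ℚ)⁻¹)) (fun i : Fin N => MvPolynomial.X i)
  simp_rw [elemSchur_inv, map_one, one_mul] at h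
  exact h

theorem powerSum_varTimes {k : ℕ} (hk : 0 < k) :
    powerSum (varTimes N) k = ∑ i, MvPolynomial.X i ^ k := by
  simp only [powerSum_of_pos _ hk, varTimes]
  rw [← Finset.mul_sum, ← mul_assoc, PNat.mk_coe,
    ← map_natCast (algebraMap ℚ (MvPolynomial (Fin N) ℚ)), ← map_mul, mul_inv_cancel₀, map_one,
    one_mul]
  exact_mod_cast hk.ne'

/-- The polynomial `∏_{l ≠ k} (1 - x_l y)`. -/
noncomputable def omitProd (k : Fin N) : Polynomial (MvPolynomial (Fin N) ℚ) :=
  ∏ l ∈ Finset.univ.erase k, (1 - Polynomial.C (MvPolynomial.X l) * Polynomial.X)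

theorem coeff_omitProd_of_le (k : Fin N) {m : ℕ} (hm : N ≤ m) : (omitProd N k).coeff m = 0 := by
  apply Polynomial.coeff_eq_zero_of_natDegree_lt
  have h1 : (omitProd N k).natDegree ≤ ∑ l ∈ Finset.univ.erase k, 1 := by
    refine (Polynomial.natDegree_prod_le _ _).trans (Finset.sum_le_sum fun l _ => ?_)
    refine (Polynomial.natDegree_sub_le _ _).trans ?_
    rw [Polynomial.natDegree_one]
    exact max_le (by omega) ((Polynomial.natDegree_C_mul_le _ _).trans Polynomial.natDegree_X_le)
  have h2 : ∑ l ∈ Finset.univ.erase k, 1 = N - 1 := by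
    rw [Finset.sum_const, Finset.card_erase_of_mem (Finset.mem_univ k), Finset.card_univ,
      Fintype.card_fin, smul_eq_mul, mul_one]
  have := k.pos
  omega

theorem geom_mul {A : Type*} [CommRing A] (x : A) :
    (PowerSeries.mk fun m => x ^ m) * (1 - PowerSeries.C x * PowerSeries.X) = 1 := by
  ext m
  rw [mul_sub, mul_one, ← mul_assoc, map_sub]
  rcases m with _ | m
  · simp
  · rw [PowerSeries.coeff_succ_mul_X, PowerSeries.coeff_mul_C, PowerSeries.coeff_mk,
      PowerSeries.coeff_mk, pow_succ, sub_self, PowerSeries.coeff_one, if_neg (by omega)]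

theorem expSeries_varTimes_mul (k : Fin N) :
    expSeries (timeSeries (varTimes N)) * (omitProd N k : PowerSeries (MvPolynomial (Fin N) ℚ)) =
      PowerSeries.mk fun m => MvPolynomial.X k ^ m := by
  have h1 : (omitProd N k : PowerSeries (MvPolynomial (Fin N) ℚ)) =
      ∏ l ∈ Finset.univ.erase k,
        (1 - PowerSeries.C (MvPolynomial.X l : MvPolynomial (Fin N) ℚ) * PowerSeries.X) := by
    rw [omitProd, ← Polynomial.coeToPowerSeries.ringHom_apply, map_prod]
    simp
  rw [expSeries_varTimes, h1, ← Finset.mul_prod_erase _ _ (Finset.mem_univ k), mul_assoc,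
    ← Finset.prod_mul_distrib, Finset.prod_eq_one, mul_one]
  exact fun i _ => geom_mul _

/-- This is the coefficient of y^m in H(y) ∏_{l≠k} (1 - x_l y) = 1/(1 - x_k y). Listing the N
coefficients of `omitProd` in reverse order turns the convolution into an entry of a matrix product.
-/
theorem sum_elemSchur_omitProd (k : Fin N) (m : ℕ) :
    ∑ j : Fin N, elemSchur (varTimes N) ((m : ℤ) - (N - 1 : ℤ) + ((j : ℕ) : ℤ)) *
      (omitProd N k).coeff (N - 1 - j) = MvPolynomial.X k ^ m := by
  have h := congrArg (PowerSeries.coeff m) (expSeries_varTimes_mul N k)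
  rw [mul_comm, PowerSeries.coeff_mul, PowerSeries.coeff_mk,
    Finset.Nat.sum_antidiagonal_eq_sum_range_succ_mk] at h
  rw [← h]
  have h1 : ∀ i, PowerSeries.coeff i (omitProd N k : PowerSeries (MvPolynomial (Fin N) ℚ)) =
      (omitProd N k).coeff i := fun i => Polynomial.coeff_coe _ _
  have h2 : ∑ j : Fin N, elemSchur (varTimes N) ((m : ℤ) - (N - 1 : ℤ) + ((j : ℕ) : ℤ)) *
      (omitProd N k).coeff (N - 1 - j) =
      ∑ i ∈ Finset.range N, (omitProd N k).coeff i * elemSchur (varTimes N) ((m : ℤ) - i) := by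
    rw [← Finset.sum_range_reflect, ← Fin.sum_univ_eq_sum_range fun i =>
      (omitProd N k).coeff (N - 1 - i) * elemSchur (varTimes N) ((m : ℤ) - (N - 1 - i : ℕ))]
    refine Finset.sum_congr rfl fun j _ => ?_
    rw [mul_comm]
    congr 2
    have := j.2
    omega
  have h3 : ∀ i ∈ Finset.range (m + 1), PowerSeries.coeff i
      (omitProd N k : PowerSeries (MvPolynomial (Fin N) ℚ)) *
        PowerSeries.coeff (m - i) (expSeries (timeSeries (varTimes N))) =
      (omitProd N k).coeff i * elemSchur (varTimes N) ((m : ℤ) - i) := by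
    intro i hi
    rw [Finset.mem_range] at hi
    rw [h1, ← elemSchur_natCast, Nat.cast_sub (by omega)]
  rw [h2, Finset.sum_congr rfl h3]
  -- The ranges differ only where `omitProd` has no coefficient (i ≥ N) or h has a negative index (i
  -- > m).
  trans ∑ i ∈ Finset.range (max N (m + 1)),
    (omitProd N k).coeff i * elemSchur (varTimes N) ((m : ℤ) - i)
  · refine Finset.sum_subset (Finset.range_mono (le_max_left _ _)) fun i _ hi => ?_
    rw [coeff_omitProd_of_le N k (by simpa using hi), zero_mul]
  · refine (Finset.sum_subset (Finset.range_mono (le_max_right _ _)) fun i _ hi => ?_).symm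
    rw [Finset.mem_range] at hi
    rw [elemSchur_of_neg _ (by omega), mul_zero]

variable {N}

/-- The alternant `det (x_k ^ βᵢ)`. -/
noncomputable def alternant (β : Fin N → ℕ) : MvPolynomial (Fin N) ℚ :=
  Matrix.det (Matrix.of fun i k : Fin N => MvPolynomial.X k ^ β i)

theorem coeff_alternant (β : Fin N → ℕ) (e : Fin N →₀ ℕ) :
    MvPolynomial.coeff e (alternant β) =
      ∑ σ : Equiv.Perm (Fin N), (Equiv.Perm.sign σ : ℚ) * if ∀ k, β (σ k) = e k then 1 else 0 := by
  rw [alternant, Matrix.det_apply', MvPolynomial.coeff_sum]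
  refine Finset.sum_congr rfl fun σ _ => ?_
  have h1 : ∏ i, (Matrix.of fun i k : Fin N =>
      (MvPolynomial.X k : MvPolynomial (Fin N) ℚ) ^ β i) (σ i) i =
      MvPolynomial.monomial (Finsupp.equivFunOnFinite.symm fun i => β (σ i)) 1 := by
    rw [MvPolynomial.monomial_eq, Finsupp.prod_fintype _ _ fun _ => pow_zero _, map_one, one_mul]
    rfl
  rw [h1, ← map_intCast (MvPolynomial.C (σ := Fin N) (R := ℚ)), MvPolynomial.coeff_C_mul,
    MvPolynomial.coeff_monomial]
  simp only [Finsupp.ext_iff, Finsupp.equivFunOnFinite_symm_apply_apply]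

theorem perm_eq_one_of_strictAnti {β : Fin N → ℕ} (hβ : StrictAnti β) {σ : Equiv.Perm (Fin N)}
    (h : StrictAnti fun k => β (σ k)) : σ = 1 := by
  have hσ : StrictMono σ := fun i j hij => hβ.lt_iff_gt.mp (h hij)
  let f : Fin N ≃o Fin N := ⟨σ, hσ.le_iff_le⟩
  have hf : f = OrderIso.refl _ := Subsingleton.elim _ _
  ext i
  exact congrArg Fin.val (DFunLike.congr_fun hf i)

/-- Among the rearrangements of a strictly decreasing sequence only the trivial one is again
decreasing, so a single Leibniz term can contribute. -/
theorem coeff_alternant_of_strictAnti {β : Fin N → ℕ} (hβ : StrictAnti β) {e : Fin N →₀ ℕ}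
    (he : StrictAnti e) :
    MvPolynomial.coeff e (alternant β) = if β = e then 1 else 0 := by
  rw [coeff_alternant, Finset.sum_eq_single 1]
  · simp only [Equiv.Perm.sign_one, Equiv.Perm.one_apply, funext_iff]
    norm_num
    congr
  · intro σ _ hσ
    rw [if_neg, mul_zero]
    intro h
    apply hσ
    apply perm_eq_one_of_strictAnti hβ
    simp_rw [h]
    exact he
  · simp

/-- The second determinant does not depend on `b`, so it can be identified from one special case. -/
theorem jacobiTrudi_mul_det (b : Fin N → ℤ) (β : Fin N → ℕ)
    (h : ∀ i, b i + (N - 1 : ℤ) = β i) :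
    jacobiTrudi (varTimes N) b *
      Matrix.det (Matrix.of fun j k : Fin N => (omitProd N k).coeff (N - 1 - j)) =
        alternant β := by
  rw [jacobiTrudi, ← Matrix.det_mul, alternant]
  congr 1
  ext1 i k
  rw [Matrix.mul_apply, Matrix.of_apply, ← sum_elemSchur_omitProd N k (β i)]
  refine Finset.sum_congr rfl fun j _ => ?_
  rw [Matrix.of_apply, Matrix.of_apply, ← h i]
  congr 2
  ring

theorem elemSchur_zero {A : Type*} [CommRing A] [Algebra ℚ A] (t : ℕ+ → A) :
    elemSchur t 0 = 1 := by
  have h := elemSchur_natCast t 0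
  rw [PowerSeries.coeff_zero_eq_constantCoeff_apply,
    constantCoeff_expSeries (constantCoeff_timeSeries t)] at h
  simpa using h

theorem jacobiTrudi_empty {A : Type*} [CommRing A] [Algebra ℚ A] (t : ℕ+ → A) :
    jacobiTrudi t (fun i : Fin N => -((i : ℕ) : ℤ)) = 1 := by
  rw [jacobiTrudi, Matrix.det_of_isUpperTriangular]
  · refine Finset.prod_eq_one fun i _ => ?_
    rw [Matrix.of_apply, neg_add_cancel, elemSchur_zero]
  · intro i j hij
    rw [Matrix.of_apply]
    apply elemSchur_of_neg
    have : (j : ℕ) < (i : ℕ) := hij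
    omega

/-- The special case is the empty partition: its Jacobi–Trudi determinant is 1 and its alternant is
the Vandermonde determinant. -/
theorem jacobiTrudi_mul_vandermonde (b : Fin N → ℤ) (β : Fin N → ℕ)
    (h : ∀ i, b i + (N - 1 : ℤ) = β i) :
    alternant (fun i : Fin N => N - 1 - i) * jacobiTrudi (varTimes N) b = alternant β := by
  have h0 := jacobiTrudi_mul_det (fun i : Fin N => -((i : ℕ) : ℤ)) (fun i : Fin N => N - 1 - i)
    (fun i => by have := i.2; omega)
  rw [jacobiTrudi_empty, one_mul] at h0
  rw [← h0, mul_comm, jacobiTrudi_mul_det b β h]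

theorem coeff_jacobiTrudi_varTimes {n : ℕ} (b : Fin N → ℤ)
    (hb : ∑ i, (b i + ((i : ℕ) : ℤ)) = n) (e : Fin N →₀ ℕ) :
    MvPolynomial.coeff e (jacobiTrudi (varTimes N) b) = (n.factorial : ℚ)⁻¹ *
      ∑ g : Equiv.Perm (Fin n), (jtChar b g : ℚ) * wordCount (fun i => (e i : ℤ)) g := by
  rw [jacobiTrudi_eq_sum _ b hb, MvPolynomial.coeff_smul, MvPolynomial.coeff_sum, smul_eq_mul]
  congr 1
  refine Finset.sum_congr rfl fun g _ => ?_
  rw [← map_intCast (MvPolynomial.C (σ := Fin N) (R := ℚ)), MvPolynomial.coeff_C_mul,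
    cycleProd_congr (fun k hk => powerSum_varTimes N hk), coeff_cycleProd_X]

/-- Orthonormality of the class functions of the Jacobi-Trudi determinants. -/
theorem sum_jtChar_mul_jtChar {n : ℕ} {a b : Fin N → ℤ} (ha : IsShifted a) (hb : IsShifted b)
    (hbn : ∑ i, (b i + ((i : ℕ) : ℤ)) = n) :
    ∑ g : Equiv.Perm (Fin n), (jtChar a g : ℚ) * jtChar b g =
      if a = b then (n.factorial : ℚ) else 0 := by
  have hN : ∀ c : Fin N → ℤ, IsShifted c → ∀ i, 0 ≤ c i + (N - 1 : ℤ) := by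
    intro c hc i
    have := hc.nonneg i
    have := i.2
    omega
  have hanti : ∀ c : Fin N → ℤ, IsShifted c → StrictAnti fun i => (c i + (N - 1 : ℤ)).toNat := by
    intro c hc i j hij
    have h1 := hc.strictAnti hij
    have h2 := hN c hc i
    have h3 := hN c hc j
    dsimp only
    omega
  let e : Fin N →₀ ℕ := Finsupp.equivFunOnFinite.symm fun i => (a i + (N - 1 : ℤ)).toNat
  have he : ∀ i, (e i : ℤ) = a i + (N - 1 : ℤ) := fun i => Int.toNat_of_nonneg (hN a ha i)
  -- The coefficient of x^(a+N-1) in the bialternant identity for `b`. On the right it detects a =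
  -- b. On the left the Vandermonde term of σ leaves the coefficient of the Schur polynomial at the
  -- exponent a i + σ i, a pairing of `jtChar b` with a word count; the signed sum over σ assembles
  -- `jtChar a`.
  have h := congrArg (MvPolynomial.coeff e) (jacobiTrudi_mul_vandermonde b
    (fun i => (b i + (N - 1 : ℤ)).toNat) fun i => (Int.toNat_of_nonneg (hN b hb i)).symm)
  rw [coeff_alternant_of_strictAnti (hanti b hb) (hanti a ha), alternant, Matrix.det_apply',
    Finset.sum_mul, MvPolynomial.coeff_sum] at h
  have hterm : ∀ σ : Equiv.Perm (Fin N), MvPolynomial.coeff e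
      ((Equiv.Perm.sign σ : MvPolynomial (Fin N) ℚ) * (∏ i, (Matrix.of fun i k : Fin N =>
        (MvPolynomial.X k : MvPolynomial (Fin N) ℚ) ^ (N - 1 - (i : ℕ))) (σ i) i) *
          jacobiTrudi (varTimes N) b) =
      (n.factorial : ℚ)⁻¹ * ∑ g : Equiv.Perm (Fin n), (jtChar b g : ℚ) *
        ((Equiv.Perm.sign σ : ℚ) *
          wordCount (fun i => a i + (((σ i : Fin N) : ℕ) : ℤ)) g) := by
    intro σ
    let m : Fin N →₀ ℕ := Finsupp.equivFunOnFinite.symm fun i => N - 1 - (σ i : ℕ)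
    have hm : ∀ i, (m i : ℤ) = N - 1 - ((σ i : Fin N) : ℕ) := by
      intro i
      have := (σ i).2
      simp only [m, Finsupp.equivFunOnFinite_symm_apply_apply]
      omega
    have h1 : ∏ i, (Matrix.of fun i k : Fin N =>
        (MvPolynomial.X k : MvPolynomial (Fin N) ℚ) ^ (N - 1 - (i : ℕ))) (σ i) i =
          MvPolynomial.monomial m 1 := by
      rw [MvPolynomial.monomial_eq, Finsupp.prod_fintype _ _ fun _ => pow_zero _, map_one, one_mul]
      rfl
    rw [h1, ← map_intCast (MvPolynomial.C (σ := Fin N) (R := ℚ)), mul_assoc,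
      MvPolynomial.coeff_C_mul, MvPolynomial.coeff_monomial_mul', one_mul]
    split_ifs with hle
    · have h2 : (fun i => (((e - m) i : ℕ) : ℤ)) =
          fun i => a i + (((σ i : Fin N) : ℕ) : ℤ) := by
        ext i
        have h3 := hle i
        rw [Finsupp.tsub_apply, Nat.cast_sub h3, he, hm]
        ring
      rw [coeff_jacobiTrudi_varTimes b hbn, h2, mul_left_comm, Finset.mul_sum]
      congr 1
      exact Finset.sum_congr rfl fun g _ => by ring
    -- The Vandermonde monomial does not divide x^e exactly when some a i + σ i is negative; then
    -- the word count vanishes as well.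
    · have h2 : ∃ i, a i + (((σ i : Fin N) : ℕ) : ℤ) < 0 := by
        by_contra! hcon
        refine hle fun i => ?_
        have h3 := hcon i
        have h4 := he i
        have h5 := hm i
        omega
      obtain ⟨i, hi⟩ := h2
      simp [wordCount_of_neg (α := fun i => a i + (((σ i : Fin N) : ℕ) : ℤ)) hi]
  rw [Finset.sum_congr rfl fun σ _ => hterm σ, ← Finset.mul_sum, Finset.sum_comm] at h
  have h5 : ∑ g : Equiv.Perm (Fin n), (jtChar a g : ℚ) * jtChar b g =
      ∑ g : Equiv.Perm (Fin n), ∑ σ : Equiv.Perm (Fin N), (jtChar b g : ℚ) *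
        ((Equiv.Perm.sign σ : ℚ) *
          wordCount (fun i => a i + (((σ i : Fin N) : ℕ) : ℤ)) g) := by
    refine Finset.sum_congr rfl fun g _ => ?_
    rw [← Finset.mul_sum, mul_comm]
    congr 1
    rw [jtChar]
    push_cast
    rfl
  have hpos : (n.factorial : ℚ) ≠ 0 := by positivity
  rw [h5, ← mul_right_inj' (inv_ne_zero hpos), h]
  have hiff : ((fun i => (b i + (N - 1 : ℤ)).toNat) = e) ↔ a = b := by
    constructor
    · intro h
      ext i
      have h1 := congrFun h i
      have h2 := he i
      have h3 := hN b hb i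
      omega
    · rintro rfl
      rfl
  simp only [hiff]
  split_ifs
  · rw [inv_mul_cancel₀ hpos]
  · rw [mul_zero]

end Bialternant

/-! ### Restriction to the symmetric group on one point less -/

/-- The embedding of `S_n` into `S_{n+1}` as the stabilizer of the last point. -/
def permSucc (n : ℕ) : Equiv.Perm (Fin n) →* Equiv.Perm (Fin (n + 1)) where
  toFun g :=
    { toFun := Fin.lastCases (Fin.last n) fun i => (g i).castSucc
      invFun := Fin.lastCases (Fin.last n) fun i => (g.symm i).castSucc
      left_inv := fun x => by cases x using Fin.lastCases <;> simp
      right_inv := fun x => by cases x using Fin.lastCases <;> simp }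
  map_one' := by
    ext x
    cases x using Fin.lastCases <;> simp
  map_mul' g h := by
    ext x
    cases x using Fin.lastCases <;> simp

@[simp]
theorem permSucc_last {n : ℕ} (g : Equiv.Perm (Fin n)) :
    permSucc n g (Fin.last n) = Fin.last n := by
  simp [permSucc]

@[simp]
theorem permSucc_castSucc {n : ℕ} (g : Equiv.Perm (Fin n)) (i : Fin n) :
    permSucc n g i.castSucc = (g i).castSucc := by
  simp [permSucc]

theorem permSucc_injective (n : ℕ) : Function.Injective (permSucc n) := by
  intro g h hgh
  ext i
  have := DFunLike.congr_fun hgh i.castSucc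
  rw [permSucc_castSucc, permSucc_castSucc] at this
  rw [Fin.castSucc_injective _ this]

/-- A sum over `S_{n+1}`, by right cosets representatives of the stabilizer of the last point. -/
theorem sum_perm_succ {M : Type*} [AddCommMonoid M] {n : ℕ} (F : Equiv.Perm (Fin (n + 1)) → M) :
    ∑ g, F g = ∑ g : Equiv.Perm (Fin n), (F (permSucc n g) +
      ∑ i : Fin n, F (permSucc n g * Equiv.swap i.castSucc (Fin.last n))) := by
  let f : Equiv.Perm (Fin n) × Fin (n + 1) → Equiv.Perm (Fin (n + 1)) := fun p =>
    permSucc n p.1 * Equiv.swap p.2 (Fin.last n)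
  have hinj : Function.Injective f := by
    rintro ⟨g, i⟩ ⟨h, j⟩ hgh
    have h1 : ∀ p : Equiv.Perm (Fin n) × Fin (n + 1), f p p.2 = Fin.last n := by
      intro p
      simp [f]
    have h2 : i = j := by
      apply (f (g, i)).injective
      have h3 := h1 (g, i)
      have h4 := h1 (h, j)
      rw [← hgh] at h4
      exact h3.trans h4.symm
    subst h2
    have h3 : g = h := permSucc_injective n (mul_right_cancel hgh)
    rw [h3]
  have hbij : Function.Bijective f := by
    rw [Fintype.bijective_iff_injective_and_card]
    refine ⟨hinj, ?_⟩
    simp [Fintype.card_perm, Nat.factorial_succ, mul_comm]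
  rw [← hbij.sum_comp F, Fintype.sum_prod_type]
  refine Finset.sum_congr rfl fun g _ => ?_
  rw [Fin.sum_univ_castSucc, add_comm]
  simp only [f, Equiv.swap_self]
  rfl

theorem comp_permSucc_eq_iff {ι : Type*} {n : ℕ} (g : Equiv.Perm (Fin n)) (v : Fin n → ι)
    (b : ι) :
    (Fin.snoc v b : Fin (n + 1) → ι) ∘ permSucc n g = (Fin.snoc v b : Fin (n + 1) → ι) ↔
      v ∘ g = v := by
  constructor
  · intro h
    ext i
    have := congrFun h i.castSucc
    simpa using this
  · intro h
    ext x
    cases x using Fin.lastCases with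
    | last => simp
    | cast i =>
      have := congrFun h i
      simpa using this

/-- The transposition inserts the last point into the cycle of i, which forces the two letters to
agree. -/
theorem comp_permSucc_mul_swap_eq_iff {ι : Type*} {n : ℕ} (g : Equiv.Perm (Fin n))
    (v : Fin n → ι) (b : ι) (i : Fin n) :
    (Fin.snoc v b : Fin (n + 1) → ι) ∘ (permSucc n g * Equiv.swap i.castSucc (Fin.last n)) =
      (Fin.snoc v b : Fin (n + 1) → ι) ↔ v ∘ g = v ∧ v i = b := by
  set w : Fin (n + 1) → ι := Fin.snoc v b with hw
  set s := Equiv.swap i.castSucc (Fin.last n) with hs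
  have h0 : w i.castSucc = v i := by simp [hw]
  have h0' : w (Fin.last n) = b := by simp [hw]
  have h1 : v i = b → w ∘ s = w := by
    intro h
    ext x
    by_cases hx : x = i.castSucc
    · rw [Function.comp_apply, hs, hx, Equiv.swap_apply_left, h0, h0', h]
    · by_cases hx' : x = Fin.last n
      · rw [Function.comp_apply, hs, hx', Equiv.swap_apply_right, h0, h0', h]
      · rw [Function.comp_apply, hs, Equiv.swap_apply_of_ne_of_ne hx hx']
  have h2 : w ∘ (permSucc n g * s : Equiv.Perm (Fin (n + 1))) = (w ∘ permSucc n g) ∘ s := rfl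
  constructor
  · intro h
    have h3 : v i = b := by
      have := congrFun h i.castSucc
      rw [h2, Function.comp_apply, hs, Equiv.swap_apply_left, Function.comp_apply, permSucc_last,
        h0, h0'] at this
      exact this.symm
    refine ⟨?_, h3⟩
    rw [← comp_permSucc_eq_iff g v b, ← hw]
    have h4 : (w ∘ permSucc n g) ∘ s = w ∘ s := by rw [← h2, h, h1 h3]
    exact s.surjective.injective_comp_right h4
  · rintro ⟨h, h3⟩
    rw [h2, (comp_permSucc_eq_iff g v b).mpr h, h1 h3]

theorem sum_words_succ {ι M : Type*} [Fintype ι] [AddCommMonoid M] {n : ℕ}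
    (F : (Fin (n + 1) → ι) → M) :
    ∑ w, F w = ∑ b : ι, ∑ v : Fin n → ι, F (Fin.snoc v b) := by
  rw [← (Fin.snocEquiv fun _ : Fin (n + 1) => ι).sum_comp F, Fintype.sum_prod_type]
  rfl

theorem card_snoc_eq {N n : ℕ} (v : Fin n → Fin N) (b a : Fin N) :
    (Finset.univ.filter fun i => (Fin.snoc v b : Fin (n + 1) → Fin N) i = a).card =
      (Finset.univ.filter fun i => v i = a).card + if a = b then 1 else 0 := by
  rw [Finset.card_filter, Finset.card_filter, Fin.sum_univ_castSucc]
  simp [eq_comm]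

theorem content_snoc_iff {N n : ℕ} (α : Fin N → ℤ) (v : Fin n → Fin N) (b : Fin N) :
    (∀ a, ((Finset.univ.filter fun i => (Fin.snoc v b : Fin (n + 1) → Fin N) i = a).card : ℤ) =
      α a) ↔
      ∀ a, ((Finset.univ.filter fun i => v i = a).card : ℤ) = (α - Pi.single b 1 : Fin N → ℤ) a := by
  refine forall_congr' fun a => ?_
  rw [card_snoc_eq, Pi.sub_apply, Pi.single_apply]
  push_cast
  split_ifs <;> omega

theorem wordCount_eq_sum {N n : ℕ} (α : Fin N → ℤ) (g : Equiv.Perm (Fin n)) :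
    wordCount α g = ∑ w : Fin n → Fin N, if w ∘ g = w ∧
      ∀ a, ((Finset.univ.filter fun i => w i = a).card : ℤ) = α a then 1 else 0 :=
  Finset.card_filter _ _

theorem wordCount_permSucc {N n : ℕ} (α : Fin N → ℤ) (g : Equiv.Perm (Fin n)) :
    wordCount α (permSucc n g) = ∑ b, wordCount (α - Pi.single b 1) g := by
  simp_rw [wordCount_eq_sum]
  rw [sum_words_succ]
  simp_rw [comp_permSucc_eq_iff, content_snoc_iff]

/-- If the last letter is b, the admissible i are the other positions carrying b, and there are α b
- 1 of them. -/
theorem sum_wordCount_mul_swap {N n : ℕ} (α : Fin N → ℤ) (g : Equiv.Perm (Fin n)) :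
    ∑ i : Fin n, (wordCount α (permSucc n g * Equiv.swap i.castSucc (Fin.last n)) : ℤ) =
      ∑ b, (α b - 1) * wordCount (α - Pi.single b 1) g := by
  simp_rw [wordCount_eq_sum, sum_words_succ, comp_permSucc_mul_swap_eq_iff,
    content_snoc_iff]
  push_cast
  rw [Finset.sum_comm]
  refine Finset.sum_congr rfl fun b _ => ?_
  rw [Finset.sum_comm, Finset.mul_sum]
  refine Finset.sum_congr rfl fun v _ => ?_
  by_cases h : v ∘ g = v ∧ ∀ a,
      ((Finset.univ.filter fun i => v i = a).card : ℤ) = (α - Pi.single b 1 : Fin N → ℤ) a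
  · have h1 := h.2 b
    rw [Pi.sub_apply, Pi.single_eq_same] at h1
    rw [if_pos h, mul_one, ← h1, Finset.card_filter]
    push_cast
    refine Finset.sum_congr rfl fun i _ => ?_
    simp only [h.1, h.2, true_and, implies_true, and_true]
  · rw [if_neg h, mul_zero]
    refine Finset.sum_eq_zero fun i _ => if_neg ?_
    rintro ⟨⟨h1, -⟩, h2⟩
    exact h ⟨h1, h2⟩

theorem add_sub_single {N : ℕ} (a c : Fin N → ℤ) (b : Fin N) :
    (fun i => a i + c i) - Pi.single b 1 = fun i => (a - Pi.single b 1 : Fin N → ℤ) i + c i := by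
  ext i
  simp only [Pi.sub_apply]
  ring

theorem jtChar_permSucc {N n : ℕ} (a : Fin N → ℤ) (g : Equiv.Perm (Fin n)) :
    jtChar a (permSucc n g) = ∑ b, jtChar (a - Pi.single b 1) g := by
  simp_rw [jtChar, wordCount_permSucc]
  rw [Finset.sum_comm]
  refine Finset.sum_congr rfl fun σ _ => ?_
  push_cast
  rw [Finset.mul_sum]
  refine Finset.sum_congr rfl fun b _ => ?_
  rw [add_sub_single]

/-- Group the terms by c = σ b, where the column index c is lowered to c - 1. For c > 0 the column c
- 1 then occurs twice, so the alternating sum vanishes; for c = 0 the weight is 0. -/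
theorem sum_sign_mul_wordCount_eq_zero {N n : ℕ} (a : Fin N → ℤ) (g : Equiv.Perm (Fin n)) :
    ∑ σ : Equiv.Perm (Fin N), ∑ b : Fin N, (Equiv.Perm.sign σ : ℤ) * (((σ b : Fin N) : ℕ) : ℤ) *
      wordCount ((fun i => a i + (((σ i : Fin N) : ℕ) : ℤ)) - Pi.single b 1) g = 0 := by
  have h1 : ∀ σ : Equiv.Perm (Fin N), ∑ b : Fin N, (Equiv.Perm.sign σ : ℤ) *
      (((σ b : Fin N) : ℕ) : ℤ) *
        wordCount ((fun i => a i + (((σ i : Fin N) : ℕ) : ℤ)) - Pi.single b 1) g =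
      ∑ c : Fin N, ((c : ℕ) : ℤ) * ((Equiv.Perm.sign σ : ℤ) *
        wordCount (fun i => a i + ((((σ i : Fin N) : ℕ) : ℤ) - if σ i = c then 1 else 0)) g) := by
    intro σ
    rw [← Equiv.sum_comp σ fun c : Fin N => ((c : ℕ) : ℤ) * ((Equiv.Perm.sign σ : ℤ) *
      wordCount (fun i => a i + ((((σ i : Fin N) : ℕ) : ℤ) - if σ i = c then 1 else 0)) g)]
    refine Finset.sum_congr rfl fun b _ => ?_
    rw [← mul_assoc, mul_comm (Equiv.Perm.sign σ : ℤ)]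
    congr 3
    funext i
    rw [Pi.sub_apply, Pi.single_apply]
    simp only [EmbeddingLike.apply_eq_iff_eq]
    ring
  rw [Finset.sum_congr rfl fun σ _ => h1 σ, Finset.sum_comm]
  refine Finset.sum_eq_zero fun c _ => ?_
  rw [← Finset.mul_sum]
  obtain ⟨c, hc⟩ := c
  rcases c with _ | c
  · simp
  set d : Fin N := ⟨c, by omega⟩
  set e : Fin N := ⟨c + 1, hc⟩
  have hde : d ≠ e := fun h => by simpa [d, e] using congrArg Fin.val h
  set S := ∑ σ : Equiv.Perm (Fin N), (Equiv.Perm.sign σ : ℤ) *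
    (wordCount (fun i => a i + ((((σ i : Fin N) : ℕ) : ℤ) - if σ i = e then 1 else 0)) g : ℤ)
    with hS
  have h2 : S = -S := by
    conv_lhs => rw [hS, ← Equiv.sum_comp (Equiv.mulLeft (Equiv.swap d e))]
    rw [hS, ← Finset.sum_neg_distrib]
    refine Finset.sum_congr rfl fun σ _ => ?_
    rw [Equiv.coe_mulLeft, Equiv.Perm.sign_mul, Equiv.Perm.sign_swap hde]
    have h3 : (fun i => a i + (((((Equiv.swap d e * σ) i : Fin N) : ℕ) : ℤ) -
        if (Equiv.swap d e * σ) i = e then 1 else 0)) =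
        fun i => a i + ((((σ i : Fin N) : ℕ) : ℤ) - if σ i = e then 1 else 0) := by
      ext i
      rw [Equiv.Perm.mul_apply]
      by_cases hi : σ i = d
      · rw [hi, Equiv.swap_apply_left, if_pos rfl, if_neg hde]
        simp [d, e]
      · by_cases hi' : σ i = e
        · rw [hi', Equiv.swap_apply_right, if_pos rfl, if_neg hde]
          simp [d, e]
        · rw [Equiv.swap_apply_of_ne_of_ne hi hi']
    rw [h3]
    push_cast
    ring
  have h3 : S = 0 := by omega
  rw [h3, mul_zero]

/-- Here contents enter. Letter b carries the weight a b + σ b - 1, and the part with σ b cancels by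
`sum_sign_mul_wordCount_eq_zero`. What remains, a b - 1, is the content of the last box of row b,
since a b is the row length minus b. -/
theorem sum_jtChar_mul_swap {N n : ℕ} (a : Fin N → ℤ) (g : Equiv.Perm (Fin n)) :
    ∑ i : Fin n, jtChar a (permSucc n g * Equiv.swap i.castSucc (Fin.last n)) =
      ∑ b, (a b - 1) * jtChar (a - Pi.single b 1) g := by
  have h := sum_sign_mul_wordCount_eq_zero a g
  rw [Finset.sum_comm] at h
  simp_rw [jtChar]
  rw [Finset.sum_comm]
  simp_rw [← Finset.mul_sum, sum_wordCount_mul_swap, Finset.mul_sum]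
  rw [Finset.sum_comm, ← sub_eq_zero, ← Finset.sum_sub_distrib, ← h]
  refine Finset.sum_congr rfl fun b _ => ?_
  rw [← Finset.sum_sub_distrib]
  refine Finset.sum_congr rfl fun σ _ => ?_
  rw [add_sub_single]
  ring

theorem wordCount_comp_perm {N n : ℕ} (α : Fin N → ℤ) (π : Equiv.Perm (Fin N))
    (g : Equiv.Perm (Fin n)) : wordCount (α ∘ π) g = wordCount α g := by
  have hcard : ∀ (w : Fin n → Fin N) (π : Equiv.Perm (Fin N)) (a : Fin N),
      (Finset.univ.filter fun i => (π ∘ w) i = a).card =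
        (Finset.univ.filter fun i => w i = π.symm a).card := by
    intro w π a
    simp only [Function.comp_apply, ← Equiv.eq_symm_apply]
  refine Finset.card_nbij' (fun w => π ∘ w) (fun w => π.symm ∘ w) ?_ ?_ ?_ ?_
  · intro w hw
    rw [Finset.mem_coe, Finset.mem_filter] at hw ⊢
    refine ⟨Finset.mem_univ _, by rw [Function.comp_assoc, hw.2.1], fun a => ?_⟩
    rw [hcard, hw.2.2, Function.comp_apply, Equiv.apply_symm_apply]
  · intro w hw
    rw [Finset.mem_coe, Finset.mem_filter] at hw ⊢
    refine ⟨Finset.mem_univ _, by rw [Function.comp_assoc, hw.2.1], fun a => ?_⟩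
    rw [hcard, hw.2.2, Function.comp_apply, Equiv.symm_symm]
  · intro w _
    ext i
    simp
  · intro w _
    ext i
    simp

theorem jtChar_eq_zero_of_eq {N n : ℕ} {a : Fin N → ℤ} {i j : Fin N} (hij : i ≠ j)
    (h : a i = a j) (g : Equiv.Perm (Fin n)) : jtChar a g = 0 := by
  have h2 : jtChar a g = -jtChar a g := by
    conv_lhs => rw [jtChar, ← Equiv.sum_comp (Equiv.mulRight (Equiv.swap i j))]
    rw [jtChar, ← Finset.sum_neg_distrib]
    refine Finset.sum_congr rfl fun σ _ => ?_
    rw [Equiv.coe_mulRight, Equiv.Perm.sign_mul, Equiv.Perm.sign_swap hij]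
    have h3 : (fun k => a k + ((((σ * Equiv.swap i j) k : Fin N) : ℕ) : ℤ)) =
        (fun k => a k + (((σ k : Fin N) : ℕ) : ℤ)) ∘ Equiv.swap i j := by
      ext k
      rw [Function.comp_apply, Equiv.Perm.mul_apply]
      congr 1
      by_cases hi : k = i
      · rw [hi, Equiv.swap_apply_left, h]
      · by_cases hj : k = j
        · rw [hj, Equiv.swap_apply_right, h]
        · rw [Equiv.swap_apply_of_ne_of_ne hi hj]
    rw [h3, wordCount_comp_perm]
    push_cast
    ring
  omega

theorem jtChar_eq_zero_of_neg {N n : ℕ} {a : Fin N → ℤ} {i : Fin N} (h : a i + (N - 1 : ℤ) < 0)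
    (g : Equiv.Perm (Fin n)) : jtChar a g = 0 := by
  refine Finset.sum_eq_zero fun σ _ => ?_
  rw [wordCount_of_neg (a := i), Nat.cast_zero, mul_zero]
  have := (σ i).2
  omega

/-- If row b has no removable box, then either the next row has the same length, so that two shifted
lengths collide, or row b is the empty last row, so that every word content is negative at b. Thus
branching only meets genuine partitions. -/
theorem isShifted_sub_single_or {N n : ℕ} {a : Fin N → ℤ} (ha : IsShifted a) (b : Fin N) :
    IsShifted (a - Pi.single b 1) ∨
      ∀ g : Equiv.Perm (Fin n), jtChar (a - Pi.single b 1) g = 0 := by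
  have hval : ∀ i, (a - Pi.single b 1 : Fin N → ℤ) i = a i - if i = b then 1 else 0 := fun i => by
    rw [Pi.sub_apply, Pi.single_apply]
  by_cases h1 : ∃ i, i ≠ b ∧ a i = a b - 1
  · obtain ⟨i, hi, h⟩ := h1
    right
    refine jtChar_eq_zero_of_eq hi ?_
    rw [hval, hval, if_neg hi, if_pos rfl, h, sub_zero]
  push Not at h1
  by_cases h2 : a b - 1 + (N - 1 : ℤ) < 0
  · right
    refine jtChar_eq_zero_of_neg (i := b) ?_
    rwa [hval, if_pos rfl]
  left
  constructor
  · intro i j hij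
    have h3 := ha.strictAnti hij
    rw [hval, hval]
    have h4 : i = b → j ≠ b := fun h h' => hij.ne (h.trans h'.symm)
    split_ifs with hj hi hi
    · omega
    · omega
    · have := h1 j hj
      rw [hi] at h3 ⊢
      omega
    · omega
  · intro i
    have h3 := ha.nonneg i
    rw [hval]
    split_ifs with hi
    -- An empty row that is not the last is followed by an empty row, whose shifted length is a b -
    -- 1; this is excluded by `h1`.
    · by_contra hcon
      have hi2 := i.2
      have h4 : (i : ℕ) + 1 < N := by
        rw [← hi] at h2
        omega
      have h5 := ha.nonneg ⟨i + 1, h4⟩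
      have h6 : a ⟨i + 1, h4⟩ < a i := ha.strictAnti (Fin.lt_def.mpr (Nat.lt_succ_self _))
      apply h1 ⟨i + 1, h4⟩
      · rw [← hi]
        intro h
        simpa using congrArg Fin.val h
      · rw [← hi]
        push_cast at h5
        omega
    · omega

/-! ### Integral trace functions of norm one on a group algebra -/

section TraceFunction

variable {K : Type*} [Field K]

/-- Off-diagonal matrix units are commutators, and E_jj = E_j0 E_0j has the same value as E_0j E_j0
= E_00. -/
theorem trace_function_matrix {d : ℕ} [NeZero d] (T : Matrix (Fin d) (Fin d) K →ₗ[K] K)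
    (hT : ∀ x y, T (x * y) = T (y * x)) (m : Matrix (Fin d) (Fin d) K) :
    T m = T (Matrix.single 0 0 1) * m.trace := by
  have h1 : ∀ (j k : Fin d) (r : K), T (Matrix.single j k r) =
      T (Matrix.single 0 0 1) * (Matrix.single j k r).trace := by
    intro j k r
    have hr : Matrix.single j k r = r • Matrix.single j k (1 : K) := by
      rw [Matrix.smul_single, smul_eq_mul, mul_one]
    by_cases hjk : j = k
    · subst hjk
      have h := hT (Matrix.single j 0 (1 : K)) (Matrix.single 0 j (1 : K))
      rw [Matrix.single_mul_single_same, Matrix.single_mul_single_same, one_mul] at h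
      rw [hr, map_smul, h, Matrix.trace_smul, Matrix.trace_single_eq_same, smul_eq_mul,
        smul_eq_mul, mul_one, mul_comm]
    · have h := hT (Matrix.single j j (1 : K)) (Matrix.single j k (1 : K))
      rw [Matrix.single_mul_single_same, one_mul, Matrix.single_mul_single_of_ne _ _ _ _
        (Ne.symm hjk), map_zero] at h
      rw [hr, map_smul, h, ← hr, Matrix.trace_single_eq_of_ne _ _ _ hjk, smul_zero, mul_zero]
  conv_lhs => rw [Matrix.matrix_eq_sum_single m]
  conv_rhs => rw [Matrix.matrix_eq_sum_single m]
  rw [map_sum, Matrix.trace_sum, Finset.mul_sum]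
  refine Finset.sum_congr rfl fun j _ => ?_
  rw [map_sum, Matrix.trace_sum, Finset.mul_sum]
  exact Finset.sum_congr rfl fun k _ => h1 j k _

theorem trace_function_pi {n : ℕ} {d : Fin n → ℕ} [∀ i, NeZero (d i)]
    (T : (∀ i, Matrix (Fin (d i)) (Fin (d i)) K) →ₗ[K] K)
    (hT : ∀ x y, T (x * y) = T (y * x)) (m : ∀ i, Matrix (Fin (d i)) (Fin (d i)) K) :
    T m = ∑ i, T (Pi.single i (Matrix.single 0 0 1)) * (m i).trace := by
  conv_lhs => rw [← Finset.univ_sum_single m]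
  rw [map_sum]
  refine Finset.sum_congr rfl fun i _ => ?_
  refine trace_function_matrix (T ∘ₗ LinearMap.single K (fun i => Matrix (Fin (d i)) (Fin (d i)) K) i) (fun x y => ?_) (m i)
  simp only [LinearMap.comp_apply, LinearMap.coe_single, Pi.single_mul, hT]

/-- The trace of left multiplication. -/
noncomputable def leftMulTrace (A : Type*) [Ring A] [Algebra K A] : A →ₗ[K] K :=
  LinearMap.trace K A ∘ₗ (Algebra.lmul K A).toLinearMap

theorem leftMulTrace_apply {A : Type*} [Ring A] [Algebra K A] (x : A) :
    leftMulTrace (K := K) A x = LinearMap.trace K A (Algebra.lmul K A x) := rfl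

theorem leftMulTrace_mul_comm {A : Type*} [Ring A] [Algebra K A] (x y : A) :
    leftMulTrace (K := K) A (x * y) = leftMulTrace A (y * x) := by
  rw [leftMulTrace_apply, leftMulTrace_apply, map_mul (Algebra.lmul K A),
    map_mul (Algebra.lmul K A), LinearMap.trace_mul_comm]

theorem leftMulTrace_eq_sum {A ι : Type*} [Ring A] [Algebra K A] [Fintype ι] [DecidableEq ι]
    (b : Module.Basis ι K A) (x : A) :
    leftMulTrace (K := K) A x = ∑ i, b.repr (x * b i) i := by
  rw [leftMulTrace_apply, LinearMap.trace_eq_matrix_trace K b, Matrix.trace]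
  simp_rw [Matrix.diag_apply, LinearMap.toMatrix_apply]
  rfl

/-- Left multiplication by E_00 of block i projects onto the zeroth row of that block, a space of
dimension `d i`. -/
theorem leftMulTrace_pi_single {n : ℕ} {d : Fin n → ℕ} [∀ i, NeZero (d i)] (i : Fin n) :
    leftMulTrace (K := K) (∀ i, Matrix (Fin (d i)) (Fin (d i)) K)
      (Pi.single i (Matrix.single 0 0 1)) = d i := by
  classical
  let b := Pi.basis fun j => Matrix.stdBasis K (Fin (d j)) (Fin (d j))
  rw [leftMulTrace_eq_sum b, Fintype.sum_sigma]
  have h : ∀ (j : Fin n) (p : Fin (d j) × Fin (d j)),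
      b.repr (Pi.single i (Matrix.single 0 0 1) * b ⟨j, p⟩) ⟨j, p⟩ =
        if j = i ∧ (p.1 : ℕ) = 0 then 1 else 0 := by
    rintro j ⟨k, l⟩
    rw [Pi.basis_apply, Pi.basis_repr,
      Pi.mul_apply, Pi.single_eq_same, Matrix.stdBasis_eq_single]
    by_cases hj : j = i
    · subst hj
      rw [Pi.single_eq_same]
      by_cases hk : k = 0
      · subst hk
        rw [Matrix.single_mul_single_same, one_mul, ← Matrix.stdBasis_eq_single,
          Module.Basis.repr_self, Finsupp.single_eq_same, if_pos ⟨rfl, rfl⟩]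
      · rw [Matrix.single_mul_single_of_ne _ _ _ _ (Ne.symm hk), map_zero, Finsupp.zero_apply,
          if_neg]
        exact fun h => hk (Fin.ext h.2)
    · rw [Pi.single_eq_of_ne hj, zero_mul, map_zero, Finsupp.zero_apply, if_neg]
      exact fun h => hj h.1
  simp_rw [h]
  rw [Finset.sum_eq_single i]
  · simp only [true_and, Fintype.sum_prod_type]
    have h2 : ∀ k : Fin (d i), ((k : ℕ) = 0) ↔ k = 0 := fun k => Fin.val_eq_zero_iff
    simp [h2]
  · intro j _ hj
    simp [hj]
  · simp

theorem leftMulTrace_monoidAlgebra {G : Type*} [Group G] [Fintype G] [DecidableEq G]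
    (x : MonoidAlgebra K G) :
    leftMulTrace (K := K) (MonoidAlgebra K G) x = Fintype.card G * x.coeff 1 := by
  rw [leftMulTrace_eq_sum (MonoidAlgebra.basis G K)]
  have h : ∀ g : G, (MonoidAlgebra.basis G K).repr
      (x * MonoidAlgebra.basis G K g) g = x.coeff 1 := by
    intro g
    rw [MonoidAlgebra.basis_apply]
    change (x * MonoidAlgebra.single g 1).coeff g = _
    rw [MonoidAlgebra.coeff_mul_single_apply, mul_inv_cancel, mul_one]
  simp_rw [h]
  rw [Finset.sum_const, Finset.card_univ, nsmul_eq_mul]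

theorem leftMulTrace_algEquiv {A B : Type*} [Ring A] [Ring B] [Algebra K A] [Algebra K B]
    (φ : A ≃ₐ[K] B) (x : A) : leftMulTrace (K := K) B (φ x) = leftMulTrace A x := by
  rw [leftMulTrace_apply, leftMulTrace_apply, ← LinearMap.trace_conj' _ φ.toLinearEquiv]
  congr 1
  ext y
  simp [LinearEquiv.conj_apply]

theorem exists_sq_eq_one_of_sum_sq {n : ℕ} {m : Fin n → ℤ} (h : ∑ i, m i ^ 2 = 1) :
    ∃ i, m i ^ 2 = 1 ∧ ∀ j, j ≠ i → m j = 0 := by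
  have h1 : ∃ i, m i ≠ 0 := by
    by_contra! hcon
    simp [hcon] at h
  obtain ⟨i, hi⟩ := h1
  have h2 : 1 ≤ m i ^ 2 := by
    have : 0 < m i ^ 2 := by positivity
    omega
  rw [← Finset.add_sum_erase _ _ (Finset.mem_univ i)] at h
  have h3 : 0 ≤ ∑ j ∈ Finset.univ.erase i, m j ^ 2 := Finset.sum_nonneg fun j _ => sq_nonneg _
  refine ⟨i, by omega, fun j hj => ?_⟩
  have h4 : ∑ j ∈ Finset.univ.erase i, m j ^ 2 = 0 := by omega
  rw [Finset.sum_eq_zero_iff_of_nonneg fun j _ => sq_nonneg _] at h4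
  exact pow_eq_zero_iff two_ne_zero |>.mp (h4 j (Finset.mem_erase.mpr ⟨hj, Finset.mem_univ j⟩))

/-- A trace function on the group algebra of a finite group which is integral on idempotents and
has norm one is an irreducible character up to sign, hence multiplicative on the center up to
normalization. -/
theorem trace_function_mul_of_norm_one [IsAlgClosed K] [CharZero K] {G : Type*} [Group G]
    [Fintype G] (F : MonoidAlgebra K G →ₗ[K] K) (hF : ∀ x y, F (x * y) = F (y * x))
    (hint : ∀ e, IsIdempotentElem e → ∃ m : ℤ, F e = m)
    (hnorm : ∑ g : G, F (MonoidAlgebra.single g 1) * F (MonoidAlgebra.single g⁻¹ 1) =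
      Fintype.card G) :
    F 1 ≠ 0 ∧ ∀ z x, (∀ y, z * y = y * z) → F (z * x) * F 1 = F z * F x := by
  classical
  have hne : NeZero (Nat.card G : K) := ⟨by exact_mod_cast Nat.card_pos.ne'⟩
  obtain ⟨n, d, hd, ⟨φ⟩⟩ :=
    IsSemisimpleRing.exists_algEquiv_pi_matrix_of_isAlgClosed K (MonoidAlgebra K G)
  -- One rank-one idempotent per block: a trace function is the combination of the block traces with
  -- coefficients its values at `ε`, which are integers for `F`.
  let ε : Fin n → MonoidAlgebra K G := fun i => φ.symm (Pi.single i (Matrix.single 0 0 1))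
  have hexp : ∀ (T : MonoidAlgebra K G →ₗ[K] K), (∀ x y, T (x * y) = T (y * x)) →
      ∀ x, T x = ∑ i, T (ε i) * (φ x i).trace := by
    intro T hT x
    have h := trace_function_pi (T ∘ₗ φ.symm.toLinearMap) (fun x y => by simp [hT]) (φ x)
    simpa using h
  have hidem : ∀ i, IsIdempotentElem (ε i) := by
    intro i
    rw [IsIdempotentElem, ← map_mul, ← Pi.single_mul, Matrix.single_mul_single_same, one_mul]
  choose m hm using fun i => hint (ε i) (hidem i)
  have hFx : ∀ x, F x = ∑ i, (m i : K) * (φ x i).trace := by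
    intro x
    rw [hexp F hF x]
    simp_rw [hm]
  have hreg : ∀ x, leftMulTrace (K := K) (MonoidAlgebra K G) x = ∑ i, (d i : K) * (φ x i).trace := by
    intro x
    rw [hexp (leftMulTrace _) leftMulTrace_mul_comm x]
    refine Finset.sum_congr rfl fun i _ => ?_
    rw [← leftMulTrace_algEquiv φ, AlgEquiv.apply_symm_apply, leftMulTrace_pi_single]
  -- `u` represents |G| · F with respect to the trace of the regular representation. Nondegeneracy
  -- of the trace form on each block makes φ u scalar there.
  let u : MonoidAlgebra K G := ∑ g, MonoidAlgebra.single g (F (MonoidAlgebra.single g⁻¹ 1))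
  have hux : ∀ x, leftMulTrace (K := K) (MonoidAlgebra K G) (u * x) = Fintype.card G * F x := by
    intro x
    rw [leftMulTrace_monoidAlgebra]
    congr 1
    simp only [u, Finset.sum_mul, MonoidAlgebra.coeff_sum, Finsupp.finsetSum_apply,
      MonoidAlgebra.coeff_single_mul_apply, mul_one]
    conv_rhs => rw [← MonoidAlgebra.sum_coeff_single x, Finsupp.sum_fintype _ _ (by simp), map_sum]
    rw [← Equiv.sum_comp (Equiv.inv G)]
    refine Finset.sum_congr rfl fun g _ => ?_
    rw [Equiv.inv_apply, inv_inv, ← mul_one (x.coeff g), ← smul_eq_mul (x.coeff g),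
      ← MonoidAlgebra.smul_single, map_smul, smul_eq_mul, smul_eq_mul, mul_one, mul_comm]
  have hcard : (Fintype.card G : K) ≠ 0 := by exact_mod_cast Fintype.card_ne_zero
  have hui : ∀ i, (d i : K) • φ u i = ((Fintype.card G : K) * m i) • 1 := by
    intro i
    rw [Matrix.ext_iff_trace_mul_right]
    intro y
    have h1 := hux (φ.symm (Pi.single i y))
    rw [hreg, hFx, map_mul, AlgEquiv.apply_symm_apply] at h1
    rw [Finset.sum_eq_single i, Finset.sum_eq_single i] at h1
    · rw [Pi.mul_apply, Pi.single_eq_same] at h1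
      rw [Matrix.smul_mul, Matrix.trace_smul, smul_eq_mul, h1, Matrix.smul_mul, one_mul,
        Matrix.trace_smul, smul_eq_mul, mul_assoc]
    · intro j _ hj
      rw [Pi.single_eq_of_ne hj, Matrix.trace_zero, mul_zero]
    · simp
    · intro j _ hj
      rw [Pi.mul_apply, Pi.single_eq_of_ne hj, mul_zero, Matrix.trace_zero, mul_zero]
    · simp
  have htr : ∀ i, (φ u i).trace = (Fintype.card G : K) * m i := by
    intro i
    have h1 := congrArg Matrix.trace (hui i)
    rw [Matrix.trace_smul, Matrix.trace_smul, Matrix.trace_one, Fintype.card_fin, smul_eq_mul,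
      smul_eq_mul, mul_comm] at h1
    exact mul_right_cancel₀ (by exact_mod_cast (hd i).out) h1
  -- Evaluating `F` at `u` in two ways turns the norm hypothesis into a sum of integer squares equal
  -- to 1, so only one block survives, with coefficient ±1.
  have hsum : ∑ i, m i ^ 2 = 1 := by
    have h1 : F u = Fintype.card G := by
      rw [← hnorm]
      simp only [u, map_sum]
      refine Finset.sum_congr rfl fun g _ => ?_
      rw [← mul_one (F (MonoidAlgebra.single g⁻¹ 1)), ← smul_eq_mul,
        ← MonoidAlgebra.smul_single, map_smul, smul_eq_mul, smul_eq_mul, mul_one, mul_comm]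
    rw [hFx] at h1
    simp_rw [htr] at h1
    have h2 : (Fintype.card G : K) * ∑ i, (m i : K) ^ 2 = (Fintype.card G : K) * 1 := by
      rw [mul_one, Finset.mul_sum]
      conv_rhs => rw [← h1]
      exact Finset.sum_congr rfl fun i _ => by ring
    exact_mod_cast mul_left_cancel₀ hcard h2
  obtain ⟨i, hi, hj⟩ := exists_sq_eq_one_of_sum_sq hsum
  have hF1 : ∀ x, F x = (m i : K) * (φ x i).trace := by
    intro x
    rw [hFx, Finset.sum_eq_single i]
    · intro j _ hji
      rw [hj j hji, Int.cast_zero, zero_mul]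
    · simp
  have hone : F 1 = m i * d i := by
    rw [hF1, map_one, Pi.one_apply, Matrix.trace_one, Fintype.card_fin]
  refine ⟨?_, fun z x hz => ?_⟩
  · rw [hone]
    refine mul_ne_zero ?_ (by exact_mod_cast (hd i).out)
    have : m i ≠ 0 := by
      rintro h
      rw [h] at hi
      norm_num at hi
    exact_mod_cast this
  · obtain ⟨c, hc⟩ : φ z i ∈ Set.range (Matrix.scalar (Fin (d i))) := by
      rw [Matrix.mem_range_scalar_iff_commute_single']
      intro k l
      have h1 := congrArg φ (hz (φ.symm (Pi.single i (Matrix.single k l 1))))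
      rw [map_mul, map_mul, AlgEquiv.apply_symm_apply] at h1
      have h2 := congrFun h1 i
      rw [Pi.mul_apply, Pi.mul_apply, Pi.single_eq_same] at h2
      exact h2.symm
    have hc' : φ z i = c • 1 := by
      rw [← hc, Matrix.scalar_apply, Matrix.smul_one_eq_diagonal]
    rw [hone, hF1, hF1 z, hF1 x, map_mul, Pi.mul_apply, hc', Matrix.smul_mul, one_mul,
      Matrix.trace_smul, Matrix.trace_smul, Matrix.trace_one, Fintype.card_fin, smul_eq_mul,
      smul_eq_mul]
    ring

/-- The trace of a permutation module is integral on idempotents. -/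
theorem exists_int_trace_of_isIdempotentElem [CharZero K] {ι : Type*} [Fintype ι] [DecidableEq ι]
    {e : Matrix ι ι K} (he : IsIdempotentElem e) : ∃ m : ℤ, e.trace = m := by
  have h1 : IsIdempotentElem (Matrix.toLin' e) := by
    rw [IsIdempotentElem, Module.End.mul_eq_comp, ← Matrix.toLin'_mul, he.eq]
  have h2 := (LinearMap.IsIdempotentElem.isProj_range _ h1).trace
  rw [Matrix.trace_toLin'_eq] at h2
  exact ⟨_, by rw [h2]; norm_cast⟩

end TraceFunction

/-! ### The blocks -/

section SymmetricValues

variable {A : Type*} [Semiring A]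

theorem elemSym_zero {m : ℕ} (x : Fin m → A) : elemSym x 0 = 1 := by
  rw [elemSym, Finset.sum_eq_single Fin.elim0]
  · simp
  · intro f _ hf
    exact absurd (Subsingleton.elim _ _) hf
  · intro h
    exact absurd (Finset.mem_filter.mpr ⟨Finset.mem_univ _, fun i => i.elim0⟩) h

theorem complSym_zero {m : ℕ} (x : Fin m → A) : complSym x 0 = 1 := by
  rw [complSym, Finset.sum_eq_single Fin.elim0]
  · simp
  · intro f _ hf
    exact absurd (Subsingleton.elim _ _) hf
  · intro h
    exact absurd (Finset.mem_filter.mpr ⟨Finset.mem_univ _, fun i => i.elim0⟩) h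

theorem elemSym_fin_zero (x : Fin 0 → A) (b : ℕ) : elemSym x (b + 1) = 0 := by
  rw [elemSym]
  exact Finset.sum_eq_zero fun f _ => (f 0).elim0

theorem complSym_fin_zero (x : Fin 0 → A) (b : ℕ) : complSym x (b + 1) = 0 := by
  rw [complSym]
  exact Finset.sum_eq_zero fun f _ => (f 0).elim0

theorem prod_ofFn_succ {b m : ℕ} (x : Fin m → A) (f : Fin (b + 1) → Fin m) :
    (List.ofFn fun i => x (f i)).prod =
      (List.ofFn fun i : Fin b => x (f i.castSucc)).prod * x (f (Fin.last b)) := by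
  rw [List.ofFn_succ', List.concat_eq_append, List.prod_append, List.prod_singleton]

theorem exists_castSucc_of_monotone {b m : ℕ} {f : Fin (b + 1) → Fin (m + 1)} (hf : Monotone f)
    (h : f (Fin.last b) ≠ Fin.last m) : ∃ f' : Fin (b + 1) → Fin m, f = fun i => (f' i).castSucc := by
  have h1 : ∀ i, f i ≠ Fin.last m := fun i hi => by
    have h2 := hf (Fin.le_last i)
    rw [hi] at h2
    exact h (le_antisymm (Fin.le_last _) h2)
  exact ⟨fun i => (f i).castPred (h1 i), by ext i; simp⟩

/-- Split according to whether the largest index is the top one. Its factor stays on the right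
because the values need not commute. -/
theorem elemSym_succ {m : ℕ} (x : Fin (m + 1) → A) (b : ℕ) :
    elemSym x (b + 1) = elemSym (fun i : Fin m => x i.castSucc) (b + 1) +
      elemSym (fun i : Fin m => x i.castSucc) b * x (Fin.last m) := by
  classical
  rw [elemSym, ← Finset.sum_filter_not_add_sum_filter _ fun f => f (Fin.last b) = Fin.last m]
  congr 1
  · rw [elemSym]
    symm
    refine Finset.sum_bij (fun f _ i => (f i).castSucc) ?_ ?_ ?_ ?_
    · intro f hf
      rw [Finset.mem_filter, Finset.mem_filter]
      refine ⟨⟨Finset.mem_univ _, fun i j hij => ?_⟩, Fin.castSucc_ne_last _⟩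
      exact Fin.castSucc_lt_castSucc_iff.mpr ((Finset.mem_filter.mp hf).2 hij)
    · intro f _ f' _ h
      ext i
      simpa using congrArg Fin.val (congrFun h i)
    · intro f hf
      rw [Finset.mem_filter, Finset.mem_filter] at hf
      obtain ⟨f', rfl⟩ := exists_castSucc_of_monotone hf.1.2.monotone hf.2
      exact ⟨f', Finset.mem_filter.mpr ⟨Finset.mem_univ _, fun i j hij =>
        Fin.castSucc_lt_castSucc_iff.mp (hf.1.2 hij)⟩, rfl⟩
    · intro f _
      rfl
  · rw [elemSym, Finset.sum_mul]
    symm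
    refine Finset.sum_bij (fun f _ => Fin.snoc (fun i => (f i).castSucc) (Fin.last m)) ?_ ?_ ?_ ?_
    · intro f hf
      rw [Finset.mem_filter, Finset.mem_filter]
      refine ⟨⟨Finset.mem_univ _, fun i j hij => ?_⟩, by simp⟩
      cases j using Fin.lastCases with
      | last =>
        cases i using Fin.lastCases with
        | last => exact absurd hij (lt_irrefl _)
        | cast i => simp [Fin.castSucc_lt_last]
      | cast j =>
        cases i using Fin.lastCases with
        | last => exact absurd hij (not_lt.mpr (Fin.le_last _))
        | cast i =>
          simpa using (Finset.mem_filter.mp hf).2 (Fin.castSucc_lt_castSucc_iff.mp hij)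
    · intro f _ f' _ h
      ext i
      simpa using congrArg Fin.val (congrFun h i.castSucc)
    · intro f hf
      rw [Finset.mem_filter, Finset.mem_filter] at hf
      have h1 : ∀ i : Fin b, f i.castSucc ≠ Fin.last m := fun i hi => by
        have h2 := hf.1.2 (Fin.castSucc_lt_last i)
        rw [hi] at h2
        exact absurd h2 (not_lt.mpr (Fin.le_last _))
      refine ⟨fun i => (f i.castSucc).castPred (h1 i), ?_, ?_⟩
      · refine Finset.mem_filter.mpr ⟨Finset.mem_univ _, fun i j hij => ?_⟩
        exact Fin.castPred_lt_castPred_iff.mpr (hf.1.2 (Fin.castSucc_lt_castSucc_iff.mpr hij))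
      · ext i
        cases i using Fin.lastCases with
        | last => simp [hf.2]
        | cast i => simp
    · intro f _
      rw [prod_ofFn_succ]
      simp

/-- After removing one top index from a weakly increasing sequence, the rest may still reach the
top, so all m + 1 values remain in the second term. -/
theorem complSym_succ {m : ℕ} (x : Fin (m + 1) → A) (b : ℕ) :
    complSym x (b + 1) = complSym (fun i : Fin m => x i.castSucc) (b + 1) +
      complSym x b * x (Fin.last m) := by
  classical
  rw [complSym, ← Finset.sum_filter_not_add_sum_filter _ fun f => f (Fin.last b) = Fin.last m]
  congr 1
  · rw [complSym]
    symm
    refine Finset.sum_bij (fun f _ i => (f i).castSucc) ?_ ?_ ?_ ?_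
    · intro f hf
      rw [Finset.mem_filter, Finset.mem_filter]
      refine ⟨⟨Finset.mem_univ _, fun i j hij => ?_⟩, Fin.castSucc_ne_last _⟩
      exact Fin.castSucc_le_castSucc_iff.mpr ((Finset.mem_filter.mp hf).2 hij)
    · intro f _ f' _ h
      ext i
      simpa using congrArg Fin.val (congrFun h i)
    · intro f hf
      rw [Finset.mem_filter, Finset.mem_filter] at hf
      obtain ⟨f', rfl⟩ := exists_castSucc_of_monotone hf.1.2 hf.2
      exact ⟨f', Finset.mem_filter.mpr ⟨Finset.mem_univ _, fun i j hij =>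
        Fin.castSucc_le_castSucc_iff.mp (hf.1.2 hij)⟩, rfl⟩
    · intro f _
      rfl
  · rw [complSym, Finset.sum_mul]
    symm
    refine Finset.sum_bij (fun f _ => Fin.snoc f (Fin.last m)) ?_ ?_ ?_ ?_
    · intro f hf
      rw [Finset.mem_filter, Finset.mem_filter]
      refine ⟨⟨Finset.mem_univ _, fun i j hij => ?_⟩, by simp⟩
      cases j using Fin.lastCases with
      | last => simpa using Fin.le_last _
      | cast j =>
        cases i using Fin.lastCases with
        | last => exact absurd (lt_of_lt_of_le (Fin.castSucc_lt_last j) hij) (lt_irrefl _)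
        | cast i =>
          simpa using (Finset.mem_filter.mp hf).2 (Fin.castSucc_le_castSucc_iff.mp hij)
    · intro f _ f' _ h
      ext i
      simpa using congrArg Fin.val (congrFun h i.castSucc)
    · intro f hf
      rw [Finset.mem_filter, Finset.mem_filter] at hf
      refine ⟨fun i => f i.castSucc, ?_, ?_⟩
      · refine Finset.mem_filter.mpr ⟨Finset.mem_univ _, fun i j hij => ?_⟩
        exact hf.1.2 (Fin.castSucc_le_castSucc_iff.mpr hij)
      · ext i
        cases i using Fin.lastCases with
        | last => simp [hf.2]
        | cast i => simp
    · intro f _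
      rw [prod_ofFn_succ]
      simp

theorem map_elemSym {B : Type*} [Semiring B] (φ : A →+* B) {m : ℕ} (x : Fin m → A) (b : ℕ) :
    φ (elemSym x b) = elemSym (fun i => φ (x i)) b := by
  rw [elemSym, elemSym, map_sum]
  refine Finset.sum_congr rfl fun f _ => ?_
  rw [map_list_prod, List.map_ofFn]
  rfl

theorem map_complSym {B : Type*} [Semiring B] (φ : A →+* B) {m : ℕ} (x : Fin m → A) (b : ℕ) :
    φ (complSym x b) = complSym (fun i => φ (x i)) b := by
  rw [complSym, complSym, map_sum]
  refine Finset.sum_congr rfl fun f _ => ?_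
  rw [map_list_prod, List.map_ofFn]
  rfl

end SymmetricValues

/-- The embedding of group algebras induced by `permSucc`. -/
noncomputable def gaSucc (n : ℕ) : GA n →ₐ[ℚ] GA (n + 1) :=
  MonoidAlgebra.mapDomainAlgHom ℚ ℚ (permSucc n)

@[simp]
theorem gaSucc_single {n : ℕ} (g : Equiv.Perm (Fin n)) (r : ℚ) :
    gaSucc n (MonoidAlgebra.single g r) = MonoidAlgebra.single (permSucc n g) r :=
  MonoidAlgebra.mapDomain_single

/-- The Jucys-Murphy element of the last point. -/
noncomputable def lastJM (n : ℕ) : GA (n + 1) :=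
  ∑ i : Fin n, MonoidAlgebra.single (Equiv.swap i.castSucc (Fin.last n)) 1

theorem permSucc_swap {n : ℕ} (i j : Fin n) :
    permSucc n (Equiv.swap i j) = Equiv.swap i.castSucc j.castSucc := by
  ext x
  cases x using Fin.lastCases with
  | last =>
    rw [permSucc_last, Equiv.swap_apply_of_ne_of_ne (Fin.castSucc_ne_last i).symm
      (Fin.castSucc_ne_last j).symm]
  | cast x =>
    rw [permSucc_castSucc, Equiv.swap_apply_def, Equiv.swap_apply_def]
    simp only [Fin.castSucc_inj]
    split_ifs <;> rfl

theorem jucysMurphy_castSucc (m : ℕ) (k : Fin m) :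
    jucysMurphy (m + 2) (k.castSucc : Fin (m + 1)) = gaSucc (m + 1) (jucysMurphy (m + 1) k) := by
  rw [jucysMurphy, jucysMurphy, map_sum, Finset.sum_filter, Finset.sum_filter,
    Fin.sum_univ_castSucc]
  have h1 : ¬ ((Fin.last (m + 1) : Fin (m + 2)) : ℕ) < ((k.castSucc : Fin (m + 1)) : ℕ) + 1 := by
    simp
  rw [if_neg h1, add_zero]
  refine Finset.sum_congr rfl fun i _ => ?_
  rw [gaSucc_single, permSucc_swap]
  rfl

theorem jucysMurphy_last (m : ℕ) :
    jucysMurphy (m + 2) (Fin.last m) = lastJM (m + 1) := by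
  rw [jucysMurphy, lastJM, Finset.sum_filter, Fin.sum_univ_castSucc]
  have h1 : ¬ ((Fin.last (m + 1) : Fin (m + 2)) : ℕ) < ((Fin.last m : Fin (m + 1)) : ℕ) + 1 := by
    simp
  rw [if_neg h1, add_zero]
  refine Finset.sum_congr rfl fun i _ => ?_
  rw [if_pos]
  · rfl
  · simpa using i.2

theorem lastJM_zero : lastJM 0 = 0 := by
  rw [lastJM, Finset.univ_eq_empty, Finset.sum_empty]

theorem strictMonoBlock_zero (n : ℕ) : strictMonoBlock n 0 = 1 := elemSym_zero _

theorem monoBlock_zero (n : ℕ) : monoBlock n 0 = 1 := complSym_zero _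

theorem strictMonoBlock_zero_succ (b : ℕ) : strictMonoBlock 0 (b + 1) = 0 := elemSym_fin_zero _ _

theorem monoBlock_zero_succ (b : ℕ) : monoBlock 0 (b + 1) = 0 := complSym_fin_zero _ _

theorem strictMonoBlock_succ (n b : ℕ) : strictMonoBlock (n + 1) (b + 1) =
    gaSucc n (strictMonoBlock n (b + 1)) + gaSucc n (strictMonoBlock n b) * lastJM n := by
  -- `Fin (n - 1)` is empty for zero points as well as for one, so the first step adds no
  -- Jucys–Murphy element.
  rcases n with _ | n
  · rw [strictMonoBlock_zero_succ, lastJM_zero, map_zero, mul_zero, add_zero]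
    exact elemSym_fin_zero _ _
  · rw [strictMonoBlock, strictMonoBlock, strictMonoBlock, ← AlgHom.coe_toRingHom, map_elemSym,
      map_elemSym]
    refine (elemSym_succ (m := n) (jucysMurphy (n + 2)) b).trans ?_
    rw [jucysMurphy_last]
    simp_rw [jucysMurphy_castSucc]
    rfl

theorem monoBlock_succ (n b : ℕ) : monoBlock (n + 1) (b + 1) =
    gaSucc n (monoBlock n (b + 1)) + monoBlock (n + 1) b * lastJM n := by
  rcases n with _ | n
  · rw [monoBlock_zero_succ, lastJM_zero, map_zero, mul_zero, add_zero]
    exact complSym_fin_zero _ _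
  · rw [monoBlock, monoBlock, monoBlock, ← AlgHom.coe_toRingHom, map_complSym]
    refine (complSym_succ (m := n) (jucysMurphy (n + 2)) b).trans ?_
    rw [jucysMurphy_last]
    simp_rw [jucysMurphy_castSucc]
    rfl

/-! ### The number of cycles and Jucys' theorem -/

/-- A fixed binary word is a free bit on each cycle. So cycle counts can be read off from fixed
words, and the word lemmas show how they change when a point is added. -/
theorem two_pow_card_parts {n : ℕ} (g : Equiv.Perm (Fin n)) :
    2 ^ Multiset.card g.partition.parts = ∑ w : Fin n → Fin 2, if w ∘ g = w then 1 else 0 := by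
  have h := sum_fixed_words (ι := Fin 2) (A := ℕ) g fun _ => 1
  simp only [one_pow, Finset.prod_const_one, Finset.sum_const, Finset.card_univ, Fintype.card_fin,
    smul_eq_mul, mul_one] at h
  rw [← Finset.card_filter, h, cycleProd, Multiset.map_const', Multiset.prod_replicate]

theorem card_parts_permSucc {n : ℕ} (g : Equiv.Perm (Fin n)) :
    Multiset.card (permSucc n g).partition.parts = Multiset.card g.partition.parts + 1 := by
  apply Nat.pow_right_injective (le_refl 2)
  dsimp only
  rw [two_pow_card_parts, sum_words_succ, pow_succ, two_pow_card_parts]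
  simp_rw [comp_permSucc_eq_iff]
  rw [Finset.sum_const, Finset.card_univ, Fintype.card_fin, smul_eq_mul, mul_comm]

theorem card_parts_mul_swap {n : ℕ} (g : Equiv.Perm (Fin n)) (i : Fin n) :
    Multiset.card (permSucc n g * Equiv.swap i.castSucc (Fin.last n)).partition.parts =
      Multiset.card g.partition.parts := by
  apply Nat.pow_right_injective (le_refl 2)
  dsimp only
  rw [two_pow_card_parts, sum_words_succ, two_pow_card_parts]
  simp_rw [comp_permSucc_mul_swap_eq_iff]
  rw [Finset.sum_comm]
  refine Finset.sum_congr rfl fun v _ => ?_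
  by_cases h : v ∘ g = v
  · simp [h]
  · simp [h]

theorem card_parts_le {n : ℕ} (g : Equiv.Perm (Fin n)) :
    Multiset.card g.partition.parts ≤ n := by
  have h := Multiset.card_nsmul_le_sum (s := g.partition.parts) (a := 1)
    fun x hx => g.partition.parts_pos hx
  rwa [partition_parts_sum, smul_eq_mul, mul_one] at h

theorem freeSingleBlock_eq_sum (n b : ℕ) : freeSingleBlock n b =
    ∑ g : Equiv.Perm (Fin n),
      if Multiset.card g.partition.parts + b = n then MonoidAlgebra.single g 1 else 0 := by
  rw [sum_perm_eq_sum_partition, freeSingleBlock, Finset.sum_filter]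
  refine Finset.sum_congr rfl fun α _ => ?_
  rw [classSum]
  split_ifs with h
  · refine Finset.sum_congr rfl fun g hg => ?_
    rw [(Finset.mem_filter.mp hg).2]
    exact (if_pos h).symm
  · symm
    refine Finset.sum_eq_zero fun g hg => ?_
    rw [(Finset.mem_filter.mp hg).2]
    exact if_neg h

/-- A new fixed point preserves the codimension n - ℓ; inserting the new point into a cycle raises
it by one. The resulting recursion is that of `strictMonoBlock_succ`. -/
theorem freeSingleBlock_succ (n b : ℕ) : freeSingleBlock (n + 1) (b + 1) =
    gaSucc n (freeSingleBlock n (b + 1)) + gaSucc n (freeSingleBlock n b) * lastJM n := by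
  rw [freeSingleBlock_eq_sum, freeSingleBlock_eq_sum, freeSingleBlock_eq_sum, sum_perm_succ,
    Finset.sum_add_distrib, map_sum, map_sum, lastJM, Finset.sum_mul]
  congr 1
  · refine Finset.sum_congr rfl fun g _ => ?_
    rw [card_parts_permSucc, apply_ite (gaSucc n), gaSucc_single, map_zero]
    congr 1
    exact propext ⟨fun h => by omega, fun h => by omega⟩
  · refine Finset.sum_congr rfl fun g _ => ?_
    rw [Finset.mul_sum]
    refine Finset.sum_congr rfl fun i _ => ?_
    rw [card_parts_mul_swap, apply_ite (gaSucc n), gaSucc_single, map_zero, ite_mul, zero_mul,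
      MonoidAlgebra.single_mul_single, mul_one]
    congr 1
    exact propext ⟨fun h => by omega, fun h => by omega⟩

theorem freeSingleBlock_zero_right (n : ℕ) : freeSingleBlock n 0 = 1 := by
  rw [freeSingleBlock_eq_sum]
  induction n with
  | zero =>
    rw [Finset.sum_eq_single 1]
    · rw [if_pos, MonoidAlgebra.one_def]
      have := card_parts_le (1 : Equiv.Perm (Fin 0))
      omega
    · intro g _ hg
      exact absurd (Subsingleton.elim _ _) hg
    · simp
  | succ n ih =>
    rw [sum_perm_succ, ← map_one (gaSucc n), ← ih, map_sum]
    refine Finset.sum_congr rfl fun g _ => ?_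
    rw [card_parts_permSucc, apply_ite (gaSucc n), gaSucc_single, map_zero, Finset.sum_eq_zero,
      add_zero]
    · congr 1
      exact propext ⟨fun h => by omega, fun h => by omega⟩
    · intro i _
      rw [card_parts_mul_swap, if_neg]
      have := card_parts_le g
      omega

theorem freeSingleBlock_zero_succ (b : ℕ) : freeSingleBlock 0 (b + 1) = 0 := by
  rw [freeSingleBlock_eq_sum]
  exact Finset.sum_eq_zero fun g _ => if_neg (by omega)

/-- Jucys' theorem: the strictly monotone block is the free single block. -/
theorem strictMonoBlock_eq_freeSingleBlock (n b : ℕ) :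
    strictMonoBlock n b = freeSingleBlock n b := by
  induction n generalizing b with
  | zero =>
    rcases b with _ | b
    · rw [strictMonoBlock_zero, freeSingleBlock_zero_right]
    · rw [strictMonoBlock_zero_succ, freeSingleBlock_zero_succ]
  | succ n ih =>
    rcases b with _ | b
    · rw [strictMonoBlock_zero, freeSingleBlock_zero_right]
    · rw [strictMonoBlock_succ, freeSingleBlock_succ, ih, ih]

/-- Conjugation by a permutation fixing the last point permutes the transpositions in `lastJM`. -/
theorem gaSucc_mul_lastJM {n : ℕ} (x : GA n) :
    gaSucc n x * lastJM n = lastJM n * gaSucc n x := by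
  induction x using MonoidAlgebra.induction_linear with
  | zero => rw [map_zero, zero_mul, mul_zero]
  | add x y hx hy => rw [map_add, add_mul, mul_add, hx, hy]
  | single g r =>
    rw [gaSucc_single, lastJM, Finset.mul_sum, Finset.sum_mul]
    refine Fintype.sum_equiv g _ _ fun i => ?_
    rw [MonoidAlgebra.single_mul_single, MonoidAlgebra.single_mul_single, mul_one, one_mul,
      Equiv.mul_swap_eq_swap_mul, permSucc_castSucc, permSucc_last]

/-! ### The two monotone blocks are inverse to each other -/

/-- The generating series of the strictly monotone blocks, with signs. -/
noncomputable def strictMonoSeries (n : ℕ) : PowerSeries (GA n) :=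
  PowerSeries.mk fun b => (-1) ^ b * strictMonoBlock n b

/-- The generating series of the monotone blocks. -/
noncomputable def monoSeries (n : ℕ) : PowerSeries (GA n) :=
  PowerSeries.mk fun b => monoBlock n b

theorem strictMonoSeries_succ (n : ℕ) : strictMonoSeries (n + 1) =
    PowerSeries.map (gaSucc n : GA n →+* GA (n + 1)) (strictMonoSeries n) *
      (1 - PowerSeries.C (lastJM n) * PowerSeries.X) := by
  ext1 b
  rw [mul_sub, mul_one, map_sub, ← mul_assoc, PowerSeries.coeff_map, strictMonoSeries,
    strictMonoSeries, PowerSeries.coeff_mk, PowerSeries.coeff_mk]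
  rcases b with _ | b
  · rw [PowerSeries.coeff_zero_mul_X, sub_zero, strictMonoBlock_zero, strictMonoBlock_zero]
    simp
  · rw [PowerSeries.coeff_succ_mul_X, PowerSeries.coeff_mul_C, PowerSeries.coeff_map,
      PowerSeries.coeff_mk, strictMonoBlock_succ]
    simp only [RingHom.coe_coe, map_mul, map_pow, map_neg, map_one, pow_succ]
    noncomm_ring

theorem monoSeries_succ_mul (n : ℕ) :
    monoSeries (n + 1) * (1 - PowerSeries.C (lastJM n) * PowerSeries.X) =
      PowerSeries.map (gaSucc n : GA n →+* GA (n + 1)) (monoSeries n) := by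
  ext1 b
  rw [mul_sub, mul_one, map_sub, ← mul_assoc, PowerSeries.coeff_map, monoSeries,
    monoSeries, PowerSeries.coeff_mk, PowerSeries.coeff_mk]
  rcases b with _ | b
  · rw [PowerSeries.coeff_zero_mul_X, sub_zero, monoBlock_zero, monoBlock_zero]
    simp
  · rw [PowerSeries.coeff_succ_mul_X, PowerSeries.coeff_mul_C, PowerSeries.coeff_mk,
      monoBlock_succ, add_sub_cancel_right]
    rfl

theorem eq_zero_of_mul_one_sub_eq_zero {A : Type*} [Ring A] {f : PowerSeries A} {a : A}
    (h : f * (1 - PowerSeries.C a * PowerSeries.X) = 0) : f = 0 := by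
  rw [mul_sub, mul_one, sub_eq_zero, ← mul_assoc] at h
  ext1 b
  rw [map_zero]
  induction b with
  | zero => rw [h, PowerSeries.coeff_zero_mul_X]
  | succ b ih => rw [h, PowerSeries.coeff_succ_mul_X, PowerSeries.coeff_mul_C, ih, zero_mul]

/-- Formally ∏ (1 - J X) times its inverse. The only commutation needed is that of the newest
Jucys–Murphy element with the group algebra on one point less. -/
theorem strictMonoSeries_mul_monoSeries (n : ℕ) : strictMonoSeries n * monoSeries n = 1 := by
  induction n with
  | zero =>
    have h1 : strictMonoSeries 0 = 1 := by
      ext1 b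
      rw [strictMonoSeries, PowerSeries.coeff_mk, PowerSeries.coeff_one]
      rcases b with _ | b
      · simp [strictMonoBlock_zero]
      · simp [strictMonoBlock_zero_succ]
    have h2 : monoSeries 0 = 1 := by
      ext1 b
      rw [monoSeries, PowerSeries.coeff_mk, PowerSeries.coeff_one]
      rcases b with _ | b
      · simp [monoBlock_zero]
      · simp [monoBlock_zero_succ]
    rw [h1, h2, one_mul]
  | succ n ih =>
    have hcomm : (1 - PowerSeries.C (lastJM n) * PowerSeries.X) *
        PowerSeries.map (gaSucc n : GA n →+* GA (n + 1)) (monoSeries n) =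
        PowerSeries.map (gaSucc n : GA n →+* GA (n + 1)) (monoSeries n) *
          (1 - PowerSeries.C (lastJM n) * PowerSeries.X) := by
      rw [sub_mul, mul_sub, one_mul, mul_one, mul_assoc, ← (PowerSeries.commute_X _).eq,
        ← mul_assoc, ← mul_assoc]
      congr 2
      ext1 b
      rw [PowerSeries.coeff_C_mul, PowerSeries.coeff_mul_C, PowerSeries.coeff_map]
      exact (gaSucc_mul_lastJM _).symm
    rw [← sub_eq_zero]
    apply eq_zero_of_mul_one_sub_eq_zero (a := lastJM n)
    rw [sub_mul, one_mul, mul_assoc, monoSeries_succ_mul, strictMonoSeries_succ, mul_assoc, hcomm,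
      ← mul_assoc, ← map_mul, ih, map_one, one_mul, sub_self]

theorem sum_strictMonoBlock_mul_monoBlock (n b : ℕ) :
    ∑ p ∈ Finset.HasAntidiagonal.antidiagonal b, (-1) ^ p.1 * strictMonoBlock n p.1 * monoBlock n p.2 =
      if b = 0 then 1 else 0 := by
  have h := congrArg (PowerSeries.coeff b) (strictMonoSeries_mul_monoSeries n)
  rw [PowerSeries.coeff_mul, PowerSeries.coeff_one] at h
  rw [← h]
  refine Finset.sum_congr rfl fun p _ => ?_
  rw [strictMonoSeries, monoSeries, PowerSeries.coeff_mk, PowerSeries.coeff_mk]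

/-! ### The free group block -/

theorem len_le {n : ℕ} (α : n.Partition) : len α ≤ n := by
  have h := Multiset.card_nsmul_le_sum (s := α.parts) (a := 1) fun x hx => α.parts_pos hx
  rwa [α.parts_sum, smul_eq_mul, mul_one] at h

/-- The sum of the products of `k` nontrivial classes of total codimension `b`. -/
noncomputable def classTupleSum (n k b : ℕ) : GA n :=
  ∑ α : Fin k → n.Partition with
    (∀ i, len (α i) ≠ n) ∧ (∑ i, len (α i)) + b = k * n,
    (List.ofFn fun i => classSum (α i)).prod

theorem classTupleSum_zero (n b : ℕ) : classTupleSum n 0 b = if b = 0 then 1 else 0 := by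
  rw [classTupleSum, Finset.sum_filter, Fintype.sum_unique]
  simp

/-- Split off the first class by its codimension, which is nonzero because the class is nontrivial;
the classes of a given codimension add up to `freeSingleBlock`. -/
theorem classTupleSum_succ (n k b : ℕ) : classTupleSum n (k + 1) b =
    ∑ p ∈ Finset.HasAntidiagonal.antidiagonal b,
      if p.1 = 0 then 0 else freeSingleBlock n p.1 * classTupleSum n k p.2 := by
  have h1 : ∀ p : ℕ × ℕ, (if p.1 = 0 then 0 else freeSingleBlock n p.1 * classTupleSum n k p.2) =
      ∑ α : n.Partition, ∑ β : Fin k → n.Partition,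
        if p.1 ≠ 0 ∧ len α + p.1 = n ∧ (∀ i, len (β i) ≠ n) ∧ (∑ i, len (β i)) + p.2 = k * n then
          classSum α * (List.ofFn fun i => classSum (β i)).prod else 0 := by
    intro p
    split_ifs with hp
    · simp [hp]
    · rw [freeSingleBlock, classTupleSum, Finset.sum_filter, Finset.sum_filter,
        Finset.sum_mul_sum]
      refine Finset.sum_congr rfl fun α _ => Finset.sum_congr rfl fun β _ => ?_
      rw [ite_zero_mul_ite_zero]
      congr 1
      simp [hp]
  rw [Finset.sum_congr rfl fun p _ => h1 p, Finset.sum_comm, classTupleSum, Finset.sum_filter,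
    ← (Fin.consEquiv fun _ => n.Partition).sum_comp, Fintype.sum_prod_type]
  refine Finset.sum_congr rfl fun α _ => ?_
  rw [Finset.sum_comm]
  refine Finset.sum_congr rfl fun β _ => ?_
  have hle : ∑ i, len (β i) ≤ k * n := by
    have := Finset.sum_le_sum fun i (_ : i ∈ (Finset.univ : Finset (Fin k))) => len_le (β i)
    simpa using this
  have hα := len_le α
  simp only [Fin.consEquiv_apply, Fin.forall_fin_succ, Fin.cons_zero, Fin.cons_succ,
    Fin.sum_univ_succ, List.ofFn_succ, List.prod_cons]
  split_ifs with h
  -- The first class determines its codimension, so just one antidiagonal index contributes.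
  · rw [Finset.sum_eq_single (n - len α, b - (n - len α))]
    · rw [if_pos]
      have := h.2
      rw [add_mul, one_mul] at this
      refine ⟨?_, ?_, h.1.2, ?_⟩
      · have := h.1.1
        dsimp only
        omega
      · dsimp only
        omega
      · dsimp only
        omega
    · intro p hp hne
      rw [if_neg]
      rintro ⟨-, h2, -⟩
      apply hne
      rw [Finset.HasAntidiagonal.mem_antidiagonal] at hp
      ext <;> dsimp only <;> omega
    · intro hn
      exfalso
      apply hn
      rw [Finset.HasAntidiagonal.mem_antidiagonal]
      have := h.2
      rw [add_mul, one_mul] at this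
      dsimp only
      omega
  · symm
    refine Finset.sum_eq_zero fun p hp => if_neg ?_
    rintro ⟨h1, h2, h3, h4⟩
    rw [Finset.HasAntidiagonal.mem_antidiagonal] at hp
    refine h ⟨⟨?_, h3⟩, ?_⟩
    · omega
    · rw [add_mul, one_mul]
      omega

/-- Every nontrivial class has codimension at least 1, so the sum over k may be cut off anywhere
from b on. -/
theorem classTupleSum_eq_zero {n k b : ℕ} (h : b < k) : classTupleSum n k b = 0 := by
  induction k generalizing b with
  | zero => omega
  | succ k ih =>
    rw [classTupleSum_succ]
    refine Finset.sum_eq_zero fun p hp => ?_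
    rw [Finset.HasAntidiagonal.mem_antidiagonal] at hp
    split_ifs with hp0
    · rfl
    · rw [ih (by omega), mul_zero]

theorem freeGroupBlock_eq_sum {n b m : ℕ} (h : b ≤ m) : freeGroupBlock n b =
    ∑ k ∈ Finset.range (m + 1), (-1) ^ (k + b) * classTupleSum n k b := by
  refine Finset.sum_subset (Finset.range_mono (by omega)) fun k _ hk => ?_
  rw [Finset.mem_range] at hk
  exact mul_eq_zero_of_right _ (classTupleSum_eq_zero (by omega))

theorem freeGroupBlock_zero (n : ℕ) : freeGroupBlock n 0 = 1 := by
  rw [freeGroupBlock_eq_sum le_rfl]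
  simp [classTupleSum_zero]

/-- This is the recursion for the inverse of ∑ (-1)^b B^|_b x^b, whose geometric expansion is the
sum over k. -/
theorem freeGroupBlock_succ (n b : ℕ) : freeGroupBlock n (b + 1) =
    ∑ p ∈ Finset.HasAntidiagonal.antidiagonal (b + 1),
      if p.1 = 0 then 0
      else -((-1) ^ p.1 * freeSingleBlock n p.1 * freeGroupBlock n p.2) := by
  rw [freeGroupBlock_eq_sum le_rfl, Finset.sum_range_succ', classTupleSum_zero,
    if_neg (Nat.succ_ne_zero b), mul_zero, add_zero]
  simp_rw [classTupleSum_succ, Finset.mul_sum]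
  rw [Finset.sum_comm]
  refine Finset.sum_congr rfl fun p hp => ?_
  rw [Finset.HasAntidiagonal.mem_antidiagonal] at hp
  split_ifs with hp0
  · simp
  · rw [freeGroupBlock_eq_sum (m := b) (by omega), Finset.mul_sum, ← Finset.sum_neg_distrib]
    refine Finset.sum_congr rfl fun k _ => ?_
    have h1 : (-1 : GA n) ^ (k + 1 + (b + 1)) = -((-1) ^ p.1 * (-1) ^ (k + p.2)) := by
      rw [← hp, ← pow_add, show k + 1 + (p.1 + p.2) = p.1 + (k + p.2) + 1 by ring, pow_succ,
        mul_neg_one]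
    have h2 : Commute (freeSingleBlock n p.1) ((-1) ^ (k + p.2)) :=
      (Commute.neg_one_right _).pow_right _
    rw [h1, neg_mul, mul_assoc, mul_assoc, ← mul_assoc (freeSingleBlock n p.1), h2.eq,
      mul_assoc ((-1 : GA n) ^ (k + p.2))]

/-- Both families are inverse to the same series, since B^< and B^| agree. -/
theorem monoBlock_eq_freeGroupBlock (n b : ℕ) : monoBlock n b = freeGroupBlock n b := by
  induction b using Nat.strong_induction_on with
  | _ b ih =>
    rcases b with _ | b
    · rw [monoBlock_zero, freeGroupBlock_zero]
    · have h := sum_strictMonoBlock_mul_monoBlock n (b + 1)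
      rw [if_neg (Nat.succ_ne_zero b)] at h
      rw [freeGroupBlock_succ]
      have hmem : (0, b + 1) ∈ Finset.HasAntidiagonal.antidiagonal (b + 1) :=
        Finset.HasAntidiagonal.mem_antidiagonal.mpr (zero_add (b + 1))
      rw [← Finset.add_sum_erase _ _ hmem,
        pow_zero, one_mul, strictMonoBlock_zero, one_mul] at h
      rw [← Finset.add_sum_erase _ _ hmem, if_pos rfl,
        zero_add, eq_neg_of_add_eq_zero_left h, ← Finset.sum_neg_distrib]
      refine Finset.sum_congr rfl fun p hp => ?_
      rw [Finset.mem_erase, Finset.HasAntidiagonal.mem_antidiagonal] at hp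
      have hp0 : p.1 ≠ 0 := by
        intro h0
        apply hp.1
        ext
        · exact h0
        · dsimp only
          omega
      rw [if_neg hp0, ih p.2 (by omega), strictMonoBlock_eq_freeSingleBlock]

/-! ### Centrality -/

theorem partition_parts_conj {n : ℕ} (g h : Equiv.Perm (Fin n)) :
    (h * g * h⁻¹).partition.parts = g.partition.parts := by
  have h1 : IsConj g (h * g * h⁻¹) := isConj_iff.mpr ⟨h, rfl⟩
  rw [Equiv.Perm.partition_eq_of_isConj.mp h1]

theorem classSum_mem_center {n : ℕ} (α : n.Partition) :
    classSum α ∈ Subalgebra.center ℚ (GA n) := by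
  rw [Subalgebra.mem_center_iff]
  intro x
  induction x using MonoidAlgebra.induction_linear with
  | zero => rw [zero_mul, mul_zero]
  | add x y hx hy => rw [add_mul, mul_add, hx, hy]
  | single h r =>
    rw [classSum, Finset.mul_sum, Finset.sum_mul, Finset.sum_filter, Finset.sum_filter]
    refine Fintype.sum_equiv (MulAut.conj h).toEquiv _ _ fun g => ?_
    have h1 : (MulAut.conj h).toEquiv g = h * g * h⁻¹ := rfl
    rw [h1, partition_parts_conj, MonoidAlgebra.single_mul_single, MonoidAlgebra.single_mul_single,
      inv_mul_cancel_right, mul_one, one_mul]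

theorem freeSingleBlock_mem_center (n b : ℕ) :
    freeSingleBlock n b ∈ Subalgebra.center ℚ (GA n) :=
  Subalgebra.sum_mem _ fun α _ => classSum_mem_center α

theorem freeGroupBlock_mem_center (n b : ℕ) :
    freeGroupBlock n b ∈ Subalgebra.center ℚ (GA n) := by
  refine Subalgebra.sum_mem _ fun k _ => Subalgebra.mul_mem _
    (Subalgebra.pow_mem _ (Subalgebra.neg_mem _ (Subalgebra.one_mem _)) _)
    (Subalgebra.sum_mem _ fun α _ => Subalgebra.list_prod_mem _ fun x hx => ?_)
  obtain ⟨i, rfl⟩ := (List.mem_ofFn' _ _).mp hx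
  exact classSum_mem_center _

theorem strictMonoBlock_mem_center (n b : ℕ) :
    strictMonoBlock n b ∈ Subalgebra.center ℚ (GA n) := by
  rw [strictMonoBlock_eq_freeSingleBlock]
  exact freeSingleBlock_mem_center n b

theorem monoBlock_mem_center (n b : ℕ) : monoBlock n b ∈ Subalgebra.center ℚ (GA n) := by
  rw [monoBlock_eq_freeGroupBlock]
  exact freeGroupBlock_mem_center n b

/-! ### The linear functionals of the class functions `jtChar` -/

section JtFun

variable (K : Type*) [Field K]

/-- The words of a given content. -/
abbrev WordsOf {N : ℕ} (n : ℕ) (α : Fin N → ℤ) : Type :=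
  {w : Fin n → Fin N // ∀ a, ((Finset.univ.filter fun i => w i = a).card : ℤ) = α a}

/-- The permutation matrices of the action on words of a given content. -/
noncomputable def wordMatrix {N n : ℕ} (α : Fin N → ℤ) :
    Equiv.Perm (Fin n) →* Matrix (WordsOf n α) (WordsOf n α) K where
  toFun g := Matrix.of fun w w' => if w.1 ∘ g = w'.1 then 1 else 0
  map_one' := by
    ext w w'
    rw [Matrix.of_apply, Matrix.one_apply]
    exact if_congr Subtype.ext_iff.symm rfl rfl
  map_mul' g h := by
    have hcard : ∀ (w : Fin n → Fin N) (a : Fin N),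
        (Finset.univ.filter fun i => (w ∘ g) i = a).card =
          (Finset.univ.filter fun i => w i = a).card := by
      intro w a
      rw [Finset.card_filter, Finset.card_filter]
      exact Equiv.sum_comp g fun i => if w i = a then 1 else 0
    ext w w'
    rw [Matrix.mul_apply, Finset.sum_eq_single ⟨w.1 ∘ g, fun a => by rw [hcard, w.2 a]⟩]
    · simp only [Matrix.of_apply, if_true, one_mul]
      rfl
    · intro v _ hv
      rw [Matrix.of_apply, if_neg, zero_mul]
      intro h
      exact hv (Subtype.ext h.symm)
    · intro h
      exact absurd (Finset.mem_univ _) h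

/-- The representation of the group algebra on words of a given content. -/
noncomputable def wordRep {N n : ℕ} (α : Fin N → ℤ) :
    MonoidAlgebra K (Equiv.Perm (Fin n)) →ₐ[K] Matrix (WordsOf n α) (WordsOf n α) K :=
  MonoidAlgebra.lift K _ _ (wordMatrix K α)

theorem trace_wordRep_single {N n : ℕ} (α : Fin N → ℤ) (g : Equiv.Perm (Fin n)) (r : K) :
    (wordRep K α (MonoidAlgebra.single g r)).trace = r * wordCount α g := by
  rw [wordRep, MonoidAlgebra.lift_single, Matrix.trace_smul, smul_eq_mul]
  congr 1
  rw [Matrix.trace, wordCount]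
  simp only [Matrix.diag_apply, wordMatrix, MonoidHom.coe_mk, OneHom.coe_mk, Matrix.of_apply]
  rw [Finset.sum_boole, ← Finset.card_map (Function.Embedding.subtype _)]
  congr 2
  ext w
  simp only [Finset.mem_map, Finset.mem_filter, Finset.mem_univ, true_and,
    Function.Embedding.subtype_apply, Subtype.exists, exists_and_left, exists_prop]
  constructor
  · rintro ⟨v, h1, h2, rfl⟩
    exact ⟨h1, h2⟩
  · rintro ⟨h1, h2⟩
    exact ⟨w, h1, h2, rfl⟩

/-- The linear extension of `jtChar` to the group algebra. -/
noncomputable def jtFun {N n : ℕ} (a : Fin N → ℤ) :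
    MonoidAlgebra K (Equiv.Perm (Fin n)) →ₗ[K] K :=
  ∑ σ : Equiv.Perm (Fin N), (((Equiv.Perm.sign σ : ℤ)) : K) •
    (Matrix.traceLinearMap _ K K ∘ₗ
      (wordRep K fun i => a i + (((σ i : Fin N) : ℕ) : ℤ)).toLinearMap)

theorem jtFun_apply {N n : ℕ} (a : Fin N → ℤ) (x : MonoidAlgebra K (Equiv.Perm (Fin n))) :
    jtFun K a x = ∑ σ : Equiv.Perm (Fin N), (((Equiv.Perm.sign σ : ℤ)) : K) *
      (wordRep K (fun i => a i + (((σ i : Fin N) : ℕ) : ℤ)) x).trace := by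
  rw [jtFun, LinearMap.sum_apply]
  rfl

theorem jtFun_single {N n : ℕ} (a : Fin N → ℤ) (g : Equiv.Perm (Fin n)) (r : K) :
    jtFun K a (MonoidAlgebra.single g r) = r * jtChar a g := by
  rw [jtFun_apply, jtChar]
  push_cast
  rw [Finset.mul_sum]
  refine Finset.sum_congr rfl fun σ _ => ?_
  rw [trace_wordRep_single]
  ring

theorem jtFun_mul_comm {N n : ℕ} (a : Fin N → ℤ) (x y : MonoidAlgebra K (Equiv.Perm (Fin n))) :
    jtFun K a (x * y) = jtFun K a (y * x) := by
  rw [jtFun_apply, jtFun_apply]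
  refine Finset.sum_congr rfl fun σ _ => ?_
  rw [map_mul, map_mul, Matrix.trace_mul_comm]

theorem exists_int_jtFun [CharZero K] {N n : ℕ} (a : Fin N → ℤ)
    {e : MonoidAlgebra K (Equiv.Perm (Fin n))} (he : IsIdempotentElem e) :
    ∃ m : ℤ, jtFun K a e = m := by
  rw [jtFun_apply]
  choose m hm using fun σ : Equiv.Perm (Fin N) => exists_int_trace_of_isIdempotentElem
    (he.map (wordRep K fun i => a i + (((σ i : Fin N) : ℕ) : ℤ)))
  exact ⟨∑ σ : Equiv.Perm (Fin N), (Equiv.Perm.sign σ : ℤ) * m σ, by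
    push_cast
    simp_rw [hm]⟩

theorem wordCount_inv {N n : ℕ} (α : Fin N → ℤ) (g : Equiv.Perm (Fin n)) :
    wordCount α g⁻¹ = wordCount α g := by
  rw [wordCount, wordCount]
  congr 1
  refine Finset.filter_congr fun w _ => and_congr_left fun _ => ?_
  constructor
  · intro h
    conv_lhs => rw [← h]
    ext i
    simp
  · intro h
    conv_lhs => rw [← h]
    ext i
    simp

theorem jtChar_inv {N n : ℕ} (a : Fin N → ℤ) (g : Equiv.Perm (Fin n)) :
    jtChar a g⁻¹ = jtChar a g := by
  simp_rw [jtChar, wordCount_inv]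

theorem jtFun_map_algebraMap [Algebra ℚ K] {N n : ℕ} (a : Fin N → ℤ) (x : GA n) :
    jtFun K a (MonoidAlgebra.mapRingHom _ (algebraMap ℚ K) x) = algebraMap ℚ K (jtFun ℚ a x) := by
  induction x using MonoidAlgebra.induction_linear with
  | zero => simp
  | add x y hx hy => rw [map_add, map_add, map_add, map_add, hx, hy]
  | single g r =>
    rw [MonoidAlgebra.mapRingHom_single, jtFun_single, jtFun_single, map_mul, map_intCast]

end JtFun

/-- Wedderburn is applied over ℂ, where the group algebra splits. Orthonormality supplies the norm
n!, and the conclusion descends because `jtFun` is compatible with extension of scalars. -/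
theorem jtFun_center {N n : ℕ} {a : Fin N → ℤ} (ha : IsShifted a)
    (hn : ∑ i, (a i + ((i : ℕ) : ℤ)) = n) :
    jtFun ℚ a (1 : GA n) ≠ 0 ∧ ∀ z ∈ Subalgebra.center ℚ (GA n), ∀ x,
      jtFun ℚ a (z * x) * jtFun ℚ a (1 : GA n) = jtFun ℚ a z * jtFun ℚ a x := by
  have hinj : Function.Injective (algebraMap ℚ ℂ) := (algebraMap ℚ ℂ).injective
  obtain ⟨h1, h2⟩ := trace_function_mul_of_norm_one (jtFun ℂ a (n := n)) (jtFun_mul_comm ℂ a)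
    (fun e he => exists_int_jtFun ℂ a he) (by
      have h := sum_jtChar_mul_jtChar ha ha hn
      rw [if_pos rfl] at h
      rw [Fintype.card_perm, Fintype.card_fin]
      simp_rw [jtFun_single, jtChar_inv, one_mul]
      exact_mod_cast h)
  have hmap := jtFun_map_algebraMap ℂ (n := n) a
  constructor
  · intro h0
    apply h1
    rw [← map_one (MonoidAlgebra.mapRingHom (Equiv.Perm (Fin n)) (algebraMap ℚ ℂ)), hmap, h0,
      map_zero]
  · intro z hz x
    apply hinj
    rw [RingHom.map_mul, RingHom.map_mul, ← hmap, ← hmap, ← hmap, ← hmap, RingHom.map_mul,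
      RingHom.map_one]
    refine h2 _ _ fun y => ?_
    -- The group elements span over ℂ too, so z remains central after extension of scalars.
    induction y using MonoidAlgebra.induction_linear with
    | zero => rw [mul_zero, zero_mul]
    | add x y hx hy => rw [mul_add, add_mul, hx, hy]
    | single g r =>
      have h3 : (MonoidAlgebra.single g r : MonoidAlgebra ℂ (Equiv.Perm (Fin n))) =
          r • MonoidAlgebra.mapRingHom _ (algebraMap ℚ ℂ) (MonoidAlgebra.single g 1) := by
        simp
      rw [h3, mul_smul_comm, smul_mul_assoc, ← map_mul, ← map_mul,
        Subalgebra.mem_center_iff.mp hz]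

/-! ### Restriction -/

theorem jtFun_gaSucc {N n : ℕ} (a : Fin N → ℤ) (x : GA n) :
    jtFun ℚ a (gaSucc n x) = ∑ b, jtFun ℚ (a - Pi.single b 1) x := by
  induction x using MonoidAlgebra.induction_linear with
  | zero => simp
  | add x y hx hy => simp_rw [map_add, hx, hy, Finset.sum_add_distrib]
  | single g r =>
    rw [gaSucc_single]
    simp_rw [jtFun_single, jtChar_permSucc]
    push_cast
    rw [Finset.mul_sum]

theorem jtFun_gaSucc_mul_lastJM {N n : ℕ} (a : Fin N → ℤ) (x : GA n) :
    jtFun ℚ a (gaSucc n x * lastJM n) = ∑ b, ((a b : ℚ) - 1) * jtFun ℚ (a - Pi.single b 1) x := by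
  induction x using MonoidAlgebra.induction_linear with
  | zero => simp
  | add x y hx hy => simp_rw [map_add, add_mul, map_add, hx, hy, mul_add, Finset.sum_add_distrib]
  | single g r =>
    rw [gaSucc_single, lastJM, Finset.mul_sum, map_sum]
    simp_rw [MonoidAlgebra.single_mul_single, jtFun_single]
    have h := congrArg (Int.cast : ℤ → ℚ) (sum_jtChar_mul_swap a g)
    push_cast at h
    rw [← Finset.mul_sum, mul_one, h, Finset.mul_sum]
    exact Finset.sum_congr rfl fun b _ => by ring

/-! ### Contents -/

/-- The contents of the boxes of the diagram with rows of length `a i + i`. -/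
def contents {N : ℕ} (a : Fin N → ℤ) : Multiset ℚ :=
  ∑ i, (Multiset.range (a i + ((i : ℕ) : ℤ)).toNat).map fun j : ℕ => (j : ℚ) - ((i : ℕ) : ℚ)

theorem contents_sub_single {N : ℕ} {a : Fin N → ℤ} {b : Fin N}
    (h : IsShifted (a - Pi.single b 1)) :
    contents a = ((a b : ℚ) - 1) ::ₘ contents (a - Pi.single b 1) := by
  have hb : (a - Pi.single b 1 : Fin N → ℤ) b = a b - 1 := by simp
  have h1 : ∀ i ≠ b, (a - Pi.single b 1 : Fin N → ℤ) i = a i := fun i hi => by simp [hi]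
  have h2 := h.nonneg b
  rw [hb] at h2
  rw [contents, contents, ← Finset.add_sum_erase _ _ (Finset.mem_univ b),
    ← Finset.add_sum_erase _ _ (Finset.mem_univ b), ← Multiset.cons_add]
  congr 1
  · obtain ⟨m, hm⟩ := Int.eq_ofNat_of_zero_le h2
    rw [hb, hm, show a b + ((b : ℕ) : ℤ) = ((m + 1 : ℕ) : ℤ) by push_cast; omega,
      Int.toNat_natCast, Int.toNat_natCast, Multiset.range_succ, Multiset.map_cons]
    congr 1
    have h3 : (a b : ℚ) - 1 + ((b : ℕ) : ℚ) = m := by exact_mod_cast hm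
    linarith
  · refine Finset.sum_congr rfl fun i hi => ?_
    rw [h1 i (Finset.mem_erase.mp hi).1]

/-- The polynomial `∏ (1 + c X)` over a multiset of values. -/
noncomputable def linearProd (s : Multiset ℚ) : PowerSeries ℚ :=
  (s.map fun c => 1 + PowerSeries.C c * PowerSeries.X).prod

theorem constantCoeff_linearProd (s : Multiset ℚ) :
    PowerSeries.constantCoeff (linearProd s) = 1 := by
  rw [linearProd, map_multiset_prod, Multiset.map_map]
  simp

theorem coeff_linearProd_cons (s : Multiset ℚ) (c : ℚ) (b : ℕ) :
    PowerSeries.coeff (b + 1) (linearProd (c ::ₘ s)) =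
      PowerSeries.coeff (b + 1) (linearProd s) + c * PowerSeries.coeff b (linearProd s) := by
  rw [linearProd, Multiset.map_cons, Multiset.prod_cons, ← linearProd, add_mul, one_mul, mul_assoc,
    map_add, PowerSeries.coeff_C_mul, PowerSeries.coeff_succ_X_mul]

theorem rescale_linearProd (s : Multiset ℚ) :
    PowerSeries.rescale (-1) (linearProd s) =
      (s.map fun c => 1 - PowerSeries.C c * PowerSeries.X).prod := by
  rw [linearProd, map_multiset_prod, Multiset.map_map]
  congr 1
  refine Multiset.map_congr rfl fun c _ => ?_
  ext b
  rw [Function.comp_apply, PowerSeries.coeff_rescale, map_add, map_sub, PowerSeries.coeff_C_mul,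
    PowerSeries.coeff_X, PowerSeries.coeff_one]
  rcases b with _ | _ | b <;> simp

theorem sum_sub_single {N n : ℕ} {a : Fin N → ℤ} (hn : ∑ i, (a i + ((i : ℕ) : ℤ)) = (n + 1 : ℕ))
    (b : Fin N) : ∑ i, ((a - Pi.single b 1 : Fin N → ℤ) i + ((i : ℕ) : ℤ)) = n := by
  have h : ∀ i, (a - Pi.single b 1 : Fin N → ℤ) i + ((i : ℕ) : ℤ) =
      (a i + ((i : ℕ) : ℤ)) - (Pi.single b 1 : Fin N → ℤ) i := fun i => by
    rw [Pi.sub_apply]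
    ring
  simp_rw [h]
  rw [Finset.sum_sub_distrib, hn, Finset.sum_pi_single', if_pos (Finset.mem_univ b)]
  push_cast
  ring

/-- Branching turns the recursion of the block in n into the recursion of the elementary symmetric
polynomials when one more content is adjoined. -/
theorem jtFun_strictMonoBlock {N n : ℕ} {a : Fin N → ℤ} (ha : IsShifted a)
    (hn : ∑ i, (a i + ((i : ℕ) : ℤ)) = n) (b : ℕ) :
    jtFun ℚ a (strictMonoBlock n b) =
      jtFun ℚ a (1 : GA n) * PowerSeries.coeff b (linearProd (contents a)) := by
  induction n generalizing a b with
  | zero =>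
    have h1 : contents a = 0 := by
      have h2 := (Finset.sum_eq_zero_iff_of_nonneg fun i _ => ha.nonneg i).mp hn
      refine Finset.sum_eq_zero fun i hi => ?_
      rw [h2 i hi]
      rfl
    rw [h1]
    rcases b with _ | b
    · simp [strictMonoBlock_zero, linearProd]
    · simp [strictMonoBlock_zero_succ, linearProd, PowerSeries.coeff_one]
  | succ n ih =>
    rcases b with _ | b
    · rw [strictMonoBlock_zero, PowerSeries.coeff_zero_eq_constantCoeff_apply,
        constantCoeff_linearProd, mul_one]
    -- The unit is written as an image under `gaSucc`, so that its value branches over the same rows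
    -- and the two sides can be compared row by row.
    · rw [strictMonoBlock_succ, map_add, jtFun_gaSucc, jtFun_gaSucc_mul_lastJM,
        ← Finset.sum_add_distrib, ← map_one (gaSucc n), jtFun_gaSucc, Finset.sum_mul]
      refine Finset.sum_congr rfl fun c _ => ?_
      rcases isShifted_sub_single_or (n := n) ha c with h | h
      · rw [ih h (sum_sub_single hn c), ih h (sum_sub_single hn c), contents_sub_single h,
          coeff_linearProd_cons]
        ring
      · have h0 : ∀ x : GA n, jtFun ℚ (a - Pi.single c 1) x = 0 := by
          intro x
          induction x using MonoidAlgebra.induction_linear with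
          | zero => simp
          | add x y hx hy => rw [map_add, hx, hy, add_zero]
          | single g r => rw [jtFun_single, h, Int.cast_zero, mul_zero]
        simp [h0]

/-! ### Central characters -/

/-- The scalar by which a central element acts. -/
noncomputable def centralChar {N n : ℕ} (a : Fin N → ℤ) (z : GA n) : ℚ :=
  jtFun ℚ a z / jtFun ℚ a (1 : GA n)

theorem jtFun_mul_of_mem_center {N n : ℕ} {a : Fin N → ℤ} (ha : IsShifted a)
    (hn : ∑ i, (a i + ((i : ℕ) : ℤ)) = n)
    {z : GA n} (hz : z ∈ Subalgebra.center ℚ (GA n)) (x : GA n) :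
    jtFun ℚ a (z * x) = centralChar a z * jtFun ℚ a x := by
  obtain ⟨h1, h2⟩ := jtFun_center ha hn
  rw [centralChar, div_mul_eq_mul_div, eq_div_iff h1, h2 z hz]

theorem centralChar_one {N n : ℕ} {a : Fin N → ℤ} (ha : IsShifted a)
    (hn : ∑ i, (a i + ((i : ℕ) : ℤ)) = n) :
    centralChar a (1 : GA n) = 1 :=
  div_self (jtFun_center ha hn).1

theorem centralChar_mul {N n : ℕ} {a : Fin N → ℤ} (ha : IsShifted a)
    (hn : ∑ i, (a i + ((i : ℕ) : ℤ)) = n)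
    {z : GA n} (hz : z ∈ Subalgebra.center ℚ (GA n)) (x : GA n) :
    centralChar a (z * x) = centralChar a z * centralChar a x := by
  rw [centralChar, jtFun_mul_of_mem_center ha hn hz, mul_div_assoc, ← centralChar]

theorem centralChar_list_prod {N n : ℕ} {a : Fin N → ℤ} (ha : IsShifted a)
    (hn : ∑ i, (a i + ((i : ℕ) : ℤ)) = n)
    (l : List (GA n)) (hl : ∀ z ∈ l, z ∈ Subalgebra.center ℚ (GA n)) :
    centralChar a l.prod = (l.map (centralChar a)).prod := by
  induction l with
  | nil => exact centralChar_one ha hn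
  | cons z l ih =>
    rw [List.prod_cons, List.map_cons, List.prod_cons,
      centralChar_mul ha hn (hl z List.mem_cons_self), ih fun y hy => hl y (List.mem_cons_of_mem _ hy)]

theorem centralChar_strictMonoBlock {N n : ℕ} {a : Fin N → ℤ} (ha : IsShifted a)
    (hn : ∑ i, (a i + ((i : ℕ) : ℤ)) = n)
    (b : ℕ) :
    centralChar a (strictMonoBlock n b) = PowerSeries.coeff b (linearProd (contents a)) := by
  rw [centralChar, jtFun_strictMonoBlock ha hn, mul_div_cancel_left₀ _ (jtFun_center ha hn).1]

/-- The recursion of the monotone blocks refers back to n + 1 points and does not fit branching.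
Instead the central character is applied to the inverse relation with the strictly monotone blocks.
-/
theorem centralChar_monoBlock {N n : ℕ} {a : Fin N → ℤ} (ha : IsShifted a)
    (hn : ∑ i, (a i + ((i : ℕ) : ℤ)) = n)
    (b : ℕ) : centralChar a (monoBlock n b) =
    PowerSeries.coeff b
      ((contents a).map fun c => 1 - PowerSeries.C c * PowerSeries.X).prod⁻¹ := by
  rw [← rescale_linearProd]
  have h0 : PowerSeries.constantCoeff (PowerSeries.rescale (-1) (linearProd (contents a))) = 1 := by
    rw [← PowerSeries.coeff_zero_eq_constantCoeff_apply, PowerSeries.coeff_rescale, pow_zero,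
      one_mul, PowerSeries.coeff_zero_eq_constantCoeff_apply, constantCoeff_linearProd]
  have h1 : PowerSeries.mk (fun b => centralChar a (monoBlock n b)) *
      PowerSeries.rescale (-1) (linearProd (contents a)) = 1 := by
    rw [mul_comm]
    ext m
    rw [PowerSeries.coeff_mul, PowerSeries.coeff_one]
    have h2 := congrArg (centralChar a) (sum_strictMonoBlock_mul_monoBlock n m)
    rw [apply_ite (centralChar a), centralChar_one ha hn] at h2
    have h3 : centralChar a (0 : GA n) = 0 := by rw [centralChar, map_zero, zero_div]
    rw [h3] at h2
    rw [← h2, centralChar, map_sum, Finset.sum_div]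
    refine Finset.sum_congr rfl fun p _ => ?_
    rw [← centralChar, mul_assoc, PowerSeries.coeff_rescale, PowerSeries.coeff_mk,
      ← centralChar_strictMonoBlock ha hn]
    have h4 : (-1 : GA n) ^ p.1 * (strictMonoBlock n p.1 * monoBlock n p.2) =
        ((-1 : ℚ) ^ p.1) • (strictMonoBlock n p.1 * monoBlock n p.2) := by
      rw [Algebra.smul_def, map_pow, map_neg, map_one]
    have h5 : ∀ (r : ℚ) (x : GA n), centralChar a (r • x) = r * centralChar a x := fun r x => by
      rw [centralChar, map_smul, smul_eq_mul, mul_div_assoc, ← centralChar]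
    rw [h4, h5, centralChar_mul ha hn (strictMonoBlock_mem_center n p.1), mul_assoc]
  rw [← (PowerSeries.eq_inv_iff_mul_eq_one (by rw [h0]; exact one_ne_zero)).mpr h1,
    PowerSeries.coeff_mk]

/-! ### The shifted row lengths of a partition -/

theorem rowLens_diagram {n : ℕ} (lam : n.Partition) :
    (diagram lam).rowLens = lam.parts.sort (· ≥ ·) :=
  YoungDiagram.rowLens_ofRowLens_eq_self fun _ hx => lam.parts_pos ((Multiset.mem_sort _).mp hx)

theorem colLen_diagram {n : ℕ} (lam : n.Partition) : (diagram lam).colLen 0 = len lam := by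
  rw [← YoungDiagram.length_rowLens, rowLens_diagram, Multiset.length_sort, len]

theorem rowLen_eq_zero {Y : YoungDiagram} {i : ℕ} (h : Y.colLen 0 ≤ i) : Y.rowLen i = 0 := by
  by_contra h0
  have h1 : (i, 0) ∈ Y := YoungDiagram.mem_iff_lt_rowLen.mpr (Nat.pos_of_ne_zero h0)
  exact absurd (YoungDiagram.mem_iff_lt_colLen.mp h1) (not_lt.mpr h)

theorem diagram_injective {n : ℕ} : Function.Injective (diagram : n.Partition → YoungDiagram) := by
  intro lam mu h
  have h1 := congrArg YoungDiagram.rowLens h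
  rw [rowLens_diagram, rowLens_diagram] at h1
  have h2 := congrArg (fun l : List ℕ => (l : Multiset ℕ)) h1
  rw [Multiset.sort_eq, Multiset.sort_eq] at h2
  exact Nat.Partition.ext h2

/-- The shifted row lengths `λᵢ - i` for `i < n`. -/
def shiftedRows {n : ℕ} (lam : n.Partition) (i : Fin n) : ℤ :=
  ((diagram lam).rowLen i : ℤ) - ((i : ℕ) : ℤ)

theorem isShifted_shiftedRows {n : ℕ} (lam : n.Partition) : IsShifted (shiftedRows lam) where
  strictAnti i j hij := by
    have h1 := (diagram lam).rowLen_anti i j (le_of_lt hij)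
    have h2 : (i : ℕ) < j := hij
    rw [shiftedRows, shiftedRows]
    omega
  nonneg i := by
    rw [shiftedRows]
    omega

theorem sum_shiftedRows {n : ℕ} (lam : n.Partition) :
    ∑ i, (shiftedRows lam i + ((i : ℕ) : ℤ)) = n := by
  simp_rw [shiftedRows, sub_add_cancel]
  rw [Fin.sum_univ_eq_sum_range fun i => ((diagram lam).rowLen i : ℤ), ← Nat.cast_sum]
  congr 1
  have h1 : (diagram lam).rowLens.sum = n := by
    rw [rowLens_diagram, ← Multiset.sum_coe, Multiset.sort_eq, lam.parts_sum]
  have h2 : (diagram lam).rowLens.sum =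
      ∑ i ∈ Finset.range ((diagram lam).colLen 0), (diagram lam).rowLen i := rfl
  refine Eq.trans ?_ h1
  rw [h2]
  symm
  refine Finset.sum_subset (Finset.range_mono ?_) fun i _ hi => rowLen_eq_zero ?_
  · rw [colLen_diagram]
    exact len_le lam
  · simpa using hi

theorem shiftedRows_injective {n : ℕ} :
    Function.Injective (shiftedRows : n.Partition → Fin n → ℤ) := by
  intro lam mu h
  apply diagram_injective
  have h1 : ∀ i, (diagram lam).rowLen i = (diagram mu).rowLen i := by
    intro i
    by_cases hi : i < n
    · have := congrFun h ⟨i, hi⟩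
      rw [shiftedRows, shiftedRows] at this
      dsimp only at this
      omega
    · rw [rowLen_eq_zero, rowLen_eq_zero]
      · rw [colLen_diagram]
        exact (len_le mu).trans (not_lt.mp hi)
      · rw [colLen_diagram]
        exact (len_le lam).trans (not_lt.mp hi)
  ext ⟨i, j⟩
  rw [YoungDiagram.mem_cells, YoungDiagram.mem_cells, YoungDiagram.mem_iff_lt_rowLen,
    YoungDiagram.mem_iff_lt_rowLen, h1]

theorem prod_cells_diagram {A : Type*} [CommMonoid A] {n : ℕ} (lam : n.Partition) (G : ℚ → A) :
    ∏ x ∈ (diagram lam).cells, G (content x : ℚ) =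
      ((contents (shiftedRows lam)).map G).prod := by
  rw [Finset.prod_finset_product (diagram lam).cells (Finset.range n)
    (fun i => Finset.range ((diagram lam).rowLen i))]
  · rw [← Fin.prod_univ_eq_prod_range fun i =>
      ∏ j ∈ Finset.range ((diagram lam).rowLen i), G (content (i, j) : ℚ), contents,
      ← Multiset.coe_mapAddMonoidHom, map_sum, Multiset.prod_sum]
    refine Finset.prod_congr rfl fun i _ => ?_
    rw [Multiset.coe_mapAddMonoidHom, Multiset.map_map, shiftedRows, sub_add_cancel,
      Int.toNat_natCast]
    refine congrArg Multiset.prod (Multiset.map_congr rfl fun j _ => ?_)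
    rw [Function.comp_apply, content]
    push_cast
    rfl
  · rintro ⟨i, j⟩
    rw [YoungDiagram.mem_cells, YoungDiagram.mem_iff_lt_rowLen, Finset.mem_range, Finset.mem_range]
    refine ⟨fun h => ⟨?_, h⟩, fun h => h.2⟩
    by_contra hi
    rw [rowLen_eq_zero] at h
    · omega
    · rw [colLen_diagram]
      exact (len_le lam).trans (not_lt.mp hi)

/-! ### Jacobi-Trudi determinants with additional empty rows -/

/-- Empty rows make the matrix block upper triangular, and their diagonal block is unitriangular
because h_0 = 1 and h vanishes at negative indices. -/
theorem jacobiTrudi_append {A : Type*} [CommRing A] [Algebra ℚ A] {m k : ℕ} (t : ℕ+ → A)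
    (a : Fin (m + k) → ℤ) (ha : ∀ i : Fin k, a (Fin.natAdd m i) = -((m : ℤ) + ((i : ℕ) : ℤ))) :
    jacobiTrudi t a = jacobiTrudi t fun i => a (Fin.castAdd k i) := by
  rw [jacobiTrudi, ← Matrix.det_submatrix_equiv_self (finSumFinEquiv (m := m) (n := k)),
    ← Matrix.fromBlocks_toBlocks (Matrix.submatrix _ _ _)]
  have h21 : (Matrix.submatrix (Matrix.of fun i j : Fin (m + k) =>
      elemSchur t (a i + ((j : ℕ) : ℤ))) finSumFinEquiv finSumFinEquiv).toBlocks₂₁ = 0 := by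
    ext i j
    rw [Matrix.toBlocks₂₁, Matrix.of_apply, Matrix.submatrix_apply, Matrix.of_apply,
      finSumFinEquiv_apply_right, finSumFinEquiv_apply_left, ha, Fin.val_castAdd,
      elemSchur_of_neg, Matrix.zero_apply]
    omega
  have h22 : (Matrix.submatrix (Matrix.of fun i j : Fin (m + k) =>
      elemSchur t (a i + ((j : ℕ) : ℤ))) finSumFinEquiv finSumFinEquiv).toBlocks₂₂.det = 1 := by
    rw [Matrix.det_of_isUpperTriangular]
    · refine Finset.prod_eq_one fun i _ => ?_
      rw [Matrix.toBlocks₂₂, Matrix.of_apply, Matrix.submatrix_apply, Matrix.of_apply,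
        finSumFinEquiv_apply_right, ha, Fin.val_natAdd, Nat.cast_add, neg_add_cancel, elemSchur_zero]
    · intro i j hij
      rw [Matrix.toBlocks₂₂, Matrix.of_apply, Matrix.submatrix_apply, Matrix.of_apply,
        finSumFinEquiv_apply_right, finSumFinEquiv_apply_right, ha, Fin.val_natAdd,
        elemSchur_of_neg]
      have h : (j : ℕ) < i := hij
      omega
  rw [h21, Matrix.det_fromBlocks_zero₂₁, h22, mul_one]
  rfl

/-- Padding to n rows gives all partitions of n vectors of the same length, as the orthogonality
relations require. -/
theorem schur_diagram {A : Type*} [CommRing A] [Algebra ℚ A] {n : ℕ} (t : ℕ+ → A)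
    (lam : n.Partition) : schur t (diagram lam) = jacobiTrudi t (shiftedRows lam) := by
  have key : ∀ (m k : ℕ) (Y : YoungDiagram), Y.colLen 0 = m →
      jacobiTrudi t (fun i : Fin m => (Y.rowLen i : ℤ) - ((i : ℕ) : ℤ)) =
        jacobiTrudi t (fun i : Fin (m + k) => (Y.rowLen i : ℤ) - ((i : ℕ) : ℤ)) := by
    intro m k Y hY
    rw [jacobiTrudi_append]
    · rfl
    · intro i
      rw [rowLen_eq_zero]
      · rw [Fin.val_natAdd]
        push_cast
        ring
      · rw [hY, Fin.val_natAdd]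
        exact Nat.le_add_right _ _
  have hle : (diagram lam).colLen 0 ≤ n := by
    rw [colLen_diagram]
    exact len_le lam
  obtain ⟨k, hk⟩ := Nat.exists_eq_add_of_le hle
  have h1 : ∀ (N : ℕ), n = N → jacobiTrudi t (shiftedRows lam) =
      jacobiTrudi t (fun i : Fin N => ((diagram lam).rowLen i : ℤ) - ((i : ℕ) : ℤ)) := by
    rintro N rfl
    rfl
  rw [h1 _ hk, ← key _ k _ rfl]
  rfl

/-! ### Orthogonality -/

/-- The word count is a coefficient of a polynomial that depends only on the cycle type. -/
theorem wordCount_congr {N n : ℕ} (α : Fin N → ℤ) {g h : Equiv.Perm (Fin n)}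
    (hgh : g.partition.parts = h.partition.parts) : wordCount α g = wordCount α h := by
  by_cases hneg : ∃ a, α a < 0
  · obtain ⟨a, ha⟩ := hneg
    rw [wordCount_of_neg ha, wordCount_of_neg ha]
  push Not at hneg
  obtain ⟨e, rfl⟩ : ∃ e : Fin N →₀ ℕ, α = fun a => (e a : ℤ) :=
    ⟨Finsupp.equivFunOnFinite.symm fun a => (α a).toNat, by ext a; simp [hneg a]⟩
  have h1 := coeff_cycleProd_X (A := ℕ) g e
  have h2 := coeff_cycleProd_X (A := ℕ) h e
  rw [cycleProd, hgh] at h1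
  rw [cycleProd, h1] at h2
  exact h2

theorem jtChar_congr {N n : ℕ} (a : Fin N → ℤ) {g h : Equiv.Perm (Fin n)}
    (hgh : g.partition.parts = h.partition.parts) : jtChar a g = jtChar a h := by
  simp_rw [jtChar, wordCount_congr _ hgh]

/-- The number of permutations of a given cycle type. -/
def classCard {n : ℕ} (μ : n.Partition) : ℕ :=
  (Finset.univ.filter fun g : Equiv.Perm (Fin n) => g.partition.parts = μ.parts).card

theorem classCard_ne_zero {n : ℕ} (μ : n.Partition) : classCard μ ≠ 0 := fun h => by
  have h1 := card_class_mul μ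
  rw [← classCard, h, zero_mul] at h1
  exact n.factorial_ne_zero h1.symm

theorem jtFun_classSum {N n : ℕ} (a : Fin N → ℤ) {μ : n.Partition} {g : Equiv.Perm (Fin n)}
    (hg : g.partition.parts = μ.parts) :
    jtFun ℚ a (classSum μ) = classCard μ * jtChar a g := by
  rw [classSum, map_sum, classCard, ← nsmul_eq_mul, ← Finset.sum_const]
  refine Finset.sum_congr rfl fun h hh => ?_
  rw [jtFun_single, one_mul, jtChar_congr a ((Finset.mem_filter.mp hh).2.trans hg.symm)]

theorem sum_jtFun_classSum_mul {n : ℕ} (lam lam' : n.Partition) :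
    ∑ μ : n.Partition, jtFun ℚ (shiftedRows lam) (classSum μ) *
      (jtFun ℚ (shiftedRows lam') (classSum μ) / (classCard μ * n.factorial)) =
        if lam = lam' then 1 else 0 := by
  have h := sum_jtChar_mul_jtChar (isShifted_shiftedRows lam) (isShifted_shiftedRows lam')
    (sum_shiftedRows lam')
  rw [sum_perm_eq_sum_partition, if_congr shiftedRows_injective.eq_iff rfl rfl] at h
  have h0 : (n.factorial : ℚ) ≠ 0 := by exact_mod_cast n.factorial_ne_zero
  rw [← mul_right_inj' h0, mul_ite, mul_one, mul_zero, ← h, Finset.mul_sum]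
  refine Finset.sum_congr rfl fun μ _ => ?_
  have h1 : (classCard μ : ℚ) ≠ 0 := by exact_mod_cast classCard_ne_zero μ
  rw [Finset.sum_congr rfl (g := fun _ => jtFun ℚ (shiftedRows lam) (classSum μ) *
    jtFun ℚ (shiftedRows lam') (classSum μ) / (classCard μ * classCard μ))]
  · rw [Finset.sum_const, ← classCard, nsmul_eq_mul]
    field_simp
  · intro g hg
    rw [jtFun_classSum _ (Finset.mem_filter.mp hg).2, jtFun_classSum _ (Finset.mem_filter.mp hg).2]
    field_simp

/-- Rows and columns of the table are both indexed by partitions, so the one-sided inverse provided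
by row orthogonality is two-sided. -/
theorem sum_jtFun_mul_jtFun_classSum {n : ℕ} (μ ν : n.Partition) :
    ∑ lam : n.Partition, jtFun ℚ (shiftedRows lam) (classSum μ) *
      jtFun ℚ (shiftedRows lam) (classSum ν) =
        if μ = ν then (classCard μ * n.factorial : ℚ) else 0 := by
  let X : Matrix n.Partition n.Partition ℚ :=
    Matrix.of fun lam μ => jtFun ℚ (shiftedRows lam) (classSum μ)
  let Y : Matrix n.Partition n.Partition ℚ :=
    Matrix.of fun μ lam => jtFun ℚ (shiftedRows lam) (classSum μ) / (classCard μ * n.factorial)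
  have h1 : X * Y = 1 := by
    ext lam lam'
    rw [Matrix.mul_apply, Matrix.one_apply, ← sum_jtFun_classSum_mul]
    rfl
  have h2 : (Y * X) μ ν = (1 : Matrix n.Partition n.Partition ℚ) μ ν := by
    rw [mul_eq_one_comm.mp h1]
  have h0 : (n.factorial : ℚ) ≠ 0 := by exact_mod_cast n.factorial_ne_zero
  have h3 : (classCard μ : ℚ) ≠ 0 := by exact_mod_cast classCard_ne_zero μ
  rw [Matrix.mul_apply, Matrix.one_apply] at h2
  rw [← mul_right_inj' (inv_ne_zero (mul_ne_zero h3 h0)), mul_ite, inv_mul_cancel₀, mul_zero, ← h2,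
    Finset.mul_sum]
  · refine Finset.sum_congr rfl fun lam _ => ?_
    simp only [X, Y, Matrix.of_apply]
    rw [div_mul_eq_mul_div, div_eq_inv_mul]
  · exact mul_ne_zero h3 h0

theorem eq_one_of_partition_parts {n : ℕ} {g : Equiv.Perm (Fin n)}
    (h : (1 : Equiv.Perm (Fin n)).partition.parts = g.partition.parts) : g = 1 :=
  isConj_one_right.mp (Equiv.Perm.partition_eq_of_isConj.mpr (Nat.Partition.ext h))

/-- Evaluation at the identity in terms of the characters. -/
theorem sum_jtFun_one_mul {n : ℕ} (x : GA n) :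
    ∑ lam : n.Partition, jtFun ℚ (shiftedRows lam) (1 : GA n) * jtFun ℚ (shiftedRows lam) x =
      n.factorial * x.coeff 1 := by
  induction x using MonoidAlgebra.induction_linear with
  | zero => simp
  | add x y hx hy =>
    simp_rw [map_add, mul_add]
    rw [Finset.sum_add_distrib, hx, hy, MonoidAlgebra.coeff_add, Finsupp.add_apply, mul_add]
  | single g r =>
    obtain ⟨μ, hμ⟩ := exists_partition_parts_eq (1 : Equiv.Perm (Fin n))
    obtain ⟨ν, hν⟩ := exists_partition_parts_eq g
    -- Column orthogonality between the class of the identity and that of g.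
    have h := sum_jtFun_mul_jtFun_classSum μ ν
    have h1 : (classCard μ : ℚ) ≠ 0 := by exact_mod_cast classCard_ne_zero μ
    have h2 : (classCard ν : ℚ) ≠ 0 := by exact_mod_cast classCard_ne_zero ν
    simp_rw [jtFun_classSum _ hμ, jtFun_classSum _ hν] at h
    have h3 : ∀ lam : n.Partition, jtFun ℚ (shiftedRows lam) (1 : GA n) *
        jtFun ℚ (shiftedRows lam) (MonoidAlgebra.single g r) =
        r * (classCard μ * classCard ν : ℚ)⁻¹ *
          ((classCard μ * jtChar (shiftedRows lam) (1 : Equiv.Perm (Fin n))) *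
            (classCard ν * jtChar (shiftedRows lam) g)) := by
      intro lam
      rw [MonoidAlgebra.one_def, jtFun_single, jtFun_single]
      field_simp
    simp_rw [h3]
    rw [← Finset.mul_sum, h, MonoidAlgebra.coeff_single]
    by_cases hg : g = 1
    · subst hg
      have h4 : μ = ν := Nat.Partition.ext (hμ.symm.trans hν)
      subst h4
      have h5 : classCard μ = 1 := by
        rw [classCard, Finset.card_eq_one]
        refine ⟨1, ?_⟩
        ext h
        rw [Finset.mem_filter, Finset.mem_singleton, ← hμ]
        exact ⟨fun hh => eq_one_of_partition_parts hh.2.symm,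
          fun hh => ⟨Finset.mem_univ _, by rw [hh]⟩⟩
      rw [if_pos rfl, h5, Finsupp.single_eq_same]
      push_cast
      ring
    · have h4 : μ ≠ ν := fun h => hg (eq_one_of_partition_parts (by rw [hμ, hν, h]))
      rw [if_neg h4, Finsupp.single_eq_of_ne (Ne.symm hg), mul_zero, mul_zero]

/-- The Frobenius formula for double Hurwitz numbers. -/
theorem hurwitz_eq_sum {n : ℕ} (μ ν : n.Partition) (B : GA n) :
    hurwitz μ ν B = ∑ lam : n.Partition,
      ((n.factorial : ℚ)⁻¹ * jtFun ℚ (shiftedRows lam) (classSum μ)) *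
        ((n.factorial : ℚ)⁻¹ * jtFun ℚ (shiftedRows lam) (classSum ν)) *
          centralChar (shiftedRows lam) B := by
  have h0 : (n.factorial : ℚ) ≠ 0 := by exact_mod_cast n.factorial_ne_zero
  rw [hurwitz, ← mul_right_inj' (mul_ne_zero h0 h0), mul_assoc, mul_inv_cancel_left₀ h0,
    ← sum_jtFun_one_mul, Finset.mul_sum]
  refine Finset.sum_congr rfl fun lam _ => ?_
  have h1 := (jtFun_center (isShifted_shiftedRows lam) (sum_shiftedRows lam)).1
  rw [mul_assoc (classSum μ), jtFun_mul_of_mem_center (isShifted_shiftedRows lam)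
    (sum_shiftedRows lam) (classSum_mem_center μ), jtFun_mul_of_mem_center
    (isShifted_shiftedRows lam) (sum_shiftedRows lam) (classSum_mem_center ν)]
  simp only [centralChar]
  field_simp

/-! ### Power series in one of several variables -/

section MvSeries

variable {σ : Type*}

/-- The embedding of a single variable. -/
def varEmb (v : σ) : Unit ↪ σ := ⟨fun _ => v, fun _ _ _ => Subsingleton.elim _ _⟩

/-- A power series in the variable `v`. -/
noncomputable def seriesIn (v : σ) : PowerSeries ℚ →ₐ[ℚ] MvPowerSeries σ ℚ :=
  MvPowerSeries.rename (varEmb v)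

theorem coeff_single_seriesIn (v : σ) (f : PowerSeries ℚ) (m : ℕ) :
    MvPowerSeries.coeff (Finsupp.single v m) (seriesIn v f) = PowerSeries.coeff m f := by
  have h := MvPowerSeries.coeff_embDomain_rename (R := ℚ)
    (varEmb v) f (Finsupp.single () m)
  rw [Finsupp.embDomain_single] at h
  exact h

theorem coeff_seriesIn_of_ne (v : σ) (f : PowerSeries ℚ) {e : σ →₀ ℕ}
    (he : e ≠ Finsupp.single v (e v)) : MvPowerSeries.coeff e (seriesIn v f) = 0 := by
  refine MvPowerSeries.coeff_rename_eq_zero _ _ ?_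
  rintro ⟨x, rfl⟩
  apply he
  have hx : x = Finsupp.single () (x ()) := by
    ext
    simp
  have hv : varEmb v () = v := rfl
  rw [hx, Finsupp.mapDomain_single, hv, Finsupp.single_eq_same]

theorem seriesIn_X (v : σ) : seriesIn v PowerSeries.X = MvPowerSeries.X v :=
  MvPowerSeries.rename_X _ _

theorem seriesIn_C (v : σ) (r : ℚ) : seriesIn v (PowerSeries.C r) = MvPowerSeries.C r :=
  MvPowerSeries.rename_C _ _

/-- Since `g` does not involve v, the power of v must come entirely from the one-variable factor. -/
theorem coeff_mul_seriesIn (v : σ) (f : PowerSeries ℚ) {g : MvPowerSeries σ ℚ}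
    (hg : ∀ e : σ →₀ ℕ, e v ≠ 0 → MvPowerSeries.coeff e g = 0) (e : σ →₀ ℕ) :
    MvPowerSeries.coeff e (g * seriesIn v f) =
      MvPowerSeries.coeff (e.erase v) g * PowerSeries.coeff (e v) f := by
  classical
  rw [MvPowerSeries.coeff_mul, Finset.sum_eq_single (e.erase v, Finsupp.single v (e v))]
  · rw [coeff_single_seriesIn]
  · rintro ⟨p, q⟩ hp hne
    rw [Finset.HasAntidiagonal.mem_antidiagonal] at hp
    dsimp only at hp ⊢
    by_cases h1 : p v = 0
    · rw [coeff_seriesIn_of_ne, mul_zero]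
      intro h2
      apply hne
      have h3 : e v = q v := by rw [← hp, Finsupp.add_apply, h1, zero_add]
      rw [h3, ← h2, ← hp]
      congr 1
      ext u
      by_cases hu : u = v
      · rw [hu, h1, Finsupp.erase_same]
      · rw [Finsupp.erase_ne hu, Finsupp.add_apply, h2, Finsupp.single_eq_of_ne hu, add_zero]
    · rw [hg p h1, zero_mul]
  · intro h
    exact absurd (Finset.HasAntidiagonal.mem_antidiagonal.mpr (Finsupp.erase_add_single v e)) h

theorem coeff_prod_seriesIn [DecidableEq σ] (T : Finset σ) (f : σ → PowerSeries ℚ)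
    (e : σ →₀ ℕ) :
    MvPowerSeries.coeff e (∏ v ∈ T, seriesIn v (f v)) =
      if e.support ⊆ T then ∏ v ∈ T, PowerSeries.coeff (e v) (f v) else 0 := by
  induction T using Finset.induction_on generalizing e with
  | empty =>
    rw [Finset.prod_empty, Finset.prod_empty, MvPowerSeries.coeff_one]
    exact if_congr (by rw [Finset.subset_empty, Finsupp.support_eq_empty]) rfl rfl
  | insert v T hv ih =>
    rw [Finset.prod_insert hv, Finset.prod_insert hv, mul_comm, coeff_mul_seriesIn, ih,
      ite_mul, zero_mul]
    · have h1 : (e.erase v).support ⊆ T ↔ e.support ⊆ insert v T := by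
        rw [Finsupp.support_erase, ← Finset.subset_insert_iff]
      refine if_congr h1 ?_ rfl
      rw [mul_comm]
      congr 1
      refine Finset.prod_congr rfl fun u hu => ?_
      rw [Finsupp.erase_ne fun h : u = v => hv (by rwa [← h])]
    · intro e' he'
      rw [ih, if_neg]
      intro h
      exact hv (h (Finsupp.mem_support_iff.mpr he'))

/-- The algebra endomorphism which sends the variables outside of `S` to zero. -/
noncomputable def killOutside (S : Set σ) : MvPowerSeries σ ℚ →ₐ[ℚ] MvPowerSeries σ ℚ :=
  (MvPowerSeries.rename (Function.Embedding.subtype (· ∈ S))).comp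
    (MvPowerSeries.killCompl (Function.Embedding.subtype (· ∈ S)))

theorem coeff_killOutside_of_subset {S : Set σ} {e : σ →₀ ℕ} (he : (e.support : Set σ) ⊆ S)
    (f : MvPowerSeries σ ℚ) :
    MvPowerSeries.coeff e (killOutside S f) = MvPowerSeries.coeff e f := by
  obtain ⟨x, rfl⟩ : ∃ x, Finsupp.embDomain (Function.Embedding.subtype (· ∈ S)) x = e := by
    have h := (Finsupp.mem_range_embDomain_iff (Function.Embedding.subtype (· ∈ S)) e).mpr
      (by simpa using he)
    exact h
  rw [killOutside, AlgHom.comp_apply, MvPowerSeries.coeff_embDomain_rename,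
    MvPowerSeries.coeff_killCompl]

theorem coeff_killOutside_of_not_subset {S : Set σ} {e : σ →₀ ℕ}
    (he : ¬(e.support : Set σ) ⊆ S) (f : MvPowerSeries σ ℚ) :
    MvPowerSeries.coeff e (killOutside S f) = 0 := by
  classical
  rw [killOutside, AlgHom.comp_apply]
  refine MvPowerSeries.coeff_rename_eq_zero _ _ ?_
  rintro ⟨x, rfl⟩
  apply he
  intro u hu
  obtain ⟨y, -, rfl⟩ := Finset.mem_image.mp (Finsupp.mapDomain_support hu)
  exact y.2

/-- Each coefficient of the image is zero or a coefficient of the argument. Continuity lets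
`killOutside` pass through the infinite products, which then become finite when only finitely many
variables survive. -/
theorem continuous_killOutside (S : Set σ) : Continuous (killOutside S) := by
  refine continuous_pi fun e => ?_
  by_cases he : (e.support : Set σ) ⊆ S
  · exact (MvPowerSeries.WithPiTopology.continuous_coeff ℚ e).congr fun f =>
      (coeff_killOutside_of_subset he f).symm
  · exact continuous_const.congr fun f => (coeff_killOutside_of_not_subset he f).symm

theorem killOutside_C (S : Set σ) (r : ℚ) :
    killOutside S (MvPowerSeries.C r) = MvPowerSeries.C r :=
  AlgHom.commutes (killOutside S) r

theorem killOutside_X {S : Set σ} {v : σ} (hv : v ∈ S) :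
    killOutside S (MvPowerSeries.X v) = MvPowerSeries.X v := by
  have h := MvPowerSeries.killCompl_X (R := ℚ) (e := Function.Embedding.subtype (· ∈ S)) ⟨v, hv⟩
  rw [Function.Embedding.subtype_apply] at h
  rw [killOutside, AlgHom.comp_apply, h, MvPowerSeries.rename_X]
  rfl

theorem killOutside_X_of_notMem {S : Set σ} {v : σ} (hv : v ∉ S) :
    killOutside S (MvPowerSeries.X v) = 0 := by
  rw [killOutside, AlgHom.comp_apply, MvPowerSeries.killCompl_X_eq_zero, map_zero]
  simpa using hv

theorem killOutside_inv (S : Set σ) {f : MvPowerSeries σ ℚ}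
    (hf : MvPowerSeries.constantCoeff f = 1) : killOutside S f⁻¹ = (killOutside S f)⁻¹ := by
  have h : MvPowerSeries.constantCoeff (killOutside S f) = 1 := by
    rw [← MvPowerSeries.coeff_zero_eq_constantCoeff_apply, coeff_killOutside_of_subset (by simp),
      MvPowerSeries.coeff_zero_eq_constantCoeff_apply, hf]
  rw [MvPowerSeries.eq_inv_iff_mul_eq_one (by rw [h]; exact one_ne_zero), ← map_mul,
    MvPowerSeries.inv_mul_cancel _ (by rw [hf]; exact one_ne_zero), map_one]

end MvSeries

/-! ### The weights of the tau-function -/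

section Weights

variable {L M : Type*}

theorem killOutside_wProd (S : Set (Var L M)) (s : Finset L)
    (hs : ∀ a, a ∈ s ↔ Var.w a ∈ S) (x : ℤ) :
    killOutside S (wProd L M x) =
      ∏ a ∈ s, seriesIn (Var.w a) (1 + PowerSeries.C (x : ℚ) * PowerSeries.X) := by
  rw [wProd, (multipliable_wProd L M x).map_tprod (killOutside S) (continuous_killOutside S),
    tprod_eq_prod (s := s)]
  · refine Finset.prod_congr rfl fun a ha => ?_
    rw [map_add, map_add, map_mul, map_mul, map_one, map_one, killOutside_C, seriesIn_C, seriesIn_X,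
      killOutside_X ((hs a).mp ha)]
  · intro a ha
    rw [map_add, map_mul, map_one, killOutside_X_of_notMem fun h => ha ((hs a).mpr h), mul_zero,
      add_zero]

theorem killOutside_zProd (S : Set (Var L M)) (s : Finset M)
    (hs : ∀ b, b ∈ s ↔ Var.z b ∈ S) (x : ℤ) :
    killOutside S (zProd L M x) =
      ∏ b ∈ s, seriesIn (Var.z b) (1 - PowerSeries.C (x : ℚ) * PowerSeries.X) := by
  rw [zProd, (multipliable_zProd L M x).map_tprod (killOutside S) (continuous_killOutside S),
    tprod_eq_prod (s := s)]
  · refine Finset.prod_congr rfl fun a ha => ?_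
    rw [map_sub, map_sub, map_mul, map_mul, map_one, map_one, killOutside_C, seriesIn_C, seriesIn_X,
      killOutside_X ((hs a).mp ha)]
  · intro a ha
    rw [map_sub, map_mul, map_one, killOutside_X_of_notMem fun h => ha ((hs a).mpr h), mul_zero,
      sub_zero]

theorem constantCoeff_zProd (x : ℤ) : MvPowerSeries.constantCoeff (zProd L M x) = 1 := by
  rw [zProd, (multipliable_zProd L M x).map_tprod MvPowerSeries.constantCoeff
    (MvPowerSeries.WithPiTopology.continuous_constantCoeff ℚ)]
  refine (tprod_congr fun b => ?_).trans tprod_one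
  simp

theorem prod_seriesIn_inv {ι : Type*} (s : Finset ι) (u : ι → Var L M) (f : PowerSeries ℚ)
    (hf : PowerSeries.constantCoeff f = 1) :
    (∏ b ∈ s, seriesIn (u b) f)⁻¹ = ∏ b ∈ s, seriesIn (u b) f⁻¹ := by
  have h1 : (∏ b ∈ s, seriesIn (u b) f⁻¹) * ∏ b ∈ s, seriesIn (u b) f = 1 := by
    rw [← Finset.prod_mul_distrib]
    refine Finset.prod_eq_one fun b _ => ?_
    rw [← map_mul, PowerSeries.inv_mul_cancel _ (by rw [hf]; exact one_ne_zero), map_one]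
  symm
  refine (MvPowerSeries.eq_inv_iff_mul_eq_one ?_).mpr h1
  intro h0
  have h2 := congrArg MvPowerSeries.constantCoeff h1
  rw [map_mul, h0, mul_zero, map_one] at h2
  exact zero_ne_one h2

/-- The weight of a partition in the tau-function. -/
noncomputable def weight (L M : Type*) {n : ℕ} (lam : n.Partition) : Series L M :=
  ∏ x ∈ (diagram lam).cells, wProd L M (content x) * (zProd L M (content x))⁻¹

/-- The power series `∏ (1 - c X)⁻¹` over a multiset of values. -/
noncomputable def geomProd (s : Multiset ℚ) : PowerSeries ℚ :=
  (s.map fun c => 1 - PowerSeries.C c * PowerSeries.X).prod⁻¹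

theorem geomProd_eq (s : Multiset ℚ) :
    geomProd s = (s.map fun c => (1 - PowerSeries.C c * PowerSeries.X : PowerSeries ℚ)⁻¹).prod := by
  have h0 : ∀ c : ℚ, PowerSeries.constantCoeff
      (1 - PowerSeries.C c * PowerSeries.X : PowerSeries ℚ) ≠ 0 := fun c => by simp
  symm
  rw [geomProd, PowerSeries.eq_inv_iff_mul_eq_one, ← Multiset.prod_map_mul]
  · refine Multiset.prod_eq_one fun y hy => ?_
    obtain ⟨c, -, rfl⟩ := Multiset.mem_map.mp hy
    exact PowerSeries.inv_mul_cancel _ (h0 c)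
  · rw [map_multiset_prod, Multiset.map_map]
    simp

theorem killOutside_weight {n : ℕ} (lam : n.Partition) (S : Set (Var L M)) (s : Finset L)
    (hs : ∀ a, a ∈ s ↔ Var.w a ∈ S) (r : Finset M) (hr : ∀ b, b ∈ r ↔ Var.z b ∈ S) :
    killOutside S (weight L M lam) =
      (∏ a ∈ s, seriesIn (Var.w a) (linearProd (contents (shiftedRows lam)))) *
        ∏ b ∈ r, seriesIn (Var.z b) (geomProd (contents (shiftedRows lam))) := by
  have h1 := prod_cells_diagram lam fun c => (1 + PowerSeries.C c * PowerSeries.X : PowerSeries ℚ)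
  have h2 := prod_cells_diagram lam
    fun c => (1 - PowerSeries.C c * PowerSeries.X : PowerSeries ℚ)⁻¹
  rw [linearProd, geomProd_eq, ← h1, ← h2, weight, map_prod]
  simp_rw [map_prod]
  rw [Finset.prod_comm, Finset.prod_comm (s := r), ← Finset.prod_mul_distrib]
  refine Finset.prod_congr rfl fun x _ => ?_
  rw [map_mul, killOutside_inv S (constantCoeff_zProd _), killOutside_wProd S s hs,
    killOutside_zProd S r hr, prod_seriesIn_inv _ _ _ (by simp)]

/-- The weight is unchanged when v is set to zero, so no monomial involving v occurs. -/
theorem coeff_weight_eq_zero {n : ℕ} (lam : n.Partition) {e : Var L M →₀ ℕ} {v : Var L M}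
    (he : e v ≠ 0) (hw : ∀ a, v ≠ Var.w a) (hz : ∀ b, v ≠ Var.z b) :
    MvPowerSeries.coeff e (weight L M lam) = 0 := by
  have hinv : killOutside {v}ᶜ (weight L M lam) = weight L M lam := by
    have hwp : ∀ x, killOutside {v}ᶜ (wProd L M x) = wProd L M x := by
      intro x
      rw [wProd, (multipliable_wProd L M x).map_tprod _ (continuous_killOutside _)]
      refine tprod_congr fun a => ?_
      rw [map_add, map_mul, map_one, killOutside_C, killOutside_X (show Var.w a ∈ ({v}ᶜ : Set _) from
        fun h => hw a (Eq.symm h))]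
    have hzp : ∀ x, killOutside {v}ᶜ (zProd L M x) = zProd L M x := by
      intro x
      rw [zProd, (multipliable_zProd L M x).map_tprod _ (continuous_killOutside _)]
      refine tprod_congr fun a => ?_
      rw [map_sub, map_mul, map_one, killOutside_C, killOutside_X (show Var.z a ∈ ({v}ᶜ : Set _) from
        fun h => hz a (Eq.symm h))]
    rw [weight, map_prod]
    refine Finset.prod_congr rfl fun x _ => ?_
    rw [map_mul, hwp, killOutside_inv _ (constantCoeff_zProd _), hzp]
  rw [← hinv, coeff_killOutside_of_not_subset]
  intro h
  exact h (Finset.mem_coe.mpr (Finsupp.mem_support_iff.mpr he)) rfl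

theorem w_injective : Function.Injective (Var.w : L → Var L M) := fun a b h => by cases h; rfl

theorem z_injective : Function.Injective (Var.z : M → Var L M) := fun a b h => by cases h; rfl

theorem p_injective : Function.Injective (Var.p : ℕ+ → Var L M) := fun a b h => by cases h; rfl

theorem pt_injective : Function.Injective (Var.pt : ℕ+ → Var L M) := fun a b h => by cases h; rfl

/-- Setting the variables outside of the two lists to zero keeps this coefficient and leaves a
finite product of one-variable series. -/
theorem coeff_weight {n : ℕ} (lam : n.Partition) (c : L →₀ ℕ) (d : M →₀ ℕ) (s : Finset L)
    (r : Finset M) (hs : ∀ a, a ∉ s → c a = 0) (hr : ∀ b, b ∉ r → d b = 0) :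
    MvPowerSeries.coeff (c.mapDomain Var.w + d.mapDomain Var.z) (weight L M lam) =
      (∏ a ∈ s, PowerSeries.coeff (c a) (linearProd (contents (shiftedRows lam)))) *
        ∏ b ∈ r, PowerSeries.coeff (d b) (geomProd (contents (shiftedRows lam))) := by
  classical
  let T : Finset (Var L M) := s.image Var.w ∪ r.image Var.z
  let f : Var L M → PowerSeries ℚ := fun v => match v with
    | Var.w _ => linearProd (contents (shiftedRows lam))
    | _ => geomProd (contents (shiftedRows lam))
  have hdisj : Disjoint (s.image (Var.w : L → Var L M)) (r.image Var.z) := by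
    rw [Finset.disjoint_left]
    intro v hv hv'
    obtain ⟨a, -, rfl⟩ := Finset.mem_image.mp hv
    obtain ⟨b, -, h⟩ := Finset.mem_image.mp hv'
    cases h
  have hw0 : ∀ a, (d.mapDomain Var.z : Var L M →₀ ℕ) (Var.w a) = 0 := fun a =>
    Finsupp.mapDomain_of_notMem_range _ _ fun ⟨b, h⟩ => by cases h
  have hz0 : ∀ b, (c.mapDomain Var.w : Var L M →₀ ℕ) (Var.z b) = 0 := fun a =>
    Finsupp.mapDomain_of_notMem_range _ _ fun ⟨b, h⟩ => by cases h
  have hsupp : (c.mapDomain Var.w + d.mapDomain Var.z : Var L M →₀ ℕ).support ⊆ T := by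
    refine Finsupp.support_add.trans (Finset.union_subset_union
      (Finsupp.mapDomain_support.trans (Finset.image_subset_image fun a ha => ?_))
      (Finsupp.mapDomain_support.trans (Finset.image_subset_image fun b hb => ?_)))
    · by_contra h
      exact Finsupp.mem_support_iff.mp ha (hs a h)
    · by_contra h
      exact Finsupp.mem_support_iff.mp hb (hr b h)
  have hprod : ∀ {A : Type} [CommMonoid A] (G : Var L M → A),
      ∏ v ∈ T, G v = (∏ a ∈ s, G (Var.w a)) * ∏ b ∈ r, G (Var.z b) := by
    intro A _ G
    rw [Finset.prod_union hdisj, Finset.prod_image w_injective.injOn,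
      Finset.prod_image z_injective.injOn]
  have hprod' : ∏ v ∈ T, seriesIn v (f v) =
      (∏ a ∈ s, seriesIn (Var.w a : Var L M) (linearProd (contents (shiftedRows lam)))) *
        ∏ b ∈ r, seriesIn (Var.z b) (geomProd (contents (shiftedRows lam))) := by
    rw [Finset.prod_union hdisj, Finset.prod_image w_injective.injOn,
      Finset.prod_image z_injective.injOn]
  rw [← coeff_killOutside_of_subset (S := (T : Set (Var L M))) (Finset.coe_subset.mpr hsupp),
    killOutside_weight lam T s _ r, ← hprod', coeff_prod_seriesIn, if_pos hsupp, hprod]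
  · congr 1
    · refine Finset.prod_congr rfl fun a _ => ?_
      rw [Finsupp.add_apply, Finsupp.mapDomain_apply w_injective, hw0, add_zero]
    · refine Finset.prod_congr rfl fun b _ => ?_
      rw [Finsupp.add_apply, Finsupp.mapDomain_apply z_injective, hz0, zero_add]
  · intro b
    rw [Finset.mem_coe, Finset.mem_union, Finset.mem_image, Finset.mem_image]
    refine ⟨fun h => Or.inr ⟨b, h, rfl⟩, ?_⟩
    rintro (⟨a, -, h⟩ | ⟨b', h, h'⟩)
    · cases h
    · rwa [← z_injective h']
  · intro a
    rw [Finset.mem_coe, Finset.mem_union, Finset.mem_image, Finset.mem_image]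
    refine ⟨fun h => Or.inl ⟨a, h, rfl⟩, ?_⟩
    rintro (⟨a', h, h'⟩ | ⟨b, -, h⟩)
    · rwa [← w_injective h']
    · cases h

end Weights

/-! ### The coefficients of the tau-function -/

section TauCoeff

variable {L M : Type*}

/-- In the rescaled times the power sum k t_k is the variable itself. -/
theorem prod_map_powerSum (u : ℕ+ → Var L M) (s : Multiset ℕ) (hs : ∀ k ∈ s, 0 < k) :
    (s.map (powerSum fun k : ℕ+ =>
      (((k : ℕ) : ℚ)⁻¹ • MvPowerSeries.X (u k) : Series L M))).prod =
      MvPowerSeries.monomial ((Finsupp.comapDomain PNat.val (Multiset.toFinsupp s)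
        PNat.coe_injective.injOn).mapDomain u) 1 := by
  induction s using Multiset.induction_on with
  | empty =>
    rw [Multiset.map_zero, Multiset.prod_zero, map_zero, Finsupp.comapDomain_zero,
      Finsupp.mapDomain_zero, MvPowerSeries.monomial_zero_one]
  | cons k s ih =>
    obtain ⟨j, rfl⟩ : ∃ j : ℕ+, (j : ℕ) = k := ⟨⟨k, hs k (Multiset.mem_cons_self k s)⟩, rfl⟩
    have h1 : Finsupp.comapDomain PNat.val (Multiset.toFinsupp ((j : ℕ) ::ₘ s))
        PNat.coe_injective.injOn = Finsupp.single j 1 +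
          Finsupp.comapDomain PNat.val (Multiset.toFinsupp s) PNat.coe_injective.injOn := by
      ext i
      rw [Finsupp.comapDomain_apply, Multiset.toFinsupp_apply, Finsupp.add_apply,
        Finsupp.comapDomain_apply, Multiset.toFinsupp_apply, Multiset.count_cons,
        Finsupp.single_apply, add_comm]
      congr 1
      exact if_congr ⟨fun h => PNat.eq h.symm, fun h => congrArg PNat.val h.symm⟩ rfl rfl
    have h2 : powerSum (fun k : ℕ+ => (((k : ℕ) : ℚ)⁻¹ • MvPowerSeries.X (u k) : Series L M)) j =
        MvPowerSeries.X (u j) := by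
      rw [powerSum_of_pos _ j.pos, ← nsmul_eq_mul, ← Nat.cast_smul_eq_nsmul ℚ, smul_smul]
      have hj : ((j : ℕ) : ℚ) ≠ 0 := by exact_mod_cast j.ne_zero
      exact (congrArg (· • _) (mul_inv_cancel₀ hj)).trans (one_smul _ _)
    rw [Multiset.map_cons, Multiset.prod_cons, ih fun i hi => hs i (Multiset.mem_cons_of_mem hi),
      h1, h2, Finsupp.mapDomain_add, Finsupp.mapDomain_single, MvPowerSeries.X,
      MvPowerSeries.monomial_mul_monomial, one_mul]

theorem schur_eq_sum_monomial (u : ℕ+ → Var L M) {n : ℕ} (lam : n.Partition) :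
    schur (fun k : ℕ+ => (((k : ℕ) : ℚ)⁻¹ • MvPowerSeries.X (u k) : Series L M)) (diagram lam) =
      ∑ μ : n.Partition, MvPowerSeries.monomial ((partExp μ).mapDomain u)
        ((n.factorial : ℚ)⁻¹ * jtFun ℚ (shiftedRows lam) (classSum μ)) := by
  rw [schur_diagram, jacobiTrudi_eq_sum _ _ (sum_shiftedRows lam), sum_perm_eq_sum_partition,
    Finset.smul_sum]
  refine Finset.sum_congr rfl fun μ _ => ?_
  have h1 : jtFun ℚ (shiftedRows lam) (classSum μ) =
      ∑ g : Equiv.Perm (Fin n) with g.partition.parts = μ.parts,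
        (jtChar (shiftedRows lam) g : ℚ) := by
    rw [classSum, map_sum]
    exact Finset.sum_congr rfl fun g _ => by rw [jtFun_single, one_mul]
  rw [h1, ← smul_eq_mul, map_smul, map_sum]
  congr 1
  refine Finset.sum_congr rfl fun g hg => ?_
  rw [cycleProd, (Finset.mem_filter.mp hg).2, prod_map_powerSum u _ fun k hk => μ.parts_pos hk,
    ← zsmul_eq_mul, ← Int.cast_smul_eq_zsmul ℚ, ← map_smul, smul_eq_mul, mul_one]
  rfl

theorem tauExp_q {n k k' : ℕ} (c : L →₀ ℕ) (d : M →₀ ℕ) (μ : k.Partition) (ν : k'.Partition) :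
    tauExp n c d μ ν Var.q = n := by
  simp only [tauExp, Finsupp.add_apply, Finsupp.single_eq_same]
  rw [Finsupp.mapDomain_of_notMem_range _ _ (fun ⟨_, h⟩ => by cases h),
    Finsupp.mapDomain_of_notMem_range _ _ (fun ⟨_, h⟩ => by cases h),
    Finsupp.mapDomain_of_notMem_range _ _ (fun ⟨_, h⟩ => by cases h),
    Finsupp.mapDomain_of_notMem_range _ _ (fun ⟨_, h⟩ => by cases h)]
  rfl

theorem tauExp_p {n k k' : ℕ} (c : L →₀ ℕ) (d : M →₀ ℕ) (μ : k.Partition) (ν : k'.Partition)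
    (j : ℕ+) : tauExp n c d μ ν (Var.p j) = partExp μ j := by
  simp only [tauExp, Finsupp.add_apply]
  rw [Finsupp.mapDomain_of_notMem_range c _ (fun ⟨_, h⟩ => by cases h),
    Finsupp.mapDomain_of_notMem_range d _ (fun ⟨_, h⟩ => by cases h),
    Finsupp.mapDomain_of_notMem_range (partExp ν) _ (fun ⟨_, h⟩ => by cases h),
    Finsupp.mapDomain_apply p_injective, Finsupp.single_eq_of_ne (by intro h; cases h)]
  simp

theorem tauExp_pt {n k k' : ℕ} (c : L →₀ ℕ) (d : M →₀ ℕ) (μ : k.Partition) (ν : k'.Partition)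
    (j : ℕ+) : tauExp n c d μ ν (Var.pt j) = partExp ν j := by
  simp only [tauExp, Finsupp.add_apply]
  rw [Finsupp.mapDomain_of_notMem_range c _ (fun ⟨_, h⟩ => by cases h),
    Finsupp.mapDomain_of_notMem_range d _ (fun ⟨_, h⟩ => by cases h),
    Finsupp.mapDomain_of_notMem_range (partExp μ) _ (fun ⟨_, h⟩ => by cases h),
    Finsupp.mapDomain_apply pt_injective, Finsupp.single_eq_of_ne (by intro h; cases h)]
  simp

theorem tauExp_eq_add {n k k' : ℕ} (c : L →₀ ℕ) (d : M →₀ ℕ) (μ : k.Partition)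
    (ν : k'.Partition) : tauExp n c d μ ν =
      tauExp n 0 0 μ ν + (c.mapDomain Var.w + d.mapDomain Var.z) := by
  simp only [tauExp, Finsupp.mapDomain_zero, add_zero]
  abel

theorem parts_eq_of_partExp {k k' : ℕ} {μ : k.Partition} {ν : k'.Partition}
    (h : ∀ j, partExp μ j = partExp ν j) : μ.parts = ν.parts := by
  ext j
  rcases Nat.eq_zero_or_pos j with rfl | hj
  · rw [Multiset.count_eq_zero_of_notMem fun h => lt_irrefl _ (μ.parts_pos h),
      Multiset.count_eq_zero_of_notMem fun h => lt_irrefl _ (ν.parts_pos h)]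
  · obtain ⟨i, rfl⟩ : ∃ i : ℕ+, (i : ℕ) = j := ⟨⟨j, hj⟩, rfl⟩
    have h1 := h i
    rw [partExp, partExp, Finsupp.comapDomain_apply, Finsupp.comapDomain_apply,
      Multiset.toFinsupp_apply, Multiset.toFinsupp_apply] at h1
    exact h1

theorem tauExp_congr {n m k k' l l' : ℕ} {c : L →₀ ℕ} {d : M →₀ ℕ} {μ : k.Partition}
    {ν : k'.Partition} {μ' : l.Partition} {ν' : l'.Partition} (hn : m = n)
    (hμ : μ'.parts = μ.parts) (hν : ν'.parts = ν.parts) :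
    tauExp m c d μ' ν' = tauExp n c d μ ν := by
  simp only [tauExp, partExp, hn, hμ, hν]

/-- The weight contains no q and no times, so the monomial in front must match these exponents
exactly; divisibility alone is not enough. -/
theorem coeff_monomial_mul_weight {n m k k' : ℕ} (c : L →₀ ℕ) (d : M →₀ ℕ) (μ : k.Partition)
    (ν : k'.Partition) (lam μ' ν' : m.Partition) (r : ℚ) :
    MvPowerSeries.coeff (tauExp n c d μ ν)
      (MvPowerSeries.monomial (tauExp m 0 0 μ' ν') r * weight L M lam) =
      if m = n ∧ μ'.parts = μ.parts ∧ ν'.parts = ν.parts then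
        r * MvPowerSeries.coeff (c.mapDomain Var.w + d.mapDomain Var.z) (weight L M lam)
      else 0 := by
  rw [MvPowerSeries.coeff_monomial_mul]
  split_ifs with hle h h
  · congr 2
    have h1 : tauExp n c d μ ν =
        tauExp m 0 0 μ' ν' + (c.mapDomain Var.w + d.mapDomain Var.z) := by
      rw [tauExp_eq_add, tauExp_congr h.1 h.2.1 h.2.2]
    rw [h1, add_tsub_cancel_left]
  · by_contra hne
    have h1 : ∀ v : Var L M, (∀ a, v ≠ Var.w a) → (∀ b, v ≠ Var.z b) →
        tauExp m (0 : L →₀ ℕ) (0 : M →₀ ℕ) μ' ν' v = tauExp n c d μ ν v := by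
      intro v hw hz
      by_contra h2
      refine hne (mul_eq_zero_of_right _ (coeff_weight_eq_zero lam (v := v) ?_ hw hz))
      have h3 := hle v
      rw [Finsupp.tsub_apply]
      omega
    apply h
    refine ⟨?_, parts_eq_of_partExp fun j => ?_, parts_eq_of_partExp fun j => ?_⟩
    · have h2 := h1 Var.q (by intro a h; cases h) (by intro a h; cases h)
      rwa [tauExp_q, tauExp_q] at h2
    · have h2 := h1 (Var.p j) (by intro a h; cases h) (by intro a h; cases h)
      rwa [tauExp_p, tauExp_p] at h2
    · have h2 := h1 (Var.pt j) (by intro a h; cases h) (by intro a h; cases h)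
      rwa [tauExp_pt, tauExp_pt] at h2
  · exfalso
    apply hle
    have h1 : tauExp n c d μ ν =
        tauExp m 0 0 μ' ν' + (c.mapDomain Var.w + d.mapDomain Var.z) := by
      rw [tauExp_eq_add, tauExp_congr h.1 h.2.1 h.2.2]
    rw [h1]
    exact le_self_add
  · rfl

theorem tauTerm_eq_sum (L M : Type*) (m : ℕ) : tauTerm L M m =
    ∑ lam : m.Partition, ∑ μ : m.Partition, ∑ ν : m.Partition,
      MvPowerSeries.monomial (tauExp m 0 0 μ ν)
        (((m.factorial : ℚ)⁻¹ * jtFun ℚ (shiftedRows lam) (classSum μ)) *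
          ((m.factorial : ℚ)⁻¹ * jtFun ℚ (shiftedRows lam) (classSum ν))) * weight L M lam := by
  rw [tauTerm, Finset.mul_sum]
  refine Finset.sum_congr rfl fun lam _ => ?_
  have h1 : schur (timeT L M) (diagram lam) = _ := schur_eq_sum_monomial Var.p lam
  have h2 : schur (timeTt L M) (diagram lam) = _ := schur_eq_sum_monomial Var.pt lam
  rw [h1, h2, ← weight, mul_assoc, Finset.sum_mul_sum, mul_left_comm, Finset.mul_sum,
    Finset.mul_sum]
  refine Finset.sum_congr rfl fun μ _ => ?_
  rw [Finset.mul_sum, Finset.mul_sum]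
  refine Finset.sum_congr rfl fun ν _ => ?_
  rw [MvPowerSeries.X_pow_eq, MvPowerSeries.monomial_mul_monomial,
    MvPowerSeries.monomial_mul_monomial, one_mul, mul_comm, tauExp, Finsupp.mapDomain_zero,
    Finsupp.mapDomain_zero, add_zero, add_zero, add_assoc]

theorem coeff_tau (e : Var L M →₀ ℕ) (n : ℕ)
    (h : ∀ m, m ≠ n → MvPowerSeries.coeff e (tauTerm L M m) = 0) :
    MvPowerSeries.coeff e (tau L M) = MvPowerSeries.coeff e (tauTerm L M n) := by
  rw [tau, (summable_tauTerm L M).map_tsum (MvPowerSeries.coeff (R := ℚ) e)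
    (MvPowerSeries.WithPiTopology.continuous_coeff ℚ e), tsum_eq_single n h]

theorem coeff_tauTerm {n m k k' : ℕ} (c : L →₀ ℕ) (d : M →₀ ℕ) (μ : k.Partition)
    (ν : k'.Partition) : MvPowerSeries.coeff (tauExp n c d μ ν) (tauTerm L M m) =
      ∑ lam : m.Partition, ∑ μ' : m.Partition, ∑ ν' : m.Partition,
        if m = n ∧ μ'.parts = μ.parts ∧ ν'.parts = ν.parts then
          ((m.factorial : ℚ)⁻¹ * jtFun ℚ (shiftedRows lam) (classSum μ')) *
            ((m.factorial : ℚ)⁻¹ * jtFun ℚ (shiftedRows lam) (classSum ν')) *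
          MvPowerSeries.coeff (c.mapDomain Var.w + d.mapDomain Var.z) (weight L M lam)
        else 0 := by
  rw [tauTerm_eq_sum]
  simp_rw [map_sum, coeff_monomial_mul_weight]

theorem coeff_tauTerm_eq_zero {n m k k' : ℕ} (c : L →₀ ℕ) (d : M →₀ ℕ) (μ : k.Partition)
    (ν : k'.Partition) (h : ¬(m = n ∧ m = k ∧ m = k')) :
    MvPowerSeries.coeff (tauExp n c d μ ν) (tauTerm L M m) = 0 := by
  rw [coeff_tauTerm]
  refine Finset.sum_eq_zero fun lam _ => Finset.sum_eq_zero fun μ' _ =>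
    Finset.sum_eq_zero fun ν' _ => if_neg ?_
  rintro ⟨h1, h2, h3⟩
  apply h
  refine ⟨h1, ?_, ?_⟩
  · rw [← μ'.parts_sum, h2, μ.parts_sum]
  · rw [← ν'.parts_sum, h3, ν.parts_sum]

theorem coeff_tau_eq_zero {n k k' : ℕ} (c : L →₀ ℕ) (d : M →₀ ℕ) (μ : k.Partition)
    (ν : k'.Partition) (h : ¬(k = n ∧ k' = n)) :
    MvPowerSeries.coeff (tauExp n c d μ ν) (tau L M) = 0 := by
  have h1 : ∀ m, MvPowerSeries.coeff (tauExp n c d μ ν) (tauTerm L M m) = 0 := fun m =>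
    coeff_tauTerm_eq_zero c d μ ν (by omega)
  rw [coeff_tau _ 0 fun m _ => h1 m, h1]

theorem coeff_tau_eq_sum {n : ℕ} (c : L →₀ ℕ) (d : M →₀ ℕ) (μ ν : n.Partition) :
    MvPowerSeries.coeff (tauExp n c d μ ν) (tau L M) =
      ∑ lam : n.Partition,
        ((n.factorial : ℚ)⁻¹ * jtFun ℚ (shiftedRows lam) (classSum μ)) *
          ((n.factorial : ℚ)⁻¹ * jtFun ℚ (shiftedRows lam) (classSum ν)) *
          MvPowerSeries.coeff (c.mapDomain Var.w + d.mapDomain Var.z) (weight L M lam) := by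
  rw [coeff_tau _ n fun m hm => coeff_tauTerm_eq_zero c d μ ν (by omega), coeff_tauTerm]
  refine Finset.sum_congr rfl fun lam _ => ?_
  rw [Finset.sum_eq_single μ, Finset.sum_eq_single ν, if_pos ⟨rfl, rfl, rfl⟩]
  · exact fun ν' _ h => if_neg fun h' => h (Nat.Partition.ext h'.2.2)
  · exact fun h => absurd (Finset.mem_univ _) h
  · exact fun μ' _ h => Finset.sum_eq_zero fun ν' _ =>
      if_neg fun h' => h (Nat.Partition.ext h'.2.1)
  · exact fun h => absurd (Finset.mem_univ _) h

/-- Both sides are sums over λ with identical character factors, so only the coefficient of the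
weight has to be matched with the central character of the product of blocks. -/
theorem coeff_tau_eq_hurwitz {n : ℕ} (c : L →₀ ℕ) (d : M →₀ ℕ) {la : List L} {lb : List M}
    (hla : la.Nodup) (hc : ∀ a, a ∉ la → c a = 0) (hlb : lb.Nodup) (hd : ∀ b, b ∉ lb → d b = 0)
    (μ ν : n.Partition) :
    MvPowerSeries.coeff (tauExp n c d μ ν) (tau L M) =
      hurwitz μ ν ((la.map fun a => strictMonoBlock n (c a)).prod *
        (lb.map fun b => monoBlock n (d b)).prod) := by
  classical
  rw [coeff_tau_eq_sum, hurwitz_eq_sum]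
  refine Finset.sum_congr rfl fun lam _ => ?_
  congr 1
  have hl := isShifted_shiftedRows lam
  have hn := sum_shiftedRows lam
  have h1 : ∀ z ∈ la.map fun a => strictMonoBlock n (c a), z ∈ Subalgebra.center ℚ (GA n) := by
    intro z hz
    obtain ⟨a, -, rfl⟩ := List.mem_map.mp hz
    exact strictMonoBlock_mem_center n _
  have h2 : ∀ z ∈ lb.map fun b => monoBlock n (d b), z ∈ Subalgebra.center ℚ (GA n) := by
    intro z hz
    obtain ⟨b, -, rfl⟩ := List.mem_map.mp hz
    exact monoBlock_mem_center n _
  rw [centralChar_mul hl hn (Subalgebra.list_prod_mem _ h1), centralChar_list_prod hl hn _ h1,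
    centralChar_list_prod hl hn _ h2, List.map_map, List.map_map,
    coeff_weight lam c d la.toFinset lb.toFinset (by simpa using hc) (by simpa using hd),
    List.prod_toFinset _ hla, List.prod_toFinset _ hlb]
  congr 2
  · exact List.map_congr_left fun a _ => (centralChar_strictMonoBlock hl hn _).symm
  · exact List.map_congr_left fun b _ => (centralChar_monoBlock hl hn _).symm

end TauCoeff

/-! ### Parity -/

/-- The automorphism of the group algebra which twists by the sign. -/
noncomputable def signTwist (n : ℕ) : GA n →ₐ[ℚ] GA n :=
  MonoidAlgebra.lift ℚ _ _
    { toFun := fun g => MonoidAlgebra.single g ((Equiv.Perm.sign g : ℤ) : ℚ)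
      map_one' := by simp [MonoidAlgebra.one_def]
      map_mul' := fun g h => by simp [MonoidAlgebra.single_mul_single] }

theorem signTwist_single {n : ℕ} (g : Equiv.Perm (Fin n)) (r : ℚ) :
    signTwist n (MonoidAlgebra.single g r) =
      ((Equiv.Perm.sign g : ℤ) : ℚ) • MonoidAlgebra.single g r := by
  rw [signTwist, MonoidAlgebra.lift_single]
  simp [mul_comm]

theorem coeff_one_signTwist {n : ℕ} (x : GA n) : (signTwist n x).coeff 1 = x.coeff 1 := by
  induction x using MonoidAlgebra.induction_linear with
  | zero => rw [map_zero]
  | add x y hx hy =>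
    rw [map_add, MonoidAlgebra.coeff_add, MonoidAlgebra.coeff_add, Finsupp.add_apply,
      Finsupp.add_apply, hx, hy]
  | single g r =>
    rw [signTwist_single, MonoidAlgebra.coeff_smul_apply, MonoidAlgebra.coeff_single]
    by_cases hg : g = 1
    · rw [hg, Equiv.Perm.sign_one]
      simp
    · rw [Finsupp.single_eq_of_ne (Ne.symm hg), smul_zero]

/-- The sign is the parity of n - ℓ; the sum n + ℓ has the same parity and avoids truncated
subtraction. -/
theorem sign_eq_neg_one_pow {n : ℕ} (g : Equiv.Perm (Fin n)) :
    ((Equiv.Perm.sign g : ℤ) : ℚ) = (-1) ^ (n + Multiset.card g.partition.parts) := by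
  have h1 : Multiset.card g.partition.parts + g.cycleType.sum = Multiset.card g.cycleType + n := by
    have h2 := g.sum_cycleType_le
    rw [Fintype.card_fin] at h2
    rw [Equiv.Perm.parts_partition, Multiset.card_add, Multiset.card_replicate,
      ← Equiv.Perm.sum_cycleType, Fintype.card_fin]
    omega
  have h3 : n + Multiset.card g.partition.parts + 2 * g.cycleType.sum =
      g.cycleType.sum + Multiset.card g.cycleType + 2 * n := by omega
  rw [Equiv.Perm.sign_of_cycleType]
  push_cast
  have h4 := congrArg (fun k => (-1 : ℚ) ^ k) h3
  simp only [pow_add _ _ (2 * _), pow_mul, neg_one_sq, one_pow, mul_one] at h4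
  exact h4.symm

theorem signTwist_classSum {n : ℕ} (α : n.Partition) :
    signTwist n (classSum α) = (-1 : ℚ) ^ (n + len α) • classSum α := by
  rw [classSum, map_sum, Finset.smul_sum]
  refine Finset.sum_congr rfl fun g hg => ?_
  rw [signTwist_single, sign_eq_neg_one_pow, (Finset.mem_filter.mp hg).2, len]

theorem signTwist_jucysMurphy (n : ℕ) (k : Fin (n - 1)) :
    signTwist n (jucysMurphy n k) = -jucysMurphy n k := by
  rw [jucysMurphy, map_sum, ← Finset.sum_neg_distrib]
  refine Finset.sum_congr rfl fun i hi => ?_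
  rw [signTwist_single, Equiv.Perm.sign_swap]
  · simp
  · intro h
    have h1 := (Finset.mem_filter.mp hi).2
    rw [h] at h1
    exact lt_irrefl _ h1

theorem prod_ofFn_neg {A : Type*} [Ring A] {b : ℕ} (x : Fin b → A) :
    (List.ofFn fun i => -x i).prod = (-1) ^ b * (List.ofFn x).prod := by
  induction b with
  | zero => simp
  | succ b ih =>
    rw [List.ofFn_succ, List.ofFn_succ, List.prod_cons, List.prod_cons, ih, pow_succ, mul_assoc,
      neg_mul, ← mul_assoc, ((Commute.neg_one_right (x 0)).pow_right b).eq]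
    simp [mul_assoc]

theorem signTwist_strictMonoBlock (n b : ℕ) :
    signTwist n (strictMonoBlock n b) = (-1 : ℚ) ^ b • strictMonoBlock n b := by
  rw [strictMonoBlock, ← AlgHom.coe_toRingHom, map_elemSym]
  simp_rw [AlgHom.coe_toRingHom, signTwist_jucysMurphy]
  rw [elemSym, elemSym, Finset.smul_sum]
  refine Finset.sum_congr rfl fun f _ => ?_
  rw [prod_ofFn_neg, Algebra.smul_def, map_pow, map_neg, map_one]

theorem signTwist_monoBlock (n b : ℕ) :
    signTwist n (monoBlock n b) = (-1 : ℚ) ^ b • monoBlock n b := by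
  rw [monoBlock, ← AlgHom.coe_toRingHom, map_complSym]
  simp_rw [AlgHom.coe_toRingHom, signTwist_jucysMurphy]
  rw [complSym, complSym, Finset.smul_sum]
  refine Finset.sum_congr rfl fun f _ => ?_
  rw [prod_ofFn_neg, Algebra.smul_def, map_pow, map_neg, map_one]

theorem signTwist_list_prod {n : ℕ} {ι : Type*} (l : List ι) (B : ℕ → GA n)
    (hB : ∀ b, signTwist n (B b) = (-1 : ℚ) ^ b • B b) (c : ι → ℕ) :
    signTwist n (l.map fun a => B (c a)).prod =
      (-1 : ℚ) ^ (l.map c).sum • (l.map fun a => B (c a)).prod := by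
  induction l with
  | nil => simp
  | cons a l ih =>
    simp only [List.map_cons, List.prod_cons, List.sum_cons, map_mul]
    rw [ih, hB, smul_mul_smul_comm, pow_add]

theorem sum_map_eq_finsuppSum {ι : Type*} {l : List ι} (hl : l.Nodup) (c : ι →₀ ℕ)
    (hc : ∀ a, a ∉ l → c a = 0) : (l.map c).sum = c.sum fun _ m => m := by
  classical
  rw [← List.sum_toFinset _ hl, Finsupp.sum]
  symm
  refine Finset.sum_subset (fun a ha => ?_) fun a _ ha => Finsupp.notMem_support_iff.mp ha
  by_contra h
  exact Finsupp.mem_support_iff.mp ha (hc a (by simpa using h))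

/-- The Riemann-Hurwitz equation. -/
theorem exists_genus {L M : Type*} {n : ℕ} (c : L →₀ ℕ) (d : M →₀ ℕ) {la : List L} {lb : List M}
    (hla : la.Nodup) (hc : ∀ a, a ∉ la → c a = 0) (hlb : lb.Nodup) (hd : ∀ b, b ∉ lb → d b = 0)
    (μ ν : n.Partition)
    (h : hurwitz μ ν ((la.map fun a => strictMonoBlock n (c a)).prod *
        (lb.map fun b => monoBlock n (d b)).prod) ≠ 0) :
    ∃ g : ℤ, (((c.sum fun _ m => m) + (d.sum fun _ m => m) : ℕ) : ℤ) =
      2 * g - 2 + len μ + len ν := by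
  rw [← sum_map_eq_finsuppSum hla c hc, ← sum_map_eq_finsuppSum hlb d hd]
  have h1 := right_ne_zero_of_mul h
  set x := classSum μ * classSum ν * ((la.map fun a => strictMonoBlock n (c a)).prod *
        (lb.map fun b => monoBlock n (d b)).prod) with hx
  -- Each factor is an eigenvector of the sign twist. The twist preserves the coefficient of the
  -- identity, so a nonzero coefficient forces an even exponent.
  have h2 : signTwist n x = (-1 : ℚ) ^ ((n + len μ) + (n + len ν) +
      ((la.map c).sum + (lb.map d).sum)) • x := by
    rw [hx, map_mul, map_mul, map_mul, signTwist_classSum, signTwist_classSum,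
      signTwist_list_prod la _ (signTwist_strictMonoBlock n),
      signTwist_list_prod lb _ (signTwist_monoBlock n), smul_mul_smul_comm, smul_mul_smul_comm,
      smul_mul_smul_comm, ← pow_add, ← pow_add, ← pow_add]
  have h3 := coeff_one_signTwist x
  rw [h2, MonoidAlgebra.coeff_smul_apply, smul_eq_mul, mul_eq_right₀ h1] at h3
  have h4 := (neg_one_pow_eq_one_iff_even (by norm_num)).mp h3
  obtain ⟨r, hr⟩ := h4
  -- Solved from 2n + ℓ(μ) + ℓ(ν) + ∑ c + ∑ d = 2r.
  exact ⟨r + 1 - n - len μ - len ν, by omega⟩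

end HarnadOrlov

theorem mainTheorem11 {L M : Type*} :
    -- the blocks are central, and the two descriptions of them agree
    (∀ n b : ℕ,
      HarnadOrlov.strictMonoBlock n b ∈ Subalgebra.center ℚ (HarnadOrlov.GA n) ∧
      HarnadOrlov.monoBlock n b ∈ Subalgebra.center ℚ (HarnadOrlov.GA n) ∧
      HarnadOrlov.strictMonoBlock n b = HarnadOrlov.freeSingleBlock n b ∧
      HarnadOrlov.monoBlock n b = HarnadOrlov.freeGroupBlock n b) ∧
    -- the coefficients of the tau-function are Hurwitz numbers;
    -- `la` and `lb` list, in any order, indices outside of which `c` and `d` vanish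
    (∀ (n : ℕ) (c : L →₀ ℕ) (d : M →₀ ℕ) (la : List L) (lb : List M),
      la.Nodup → (∀ a, a ∉ la → c a = 0) → lb.Nodup → (∀ b, b ∉ lb → d b = 0) →
      ∀ μ ν : n.Partition,
        MvPowerSeries.coeff (HarnadOrlov.tauExp n c d μ ν) (HarnadOrlov.tau L M) =
          HarnadOrlov.hurwitz μ ν
            ((la.map fun a => HarnadOrlov.strictMonoBlock n (c a)).prod *
              (lb.map fun b => HarnadOrlov.monoBlock n (d b)).prod) ∧
        MvPowerSeries.coeff (HarnadOrlov.tauExp n c d μ ν) (HarnadOrlov.tau L M) =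
          HarnadOrlov.hurwitz μ ν
            ((la.map fun a => HarnadOrlov.freeSingleBlock n (c a)).prod *
              (lb.map fun b => HarnadOrlov.freeGroupBlock n (d b)).prod) ∧
        -- a nonzero coefficient satisfies the Riemann-Hurwitz equation for an integer genus
        (MvPowerSeries.coeff (HarnadOrlov.tauExp n c d μ ν) (HarnadOrlov.tau L M) ≠ 0 →
          ∃ g : ℤ, (((c.sum fun _ m => m) + (d.sum fun _ m => m) : ℕ) : ℤ) =
            2 * g - 2 + HarnadOrlov.len μ + HarnadOrlov.len ν)) ∧
    -- all the other coefficients vanish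
    (∀ (n : ℕ) (c : L →₀ ℕ) (d : M →₀ ℕ) (k k' : ℕ) (μ : k.Partition) (ν : k'.Partition),
      ¬(k = n ∧ k' = n) →
        MvPowerSeries.coeff (HarnadOrlov.tauExp n c d μ ν) (HarnadOrlov.tau L M) = 0) := by
  refine ⟨fun n b => ⟨HarnadOrlov.strictMonoBlock_mem_center n b,
    HarnadOrlov.monoBlock_mem_center n b, HarnadOrlov.strictMonoBlock_eq_freeSingleBlock n b,
    HarnadOrlov.monoBlock_eq_freeGroupBlock n b⟩, ?_, ?_⟩
  · intro n c d la lb hla hc hlb hd μ ν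
    have h := HarnadOrlov.coeff_tau_eq_hurwitz c d hla hc hlb hd μ ν
    refine ⟨h, ?_, fun h0 => ?_⟩
    · simp_rw [← HarnadOrlov.strictMonoBlock_eq_freeSingleBlock,
        ← HarnadOrlov.monoBlock_eq_freeGroupBlock]
      exact h
    · rw [h] at h0
      exact HarnadOrlov.exists_genus c d hla hc hlb hd μ ν h0
  · intro n c d k k' μ ν h
    exact HarnadOrlov.coeff_tau_eq_zero c d μ ν h
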